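/- Let $V_6$ be the complex vector space with basis $e_0,\dots,e_5$ and homogeneous coordinates $x_0,\dots,x_5$ on $\mathbf P(V_6)$, and write $e_{ijk}=e_i\wedge e_j\wedge e_k$. Let $\mathbb A\subset\bigwedge^3V_6$ be the Klein Lagrangian, that is, the $10$-dimensional subspace (Lagrangian for the wedge product) spanned by $$e_{012}+e_{245},\quad e_{013}-e_{345},\quad e_{014}+e_{123},\quad e_{015}-e_{134},\quad e_{023}+e_{135},$$ $$e_{024}-e_{145},\quad e_{025}+e_{234},\quad e_{034}+e_{124},\quad e_{035}-e_{125},\quad e_{045}+e_{235}.$$ For $\ell\ge 0$, let $$Y_{\mathbb A}^{\ge\ell}=\bigl\{[x]\in\mathbf P(V_6)\;\big|\;\dim\bigl(\mathbb A\cap(x\wedge\textstyle\bigwedge^2V_6)\bigr)\ge\ell\bigr\},$$ with its structure of closed subscheme of $\mathbf P(V_6)$ as the locus where the map $x\wedge\bigwedge^2V_6\to\bigwedge^3V_6/\mathbb A$ between spaces of dimension $10$ has rank at most $10-\ell$ (defined by the vanishing of its minors of size $11-\ell$), and let $Y_{\mathbb A}=Y_{\mathbb A}^{\ge1}$ be the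 Klein EPW sextic. Then the scheme $Y_{\mathbb A}$ is the hypersurface in $\mathbf P(V_6)$ defined by the equation $$\begin{aligned} &x_0^6+ 2x_0^3(x_1x_3^2+x_2x_4^2+x_3x_5^2+x_4x_1^2+x_5x_2^2)-4x_0(x_1^3x_2^2+ x_2^3x_3^2+ x_3^3x_4^2+x_4^3x_5^2+x_5^3x_1^2)\\ &{}+4x_0(x_1x_3x_4^3+x_2x_4x_5^3+x_3x_5x_1^3+ x_4x_1x_2^3 + x_5x_2x_3^3)-12x_0x_1x_2x_3x_4x_5\\ &{}+x_1^2x_3^4+x_2^2x_4^4 +x_3^2x_5^4+x_4^2x_1^4+x_5^2x_2^4 -4(x_1x_4x_5^4+x_2x_5x_1^4+x_3x_1x_2^4+x_4x_2x_3^4+x_5x_3x_4^4) \\ &{}-2(x_1x_3^3x_5^2+x_2x_4^3x_1^2+x_3x_5^3x_2^2+x_4x_1^3x_3^2+x_5x_2^3x_4^2)\\ &{}+6(x_1x_2x_3^2x_4^2+x_2x_3x_4^2x_5^2+x_3x_4x_5^2x_1^2+x_4x_5 x_1^2x_2^2 + x_5x_1x_2^2x_3^2)=0. \end{aligned}$$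 The singular locus of $Y_{\mathbb A}$ is, as a set, $Y_{\mathbb A}^{\ge2}$. The scheme $Y_{\mathbb A}^{\ge2}$ is a smooth irreducible surface over $\mathbf C$, and the scheme $Y_{\mathbb A}^{\ge3}$ is empty. -/

import Mathlib

open AlgebraicGeometry CategoryTheory
open scoped ExteriorAlgebra

namespace KleinEPW

noncomputable section

/-! ### Closed subschemes of `ℙ⁵` over `ℂ` -/

/-- The homogeneous coordinate ring `ℂ[x₀, …, x₅]`. -/
abbrev CoordRing : Type := MvPolynomial (Fin 6) ℂ

/-- Its grading by degree. -/
abbrev grading : ℕ → Submodule ℂ CoordRing := MvPolynomial.homogeneousSubmodule (Fin 6) ℂ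

instance gradedAlgebraGrading : GradedAlgebra grading := MvPolynomial.gradedAlgebra

/-- Projective space `ℙ(V₆) = Proj ℂ[x₀, …, x₅]`, whose closed points are the lines in `V₆`. -/
abbrev P5 : Scheme := Proj grading

/-- The structure morphism `ℙ(V₆) ⟶ Spec ℂ`. -/
def P5.toSpec : P5 ⟶ Spec (CommRingCat.of ℂ) :=
  Proj.toSpecZero grading ≫ Spec.map (CommRingCat.ofHom (algebraMap ℂ (grading 0)))

theorem X_mem_grading (i : Fin 6) : (MvPolynomial.X i : CoordRing) ∈ grading 1 :=
  MvPolynomial.isHomogeneous_X ℂ i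

/-- For a homogeneous ideal `I` of `ℂ[x₀, …, x₅]`, the degree-zero part of the localization `I_{xᵢ}`,
an ideal of the coordinate ring `ℂ[x₀, …, x₅]_(xᵢ)` of the chart `xᵢ ≠ 0`. -/
def chartIdeal (I : Ideal CoordRing) (i : Fin 6) :
    Ideal (HomogeneousLocalization.Away grading (MvPolynomial.X i : CoordRing)) :=
  (I.map (algebraMap CoordRing (Localization.Away (MvPolynomial.X i : CoordRing)))).comap
    (algebraMap (HomogeneousLocalization.Away grading (MvPolynomial.X i : CoordRing))
      (Localization.Away (MvPolynomial.X i : CoordRing)))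

/-- The closed subscheme of the chart `xᵢ ≠ 0` cut out by `I`, as a morphism to `ℙ(V₆)`. -/
def chartMap (I : Ideal CoordRing) (i : Fin 6) :
    Spec (CommRingCat.of
      (HomogeneousLocalization.Away grading (MvPolynomial.X i : CoordRing) ⧸ chartIdeal I i)) ⟶ P5 :=
  Spec.map (CommRingCat.ofHom (Ideal.Quotient.mk (chartIdeal I i))) ≫
    Proj.awayι grading (MvPolynomial.X i) (X_mem_grading i) Nat.one_pos

/-- The ideal sheaf on `ℙ(V₆)` attached to a homogeneous ideal `I`: the functions whose restriction
to each of the six standard charts lies in the ideal of that chart given by `I`. -/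
def idealSheaf (I : Ideal CoordRing) : P5.IdealSheafData :=
  ⨅ i : Fin 6, (chartMap I i).ker

/-- The points of `X` at which a morphism `X ⟶ S` is not smooth. When `S` is the spectrum of a
field of characteristic zero and `X` is locally of finite type, this is the singular locus of `X`,
the set of points whose local ring is not regular. -/
def singularLocus {X S : Scheme} (f : X ⟶ S) : Set X :=
  {x | ¬ ∃ U : X.Opens, x ∈ U ∧ Smooth (U.ι ≫ f)}

/-! ### The degeneracy schemes `Y_A^{≥ ℓ}` -/

/-- The six-dimensional complex vector space `V₆`. -/
abbrev V6 : Type := Fin 6 → ℂ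

/-- The standard basis `e₀, …, e₅` of `V₆`. -/
def e (i : Fin 6) : V6 := Pi.single i 1

/-- The wedge product `x ∧ w ∈ ⋀³V₆` of `x ∈ V₆` and `w ∈ ⋀²V₆`. -/
def wedge (x : V6) (w : ⋀[ℂ]^2 V6) : ⋀[ℂ]^3 V6 :=
  ⟨ExteriorAlgebra.ι ℂ x * (w : ExteriorAlgebra ℂ V6), by
    rw [ExteriorAlgebra.exteriorPower, pow_succ']
    exact Submodule.mul_mem_mul (LinearMap.mem_range_self _ x) w.2⟩

/-- Let `x = x₀e₀ + ⋯ + x₅e₅` be the universal vector. For `w ∈ ⋀²V₆` and a linear form `φ` on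
`⋀³V₆ / A`, this is `φ (x ∧ w)`, as a linear form in `x₀, …, x₅`. -/
def pairing (A : Submodule ℂ (⋀[ℂ]^3 V6)) (φ : Module.Dual ℂ (⋀[ℂ]^3 V6 ⧸ A)) (w : ⋀[ℂ]^2 V6) :
    CoordRing :=
  ∑ i : Fin 6, MvPolynomial.C (φ (A.mkQ (wedge (e i) w))) * MvPolynomial.X i

/-- For a Lagrangian subspace `A` of `⋀³V₆` (so `dim A = 10`), the homogeneous ideal of
`Y_A^{≥ ℓ} = {[x] | dim (A ∩ (x ∧ ⋀²V₆)) ≥ ℓ}`.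

The space `x ∧ ⋀²V₆` has dimension `10`, so the condition on `[x]` is that the map
`x ∧ ⋀²V₆ → ⋀³V₆ / A` between spaces of dimension `10` has rank at most `10 - ℓ`. As usual, the
scheme structure is the one given by the minors of size `11 - ℓ` of this map. They are taken here
with respect to arbitrary families of linear forms on the target and of vectors `x ∧ w` of the
source. -/
def degeneracyIdeal (A : Submodule ℂ (⋀[ℂ]^3 V6)) (ℓ : ℕ) : Ideal CoordRing :=
  Ideal.span {p | ∃ (φ : Fin (11 - ℓ) → Module.Dual ℂ (⋀[ℂ]^3 V6 ⧸ A))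
    (w : Fin (11 - ℓ) → ⋀[ℂ]^2 V6), p = (Matrix.of fun a b => pairing A (φ a) (w b)).det}

/-- The closed subscheme `Y_A^{≥ ℓ}` of `ℙ(V₆)`, for a Lagrangian subspace `A` of `⋀³V₆`. -/
def Y (A : Submodule ℂ (⋀[ℂ]^3 V6)) (ℓ : ℕ) : Scheme :=
  (idealSheaf (degeneracyIdeal A ℓ)).subscheme

/-- The closed immersion of `Y_A^{≥ ℓ}` in `ℙ(V₆)`. -/
def Y.emb (A : Submodule ℂ (⋀[ℂ]^3 V6)) (ℓ : ℕ) : Y A ℓ ⟶ P5 :=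
  (idealSheaf (degeneracyIdeal A ℓ)).subschemeι

/-- The structure morphism `Y_A^{≥ ℓ} ⟶ Spec ℂ`. -/
def Y.toSpec (A : Submodule ℂ (⋀[ℂ]^3 V6)) (ℓ : ℕ) : Y A ℓ ⟶ Spec (CommRingCat.of ℂ) :=
  Y.emb A ℓ ≫ P5.toSpec

/-! ### The Klein Lagrangian and the sextic -/

/-- The vector `e_{ijk} = eᵢ ∧ eⱼ ∧ eₖ`. -/
def e3 (i j k : Fin 6) : ⋀[ℂ]^3 V6 := exteriorPower.ιMulti ℂ 3 ![e i, e j, e k]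

/-- The Klein Lagrangian `𝔸`: the graph `{e₀ ∧ x + v(x) | x ∈ ⋀²V_ξ}`, with `V_ξ = ⟨e₁, …, e₅⟩`, of
the isomorphism `v : ⋀²V_ξ → ⋀³V_ξ` with `v(e₁₂) = e₂₄₅`, `v(e₁₃) = -e₃₄₅`, `v(e₁₄) = e₁₂₃`,
`v(e₁₅) = -e₁₃₄`, `v(e₂₃) = e₁₃₅`, `v(e₂₄) = -e₁₄₅`, `v(e₂₅) = e₂₃₄`, `v(e₃₄) = e₁₂₄`,
`v(e₃₅) = -e₁₂₅`, `v(e₄₅) = e₂₃₅`. -/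
def kleinLagrangian : Submodule ℂ (⋀[ℂ]^3 V6) :=
  Submodule.span ℂ
    {e3 0 1 2 + e3 2 4 5, e3 0 1 3 - e3 3 4 5, e3 0 1 4 + e3 1 2 3, e3 0 1 5 - e3 1 3 4,
      e3 0 2 3 + e3 1 3 5, e3 0 2 4 - e3 1 4 5, e3 0 2 5 + e3 2 3 4, e3 0 3 4 + e3 1 2 4,
      e3 0 3 5 - e3 1 2 5, e3 0 4 5 + e3 2 3 5}

/-- The sextic form `F`, evaluated at elements `x₀, …, x₅` of a commutative ring. -/
def sexticForm {R : Type*} [CommRing R] (x₀ x₁ x₂ x₃ x₄ x₅ : R) : R :=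
  x₀ ^ 6
  + 2 * x₀ ^ 3 * (x₁ * x₃ ^ 2 + x₂ * x₄ ^ 2 + x₃ * x₅ ^ 2 + x₄ * x₁ ^ 2 + x₅ * x₂ ^ 2)
  - 4 * x₀ * (x₁ ^ 3 * x₂ ^ 2 + x₂ ^ 3 * x₃ ^ 2 + x₃ ^ 3 * x₄ ^ 2 + x₄ ^ 3 * x₅ ^ 2
      + x₅ ^ 3 * x₁ ^ 2)
  + 4 * x₀ * (x₁ * x₃ * x₄ ^ 3 + x₂ * x₄ * x₅ ^ 3 + x₃ * x₅ * x₁ ^ 3 + x₄ * x₁ * x₂ ^ 3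
      + x₅ * x₂ * x₃ ^ 3)
  - 12 * x₀ * x₁ * x₂ * x₃ * x₄ * x₅
  + x₁ ^ 2 * x₃ ^ 4 + x₂ ^ 2 * x₄ ^ 4 + x₃ ^ 2 * x₅ ^ 4 + x₄ ^ 2 * x₁ ^ 4 + x₅ ^ 2 * x₂ ^ 4
  - 4 * (x₁ * x₄ * x₅ ^ 4 + x₂ * x₅ * x₁ ^ 4 + x₃ * x₁ * x₂ ^ 4 + x₄ * x₂ * x₃ ^ 4
      + x₅ * x₃ * x₄ ^ 4)
  - 2 * (x₁ * x₃ ^ 3 * x₅ ^ 2 + x₂ * x₄ ^ 3 * x₁ ^ 2 + x₃ * x₅ ^ 3 * x₂ ^ 2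
      + x₄ * x₁ ^ 3 * x₃ ^ 2 + x₅ * x₂ ^ 3 * x₄ ^ 2)
  + 6 * (x₁ * x₂ * x₃ ^ 2 * x₄ ^ 2 + x₂ * x₃ * x₄ ^ 2 * x₅ ^ 2 + x₃ * x₄ * x₅ ^ 2 * x₁ ^ 2
      + x₄ * x₅ * x₁ ^ 2 * x₂ ^ 2 + x₅ * x₁ * x₂ ^ 2 * x₃ ^ 2)

/-- The sextic form `F` as a polynomial. -/
def kleinSextic : CoordRing :=
  sexticForm (.X 0) (.X 1) (.X 2) (.X 3) (.X 4) (.X 5)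

end

end KleinEPW

/-! Write A for the Klein Lagrangian and F for the sextic.

Equation. The ten forms `bC` cut out A, and the wedge pairing on ⋀³V₆ is the antisymmetrization of ∑
aC·bC. Where xᵢ ≠ 0, the space x ∧ ⋀²V₆ is parametrized by the bivectors without i-component. The
degeneracy ideals therefore become ideals of minors of a single 10 × 10 matrix of linear forms,
`bMat i x` (`map_degeneracyIdeal`). Its determinant is -xᵢ⁴F (`det_bMat_X`), so F defines the first
degeneracy scheme on every chart.

Local structure. Near a point p of corank c, a Schur complement replaces `bMat` by a c × c matrix m
vanishing at p (`nonempty_localForm`). Since x ∧ ⋀²V₆ is isotropic, m is symmetric up to a factor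
that is invertible near p. The differential of m_{ab} at p is, up to a nonzero constant, t ↦ t ∧ p ∧
κ_a ∧ κ_b, where the p ∧ κ_a form a basis of A ∩ (p ∧ ⋀²V₆). Locally F is a unit times det m, so F
vanishes at p to order at least c.

Coranks. If c ≥ 3, all second partials of F vanish at p, which an explicit elimination excludes for
p ≠ 0 (`LocalForm.lt_three`). The other input is that A contains no nonzero decomposable vector
(`tht_self_ne_zero`). In corank one this gives p ∧ κ ∧ κ ≠ 0, so F has nonzero differential; hence
the singular points are exactly those of corank two (`degeneracyIdeal_two_le_iff`). In corank two it
forces the three differentials to be independent (`tht_independent`), so the second degeneracy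
scheme is smooth of codimension three.

Irreducibility. A Noetherian local ring whose maximal ideal is generated by as many elements as its
dimension is a domain, so exactly one component of the singular locus passes through each of its
points (`eq_of_le_pointIdeal`). The cone over a component has dimension at least three there, so the
component meets every linear space x₀ = xᵢ = 0 (`exists_section`). For i ≠ 0 the only singular
points on that space are coordinate points (`IsSing.mul_eq_zero`). Following components from one
coordinate point to another with the cyclic symmetry of x₁, …, x₅ links all five points, so there is
a single component (`isPrime_singIdeal`).

Schemes. The chart xᵢ ≠ 0 of the subscheme of a homogeneous ideal I is the spectrum of ℂ[x₀, …,
x₅]/(I + (xᵢ - 1)) (`dehom_mem_chartIdeal`). Smoothness there follows from the Jacobian criterion.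
At a singular point of F it is refuted by the lifting property of formally smooth algebras
(`not_smooth_of_isSing`). Statements checked at closed points extend to all primes by the
Nullstellensatz (`mem_of_vanishing`). -/

namespace KleinEPW

noncomputable section

/-! ### Coordinates on the exterior powers -/

section Coordinates

variable {R : Type*} [CommRing R]

/-- Coordinates of the wedge product of a vector with an alternating array. -/
def wdg (x : Fin 6 → R) (w : Fin 6 → Fin 6 → R) : Fin 6 → Fin 6 → Fin 6 → R :=
  fun i j k => x i * w j k - x j * w i k + x k * w i j

/-- The coordinates along the vectors `e_{0jk}`. -/
def aC (η : Fin 6 → Fin 6 → Fin 6 → R) : Fin 10 → R :=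
  ![η 0 1 2, η 0 1 3, η 0 1 4, η 0 1 5, η 0 2 3, η 0 2 4, η 0 2 5, η 0 3 4, η 0 3 5, η 0 4 5]

/-- Ten linear forms cutting out the Klein Lagrangian, in the basis dual to the one of `aC`. -/
def bC (η : Fin 6 → Fin 6 → Fin 6 → R) : Fin 10 → R :=
  ![η 3 4 5 + η 0 1 3, -η 2 4 5 + η 0 1 2, η 2 3 5 - η 0 4 5, -η 2 3 4 + η 0 2 5,
    η 1 4 5 + η 0 2 4, -η 1 3 5 + η 0 2 3, η 1 3 4 + η 0 1 5, η 1 2 5 + η 0 3 5,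
    -η 1 2 4 + η 0 3 4, η 1 2 3 - η 0 1 4]

theorem bC_add (η η' : Fin 6 → Fin 6 → Fin 6 → R) : bC (η + η') = bC η + bC η' := by
  ext s; fin_cases s <;> simp [bC] <;> ring

theorem bC_smul (c : R) (η : Fin 6 → Fin 6 → Fin 6 → R) : bC (c • η) = c • bC η := by
  ext s; fin_cases s <;> simp [bC] <;> ring

/-- `bC` as a linear map. -/
def bL (R : Type*) [CommRing R] : (Fin 6 → Fin 6 → Fin 6 → R) →ₗ[R] (Fin 10 → R) where
  toFun := bC
  map_add' := bC_add
  map_smul' := bC_smul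

theorem aC_add (η η' : Fin 6 → Fin 6 → Fin 6 → R) : aC (η + η') = aC η + aC η' := by
  ext s; fin_cases s <;> simp [aC]

theorem aC_smul (c : R) (η : Fin 6 → Fin 6 → Fin 6 → R) : aC (c • η) = c • aC η := by
  ext s; fin_cases s <;> simp [aC]

theorem bC_map {S : Type*} [CommRing S] (f : R →+* S) (η : Fin 6 → Fin 6 → Fin 6 → R) (s : Fin 10) :
    f (bC η s) = bC (fun i j k => f (η i j k)) s := by
  fin_cases s <;> simp [bC]

theorem aC_map {S : Type*} [CommRing S] (f : R →+* S) (η : Fin 6 → Fin 6 → Fin 6 → R) (s : Fin 10) :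
    f (aC η s) = aC (fun i j k => f (η i j k)) s := by
  fin_cases s <;> simp [aC]

theorem wdg_map {S : Type*} [CommRing S] (f : R →+* S) (x : Fin 6 → R) (w : Fin 6 → Fin 6 → R) :
    (fun i j k => f (wdg x w i j k)) = wdg (fun i => f (x i)) (fun j k => f (w j k)) := by
  funext i j k; simp [wdg]

theorem wdg_add_left (x y : Fin 6 → R) (w : Fin 6 → Fin 6 → R) :
    wdg (x + y) w = wdg x w + wdg y w := by
  funext i j k; simp [wdg]; ring

theorem wdg_smul_left (c : R) (x : Fin 6 → R) (w : Fin 6 → Fin 6 → R) :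
    wdg (c • x) w = c • wdg x w := by
  funext i j k; simp [wdg]; ring

theorem wdg_add_right (x : Fin 6 → R) (w w' : Fin 6 → Fin 6 → R) :
    wdg x (w + w') = wdg x w + wdg x w' := by
  funext i j k; simp [wdg]; ring

theorem wdg_smul_right (c : R) (x : Fin 6 → R) (w : Fin 6 → Fin 6 → R) :
    wdg x (c • w) = c • wdg x w := by
  funext i j k; simp [wdg]; ring

/-- `wdg` as a linear map in the vector. -/
def wdgL (w : Fin 6 → Fin 6 → R) : (Fin 6 → R) →ₗ[R] (Fin 6 → Fin 6 → Fin 6 → R) where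
  toFun x := wdg x w
  map_add' x y := wdg_add_left x y w
  map_smul' c x := wdg_smul_left c x w

/-- `wdg` as a linear map in the array. -/
def wdgR (x : Fin 6 → R) : (Fin 6 → Fin 6 → R) →ₗ[R] (Fin 6 → Fin 6 → Fin 6 → R) where
  toFun w := wdg x w
  map_add' w w' := wdg_add_right x w w'
  map_smul' c w := wdg_smul_right c x w

/-- The subspaces `x ∧ ⋀²V₆` are isotropic. -/
theorem isotropic (x : Fin 6 → R) (w w' : Fin 6 → Fin 6 → R) :
    ∑ s, aC (wdg x w) s * bC (wdg x w') s = ∑ s, aC (wdg x w') s * bC (wdg x w) s := by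
  -- Each `bC` is the signed coordinate complementary to the corresponding `aC`, plus a symmetric
  -- matrix applied to `aC`. The difference of the two sides is thus the coefficient of (x ∧ w) ∧ (x
  -- ∧ w'), which is zero.
  simp only [Fin.sum_univ_succ, aC, bC, wdg]
  simp
  ring

/-- Alternating arrays. -/
def IsAlt (w : Fin 6 → Fin 6 → R) : Prop := (∀ i, w i i = 0) ∧ ∀ i j, w j i = -w i j

end Coordinates

/-- The coordinates of a vector of `⋀³V₆`. -/
def coord3 : ⋀[ℂ]^3 V6 →ₗ[ℂ] (Fin 6 → Fin 6 → Fin 6 → ℂ) :=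
  LinearMap.pi fun i => LinearMap.pi fun j => LinearMap.pi fun k =>
    exteriorPower.alternatingMapLinearEquiv
      (Matrix.detRowAlternating.compLinearMap (LinearMap.funLeft ℂ ℂ ![i, j, k]))

/-- The coordinates of a vector of `⋀²V₆`. -/
def coord2 : ⋀[ℂ]^2 V6 →ₗ[ℂ] (Fin 6 → Fin 6 → ℂ) :=
  LinearMap.pi fun i => LinearMap.pi fun j =>
    exteriorPower.alternatingMapLinearEquiv
      (Matrix.detRowAlternating.compLinearMap (LinearMap.funLeft ℂ ℂ ![i, j]))

theorem coord3_ιMulti (v : Fin 3 → V6) (i j k : Fin 6) :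
    coord3 (exteriorPower.ιMulti ℂ 3 v) i j k = (Matrix.of fun a b => v a (![i, j, k] b)).det := by
  simp [coord3]; rfl

theorem coord2_ιMulti (v : Fin 2 → V6) (i j : Fin 6) :
    coord2 (exteriorPower.ιMulti ℂ 2 v) i j = v 0 i * v 1 j - v 0 j * v 1 i := by
  have : coord2 (exteriorPower.ιMulti ℂ 2 v) i j = (Matrix.of fun a b => v a (![i, j] b)).det := by
    simp [coord2]; rfl
  rw [this, Matrix.det_fin_two]
  simp

theorem wedge_ιMulti (x : V6) (v : Fin 2 → V6) :
    wedge x (exteriorPower.ιMulti ℂ 2 v) = exteriorPower.ιMulti ℂ 3 ![x, v 0, v 1] := by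
  ext
  simp [wedge, exteriorPower.ιMulti_apply_coe, ExteriorAlgebra.ιMulti_apply]
  rfl

/-- `wedge` as a linear map in the second argument. -/
def wedgeL (x : V6) : ⋀[ℂ]^2 V6 →ₗ[ℂ] ⋀[ℂ]^3 V6 where
  toFun := wedge x
  map_add' w w' := by ext; simp [wedge, mul_add]
  map_smul' c w := by ext; simp [wedge]

theorem coord3_wedge (x : V6) (w : ⋀[ℂ]^2 V6) : coord3 (wedge x w) = wdg x (coord2 w) := by
  have : coord3 ∘ₗ wedgeL x = wdgR x ∘ₗ coord2 := by
    apply exteriorPower.linearMap_ext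
    ext v : 1
    funext i j k
    change coord3 (wedge x (exteriorPower.ιMulti ℂ 2 v)) i j k = wdg x (coord2 (exteriorPower.ιMulti ℂ 2 v)) i j k
    rw [wedge_ιMulti, coord3_ιMulti, wdg, coord2_ιMulti, coord2_ιMulti, coord2_ιMulti, Matrix.det_fin_three]
    simp
    ring
  exact LinearMap.congr_fun this w

theorem isAlt_coord2 (w : ⋀[ℂ]^2 V6) : IsAlt (coord2 w) := by
  constructor
  · intro i
    have : LinearMap.proj i ∘ₗ LinearMap.proj i ∘ₗ coord2 = 0 := by
      apply exteriorPower.linearMap_ext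
      ext v : 1
      change coord2 (exteriorPower.ιMulti ℂ 2 v) i i = 0
      rw [coord2_ιMulti]; ring
    exact LinearMap.congr_fun this w
  · intro i j
    have : LinearMap.proj i ∘ₗ LinearMap.proj j ∘ₗ coord2 =
        -(LinearMap.proj j ∘ₗ LinearMap.proj i ∘ₗ coord2) := by
      apply exteriorPower.linearMap_ext
      ext v : 1
      change coord2 (exteriorPower.ιMulti ℂ 2 v) j i = -coord2 (exteriorPower.ιMulti ℂ 2 v) i j
      rw [coord2_ιMulti, coord2_ιMulti]; ring
    exact LinearMap.congr_fun this w

theorem exists_coord2_eq (w : Fin 6 → Fin 6 → ℂ) (hw : IsAlt w) : ∃ ω, coord2 ω = w := by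
  -- The factor 1/2 is there because the sum runs over ordered pairs and meets each eⱼ ∧ eₖ twice.
  refine ⟨∑ j, ∑ k, (w j k / 2) • exteriorPower.ιMulti ℂ 2 ![e j, e k], ?_⟩
  funext l m
  simp only [map_sum, map_smul, Finset.sum_apply, Pi.smul_apply, coord2_ιMulti]
  simp only [e, Matrix.cons_val_zero, Matrix.cons_val_one, Pi.single_apply, smul_eq_mul, mul_sub,
    Finset.sum_sub_distrib, mul_ite, mul_one, mul_zero]
  simp
  rw [hw.2 l m]; ring

theorem linearMap_ext_e3 {M : Type*} [AddCommGroup M] [Module ℂ M] (f g : ⋀[ℂ]^3 V6 →ₗ[ℂ] M)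
    (h : ∀ i j k : Fin 6, i < j → j < k → f (e3 i j k) = g (e3 i j k)) : f = g := by
  apply ((Pi.basisFun ℂ (Fin 6)).exteriorPower 3).ext
  intro s
  rw [exteriorPower.basis_apply]
  have h1 : exteriorPower.ιMulti_family ℂ 3 (Pi.basisFun ℂ (Fin 6)) s =
      e3 (Set.powersetCard.ofFinEmbEquiv.symm s 0) (Set.powersetCard.ofFinEmbEquiv.symm s 1)
        (Set.powersetCard.ofFinEmbEquiv.symm s 2) := by
    rw [exteriorPower.ιMulti_family, e3]
    congr 1
    ext a : 1
    fin_cases a <;> simp [e]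
  rw [h1]
  apply h <;> simp

/-- The coordinates of `e_{ijk}` are the minors of permutation matrices. -/
def e3Coord (i j k a b c : Fin 6) : ℤ :=
  let δ : Fin 6 → Fin 6 → ℤ := fun p q => if q = p then 1 else 0
  δ i a * (δ j b * δ k c - δ j c * δ k b) - δ i b * (δ j a * δ k c - δ j c * δ k a) +
    δ i c * (δ j a * δ k b - δ j b * δ k a)

theorem coord3_e3 (i j k : Fin 6) :
    coord3 (e3 i j k) = fun a b c => ((e3Coord i j k a b c : ℤ) : ℂ) := by
  funext a b c
  rw [e3, coord3_ιMulti, Matrix.det_fin_three]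
  simp only [e, e3Coord, Pi.single_apply, Matrix.of_apply, Matrix.cons_val_zero,
    Matrix.cons_val_one, Matrix.cons_val, Int.cast_add, Int.cast_sub, Int.cast_mul, Int.cast_ite,
    Int.cast_one, Int.cast_zero]
  ring

/-- Moves the values on basis vectors into ℤ, where they can be decided. -/
theorem bC_coord3_e3 (i j k : Fin 6) (s : Fin 10) :
    bC (coord3 (e3 i j k)) s = ((bC (e3Coord i j k) s : ℤ) : ℂ) := by
  rw [coord3_e3]
  exact (bC_map (Int.castRingHom ℂ) _ s).symm

/-- The Klein Lagrangian lies in the common kernel of the forms `bC`. -/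
theorem bC_coord3_of_mem {η : ⋀[ℂ]^3 V6} (h : η ∈ kleinLagrangian) : bC (coord3 η) = 0 := by
  have : kleinLagrangian ≤ LinearMap.ker (bL ℂ ∘ₗ coord3) := by
    rw [kleinLagrangian, Submodule.span_le]
    intro η hη
    simp only [Set.mem_insert_iff, Set.mem_singleton_iff] at hη
    have key : ∀ (i j k l m n : Fin 6),
        (∀ s, bC (e3Coord i j k) s + bC (e3Coord l m n) s = 0) →
        (bL ℂ ∘ₗ coord3) (e3 i j k + e3 l m n) = 0 := by
      intro i j k l m n h
      rw [map_add]
      funext s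
      change bC (coord3 _) s + bC (coord3 _) s = 0
      rw [bC_coord3_e3, bC_coord3_e3]
      exact_mod_cast h s
    have key' : ∀ (i j k l m n : Fin 6),
        (∀ s, bC (e3Coord i j k) s - bC (e3Coord l m n) s = 0) →
        (bL ℂ ∘ₗ coord3) (e3 i j k - e3 l m n) = 0 := by
      intro i j k l m n h
      rw [map_sub]
      funext s
      change bC (coord3 _) s - bC (coord3 _) s = 0
      rw [bC_coord3_e3, bC_coord3_e3]
      exact_mod_cast h s
    rw [SetLike.mem_coe, LinearMap.mem_ker]
    rcases hη with rfl | rfl | rfl | rfl | rfl | rfl | rfl | rfl | rfl | rfl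
    · exact key _ _ _ _ _ _ (by decide)
    · exact key' _ _ _ _ _ _ (by decide)
    · exact key _ _ _ _ _ _ (by decide)
    · exact key' _ _ _ _ _ _ (by decide)
    · exact key _ _ _ _ _ _ (by decide)
    · exact key' _ _ _ _ _ _ (by decide)
    · exact key _ _ _ _ _ _ (by decide)
    · exact key _ _ _ _ _ _ (by decide)
    · exact key' _ _ _ _ _ _ (by decide)
    · exact key _ _ _ _ _ _ (by decide)
  exact this h

/-- The linear form on `⋀³V₆ / 𝔸` with given coordinates. -/
def dualForm (c : Fin 10 → ℂ) : Module.Dual ℂ (⋀[ℂ]^3 V6 ⧸ kleinLagrangian) :=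
  kleinLagrangian.liftQ ((∑ s, c s • LinearMap.proj s) ∘ₗ bL ℂ ∘ₗ coord3) (by
    intro η hη
    have : bC (coord3 η) = 0 := bC_coord3_of_mem hη
    simp [bL, this])

theorem dualForm_mkQ (c : Fin 10 → ℂ) (η : ⋀[ℂ]^3 V6) :
    dualForm c (kleinLagrangian.mkQ η) = ∑ s, c s * bC (coord3 η) s := by
  simp [dualForm, bL]

/-- Each of the twenty coordinates occurs in exactly one of the ten forms `bC`, with coefficient ±1,
so a single coefficient of `c` survives on each basis vector. -/
theorem dualForm_e3 (c : Fin 10 → ℂ) {i j k : Fin 6} (n : Fin 10) (ε : ℤ)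
    (h : ∀ s, bC (e3Coord i j k) s = if s = n then ε else 0) :
    dualForm c (kleinLagrangian.mkQ (e3 i j k)) = ε * c n := by
  rw [dualForm_mkQ]
  simp [bC_coord3_e3, h, mul_comm]

theorem exists_dualForm_eq (φ : Module.Dual ℂ (⋀[ℂ]^3 V6 ⧸ kleinLagrangian)) :
    ∃ c, φ = dualForm c := by
  set ψ := φ ∘ₗ kleinLagrangian.mkQ with hψ
  have hA : ∀ η ∈ kleinLagrangian, ψ η = 0 := by
    intro η hη
    simp [hψ, (Submodule.Quotient.mk_eq_zero _).2 hη]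
  -- The vectors e_{jkl} with indices in 1, …, 5 project to a basis of the quotient, so the
  -- coefficients are the values there, with the signs of `bC`. The ten generators of A then account
  -- for the values on e_{0jk}.
  refine ⟨![ψ (e3 3 4 5), -ψ (e3 2 4 5), ψ (e3 2 3 5), -ψ (e3 2 3 4), ψ (e3 1 4 5),
    -ψ (e3 1 3 5), ψ (e3 1 3 4), ψ (e3 1 2 5), -ψ (e3 1 2 4), ψ (e3 1 2 3)], ?_⟩
  apply Submodule.linearMap_qext
  apply linearMap_ext_e3
  have g1 := hA (e3 0 1 2 + e3 2 4 5) (Submodule.subset_span (by simp))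
  have g2 := hA (e3 0 1 3 - e3 3 4 5) (Submodule.subset_span (by simp))
  have g3 := hA (e3 0 1 4 + e3 1 2 3) (Submodule.subset_span (by simp))
  have g4 := hA (e3 0 1 5 - e3 1 3 4) (Submodule.subset_span (by simp))
  have g5 := hA (e3 0 2 3 + e3 1 3 5) (Submodule.subset_span (by simp))
  have g6 := hA (e3 0 2 4 - e3 1 4 5) (Submodule.subset_span (by simp))
  have g7 := hA (e3 0 2 5 + e3 2 3 4) (Submodule.subset_span (by simp))
  have g8 := hA (e3 0 3 4 + e3 1 2 4) (Submodule.subset_span (by simp))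
  have g9 := hA (e3 0 3 5 - e3 1 2 5) (Submodule.subset_span (by simp))
  have g10 := hA (e3 0 4 5 + e3 2 3 5) (Submodule.subset_span (by simp))
  simp only [map_add, map_sub] at g1 g2 g3 g4 g5 g6 g7 g8 g9 g10
  intro i j k hij hjk
  change ψ _ = dualForm _ (kleinLagrangian.mkQ _)
  fin_cases i <;> fin_cases j <;> first | exact absurd hij (by decide) | skip
  all_goals fin_cases k <;> first | exact absurd hjk (by decide) | skip
  · refine Eq.trans ?_ (dualForm_e3 _ 1 (1) (by decide)).symm
    simp
    linear_combination g1
  · refine Eq.trans ?_ (dualForm_e3 _ 0 (1) (by decide)).symm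
    simp
    linear_combination g2
  · refine Eq.trans ?_ (dualForm_e3 _ 9 (-1) (by decide)).symm
    simp
    linear_combination g3
  · refine Eq.trans ?_ (dualForm_e3 _ 6 (1) (by decide)).symm
    simp
    linear_combination g4
  · refine Eq.trans ?_ (dualForm_e3 _ 5 (1) (by decide)).symm
    simp
    linear_combination g5
  · refine Eq.trans ?_ (dualForm_e3 _ 4 (1) (by decide)).symm
    simp
    linear_combination g6
  · refine Eq.trans ?_ (dualForm_e3 _ 3 (1) (by decide)).symm
    simp
    linear_combination g7
  · refine Eq.trans ?_ (dualForm_e3 _ 8 (1) (by decide)).symm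
    simp
    linear_combination g8
  · refine Eq.trans ?_ (dualForm_e3 _ 7 (1) (by decide)).symm
    simp
    linear_combination g9
  · refine Eq.trans ?_ (dualForm_e3 _ 2 (-1) (by decide)).symm
    simp
    linear_combination g10
  · refine Eq.trans ?_ (dualForm_e3 _ 9 (1) (by decide)).symm
    simp
  · refine Eq.trans ?_ (dualForm_e3 _ 8 (-1) (by decide)).symm
    simp
  · refine Eq.trans ?_ (dualForm_e3 _ 7 (1) (by decide)).symm
    simp
  · refine Eq.trans ?_ (dualForm_e3 _ 6 (1) (by decide)).symm
    simp
  · refine Eq.trans ?_ (dualForm_e3 _ 5 (-1) (by decide)).symm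
    simp
  · refine Eq.trans ?_ (dualForm_e3 _ 4 (1) (by decide)).symm
    simp
  · refine Eq.trans ?_ (dualForm_e3 _ 3 (-1) (by decide)).symm
    simp
  · refine Eq.trans ?_ (dualForm_e3 _ 2 (1) (by decide)).symm
    simp
  · refine Eq.trans ?_ (dualForm_e3 _ 1 (-1) (by decide)).symm
    simp
  · refine Eq.trans ?_ (dualForm_e3 _ 0 (1) (by decide)).symm
    simp

/-! ### The degeneracy ideals in coordinates -/

/-- The matrix of linear forms attached to constant linear forms and constant arrays. -/
def minorMatrix {k : ℕ} (c : Fin k → Fin 10 → ℂ) (w : Fin k → Fin 6 → Fin 6 → ℂ) :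
    Matrix (Fin k) (Fin k) CoordRing :=
  Matrix.of fun a b => ∑ s, MvPolynomial.C (c a s) *
    bC (wdg MvPolynomial.X (fun i j => MvPolynomial.C (w b i j))) s

/-- Both sides are linear in the universal vector, so it suffices to expand it in the standard
basis. -/
theorem pairing_eq (c : Fin 10 → ℂ) (w : ⋀[ℂ]^2 V6) :
    pairing kleinLagrangian (dualForm c) w = ∑ s, MvPolynomial.C (c s) *
      bC (wdg MvPolynomial.X (fun i j => MvPolynomial.C (coord2 w i j))) s := by
  have h : ∀ i, bC (wdg (Pi.single i (1 : CoordRing))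
      (fun i j => MvPolynomial.C (coord2 w i j))) =
      fun s => MvPolynomial.C (bC (coord3 (wedge (e i) w)) s) := by
    intro i
    funext s
    rw [coord3_wedge, bC_map, wdg_map]
    congr 2
    funext j
    simp [e, Pi.single_apply, apply_ite]
  have hX : (MvPolynomial.X : Fin 6 → CoordRing) =
      ∑ i, (MvPolynomial.X i : CoordRing) • Pi.single i (1 : CoordRing) := by
    funext j; simp [Finset.sum_apply, Pi.single_apply]
  have h2 : ∀ s, bC (wdg MvPolynomial.X (fun i j => MvPolynomial.C (coord2 w i j))) s =
      ∑ i, MvPolynomial.X i * MvPolynomial.C (bC (coord3 (wedge (e i) w)) s) := by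
    intro s
    set f := bL CoordRing ∘ₗ wdgL (fun i j => MvPolynomial.C (coord2 w i j)) with hf
    have h3 : f MvPolynomial.X = ∑ i, (MvPolynomial.X i : CoordRing) • f (Pi.single i 1) := by
      conv_lhs => rw [hX]
      rw [map_sum]
      exact Finset.sum_congr rfl fun i _ => map_smul f _ _
    have h4 := congrFun h3 s
    rw [Finset.sum_apply] at h4
    refine h4.trans (Finset.sum_congr rfl fun i _ => ?_)
    exact congrArg (MvPolynomial.X i * ·) (congrFun (h i) s)
  simp only [h2, pairing, dualForm_mkQ, map_sum, map_mul, Finset.sum_mul, Finset.mul_sum]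
  rw [Finset.sum_comm]
  refine Finset.sum_congr rfl fun s _ => Finset.sum_congr rfl fun i _ => ?_
  ring

theorem degeneracyIdeal_eq (l : ℕ) : degeneracyIdeal kleinLagrangian l =
    Ideal.span {p | ∃ (c : Fin (11 - l) → Fin 10 → ℂ) (w : Fin (11 - l) → Fin 6 → Fin 6 → ℂ),
      (∀ b, IsAlt (w b)) ∧ p = (minorMatrix c w).det} := by
  rw [degeneracyIdeal]
  congr 1
  ext p
  constructor
  · rintro ⟨φ, w, rfl⟩
    choose c hc using fun a => exists_dualForm_eq (φ a)
    refine ⟨c, fun b => coord2 (w b), fun b => isAlt_coord2 _, ?_⟩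
    congr 1
    ext a b : 2
    simp only [Matrix.of_apply, minorMatrix]
    rw [hc, pairing_eq]
  · rintro ⟨c, w, hw, rfl⟩
    choose ω hω using fun b => exists_coord2_eq (w b) (hw b)
    refine ⟨fun a => dualForm (c a), ω, ?_⟩
    congr 1
    ext a b : 2
    simp only [Matrix.of_apply, minorMatrix]
    rw [pairing_eq, hω]

end

end KleinEPW

namespace KleinEPW

noncomputable section

/-! ### The matrices of the charts -/

section Charts

/-- The array of `e_a ∧ e_b`. -/
def el (a b l m : Fin 6) : ℤ :=
  (if l = a ∧ m = b then 1 else 0) - (if l = b ∧ m = a then 1 else 0)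

/-- The pairs `j < k` in `{0, …, 4}`. -/
def pr : Fin 10 → Fin 5 × Fin 5 :=
  ![(0, 1), (0, 2), (0, 3), (0, 4), (1, 2), (1, 3), (1, 4), (2, 3), (2, 4), (3, 4)]

/-- An injection of `{0, …, 4}` onto the complement of `i`. -/
def ch (i : Fin 6) (p : Fin 5) : Fin 6 := Equiv.swap 0 i p.succ

/-- A basis of the arrays supported away from `i`. -/
def wv (i : Fin 6) (t : Fin 10) (l m : Fin 6) : ℤ := el (ch i (pr t).1) (ch i (pr t).2) l m

variable {R : Type*} [CommRing R]

/-- The matrix of `w ↦ bC (x ∧ w)` on the arrays supported away from `i`. -/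
def bMat (i : Fin 6) (x : Fin 6 → R) : Matrix (Fin 10) (Fin 10) R :=
  Matrix.of fun s t => bC (wdg x fun l m => (wv i t l m : R)) s

/-- The matrix of `w ↦ aC (x ∧ w)` on the arrays supported away from `i`. -/
def aMat (i : Fin 6) (x : Fin 6 → R) : Matrix (Fin 10) (Fin 10) R :=
  Matrix.of fun s t => aC (wdg x fun l m => (wv i t l m : R)) s

theorem bMat_map {S : Type*} [CommRing S] (f : R →+* S) (i : Fin 6) (x : Fin 6 → R) :
    (bMat i x).map f = bMat i (fun j => f (x j)) := by
  ext s t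
  simp only [bMat, Matrix.map_apply, Matrix.of_apply, bC_map, wdg_map, map_intCast]

theorem aMat_map {S : Type*} [CommRing S] (f : R →+* S) (i : Fin 6) (x : Fin 6 → R) :
    (aMat i x).map f = aMat i (fun j => f (x j)) := by
  ext s t
  simp only [aMat, Matrix.map_apply, Matrix.of_apply, aC_map, wdg_map, map_intCast]

/-- Matrix form of isotropy. It identifies left kernel vectors of `bMat` with `aMat` applied to
right kernel vectors, and it is the source of the symmetry of the local equations. -/
theorem aMat_transpose_mul_bMat_symm (i : Fin 6) (x : Fin 6 → R) :
    ((aMat i x).transpose * bMat i x).IsSymm := by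
  ext s t
  simp only [Matrix.transpose_apply, Matrix.mul_apply, aMat, bMat, Matrix.of_apply]
  exact isotropic _ _ _

/-- The array `∑ t, y t • wv i t`. -/
def arr (i : Fin 6) (y : Fin 10 → R) : Fin 6 → Fin 6 → R :=
  fun l m => ∑ t, y t * (wv i t l m : R)

theorem bMat_mulVec (i : Fin 6) (x : Fin 6 → R) (y : Fin 10 → R) :
    (bMat i x).mulVec y = bC (wdg x (arr i y)) := by
  have h : arr i y = ∑ t, y t • (fun l m => (wv i t l m : R)) := by
    funext l m; simp [arr, Finset.sum_apply]
  have h2 : bC (wdg x (arr i y)) = (bL R ∘ₗ wdgR x) (arr i y) := rfl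
  rw [h2, h, map_sum]
  funext s
  simp only [Matrix.mulVec, dotProduct, Finset.sum_apply, map_smul, Pi.smul_apply, smul_eq_mul]
  refine Finset.sum_congr rfl fun t _ => ?_
  rw [mul_comm]; rfl

theorem aMat_mulVec (i : Fin 6) (x : Fin 6 → R) (y : Fin 10 → R) :
    (aMat i x).mulVec y = aC (wdg x (arr i y)) := by
  funext s
  have h : ∀ j k, arr i y j k = ∑ t, y t * (wv i t j k : R) := fun _ _ => rfl
  simp only [Matrix.mulVec, dotProduct, aMat, Matrix.of_apply]
  have h2 : ∀ w : Fin 6 → Fin 6 → R, aC (wdg x w) s =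
      (LinearMap.proj s ∘ₗ (⟨⟨aC, aC_add⟩, aC_smul⟩ : _ →ₗ[R] (Fin 10 → R)) ∘ₗ wdgR x) w :=
    fun _ => rfl
  have h3 : arr i y = ∑ t, y t • (fun l m => (wv i t l m : R)) := by
    funext l m; simp [arr, Finset.sum_apply]
  rw [h2, h3, map_sum]
  refine Finset.sum_congr rfl fun t _ => ?_
  rw [map_smul, ← h2, smul_eq_mul, mul_comm]

theorem isAlt_arr (i : Fin 6) (y : Fin 10 → R) : IsAlt (arr i y) := by
  constructor
  · intro l
    refine Finset.sum_eq_zero fun t _ => ?_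
    simp [wv, el, and_comm]
  · intro l m
    simp only [arr, ← Finset.sum_neg_distrib]
    refine Finset.sum_congr rfl fun t _ => ?_
    simp [wv, el, and_comm]
    ring

theorem arr_zero_eq {v : Fin 6 → Fin 6 → R} (hv : IsAlt v) (h0 : ∀ k, v 0 k = 0) :
    arr 0 (fun t => v (ch 0 (pr t).1) (ch 0 (pr t).2)) = v := by
  have h0' : ∀ k, v k 0 = 0 := fun k => by rw [hv.2, h0, neg_zero]
  funext l m
  simp only [arr, wv, ch, Equiv.swap_self, Equiv.refl_apply, Fin.sum_univ_succ, pr]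
  fin_cases l <;> fin_cases m <;> simp [el, h0, h0', hv.1] <;> rw [← hv.2]

theorem el_swap (i a b l m : Fin 6) :
    el (Equiv.swap 0 i a) (Equiv.swap 0 i b) l m =
      el a b (Equiv.swap 0 i l) (Equiv.swap 0 i m) := by
  have : ∀ p q : Fin 6, p = Equiv.swap 0 i q ↔ Equiv.swap 0 i p = q := by
    intro p q
    constructor <;> rintro rfl <;> simp
  simp [el, this]

/-- Swapping the indices 0 and i reduces this to the chart 0, so the case check is made only once.
-/
theorem arr_eq (i : Fin 6) {v : Fin 6 → Fin 6 → R} (hv : IsAlt v) (h0 : ∀ k, v i k = 0) :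
    arr i (fun t => v (ch i (pr t).1) (ch i (pr t).2)) = v := by
  have h := arr_zero_eq (v := fun l m => v (Equiv.swap 0 i l) (Equiv.swap 0 i m))
    ⟨fun l => hv.1 _, fun l m => hv.2 _ _⟩ (fun k => by simpa using h0 _)
  funext l m
  have h2 := congrFun (congrFun h (Equiv.swap 0 i l)) (Equiv.swap 0 i m)
  simp only [Equiv.swap_apply_self] at h2
  rw [← h2]
  refine Finset.sum_congr rfl fun t _ => ?_
  simp only [wv, ch, Equiv.swap_self, Equiv.refl_apply, el_swap]

/-- Contraction by the i-th coordinate is an antiderivation and x ∧ (x ∧ w) = 0. So xᵢ(x ∧ w) is x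
wedged with a contraction that has no i-component, and where xᵢ is a unit ten of the fifteen
bivectors suffice. -/
theorem wdg_contract (x : Fin 6 → R) (w : Fin 6 → Fin 6 → R) (i : Fin 6) :
    wdg x (wdg x w i) = x i • wdg x w := by
  funext j k l
  simp only [wdg, Pi.smul_apply, smul_eq_mul]
  ring

theorem isAlt_wdg {w : Fin 6 → Fin 6 → R} (hw : IsAlt w) (x : Fin 6 → R) (i : Fin 6) :
    IsAlt (wdg x w i) := by
  constructor
  · intro j
    simp only [wdg, hw.1]
    ring
  · intro j k
    simp only [wdg]
    rw [hw.2 j k]; ring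

/-- The coordinates in the chart `i` of the contraction of `x ∧ w` by `i`. -/
def yv (i : Fin 6) (x : Fin 6 → R) (w : Fin 6 → Fin 6 → R) : Fin 10 → R :=
  fun t => wdg x w i (ch i (pr t).1) (ch i (pr t).2)

theorem arr_yv (i : Fin 6) (x : Fin 6 → R) {w : Fin 6 → Fin 6 → R} (hw : IsAlt w) :
    arr i (yv i x w) = wdg x w i :=
  arr_eq i (isAlt_wdg hw x i) fun k => by simp [wdg, hw.1]

theorem bMat_mulVec_yv (i : Fin 6) (x : Fin 6 → R) {w : Fin 6 → Fin 6 → R} (hw : IsAlt w) :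
    (bMat i x).mulVec (yv i x w) = x i • bC (wdg x w) := by
  rw [bMat_mulVec, arr_yv i x hw, wdg_contract, bC_smul]

theorem isAlt_wv (i : Fin 6) (t : Fin 10) : IsAlt fun l m => (wv i t l m : R) := by
  constructor <;> simp [wv, el, and_comm]

/-- The change of charts. -/
def chartChange (i j : Fin 6) (x : Fin 6 → R) : Matrix (Fin 10) (Fin 10) R :=
  Matrix.of fun s t => yv i x (fun l m => (wv j t l m : R)) s

theorem bMat_mul_chartChange (i j : Fin 6) (x : Fin 6 → R) :
    bMat i x * chartChange i j x = x i • bMat j x := by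
  ext s t
  exact congrFun (bMat_mulVec_yv i x (isAlt_wv j t)) s


theorem chartChange_apply (i : Fin 6) (x : Fin 6 → R) (s t : Fin 10) :
    chartChange i 0 x s t = x i * (wv 0 t (ch i (pr s).1) (ch i (pr s).2) : R) -
      x (ch i (pr s).1) * (wv 0 t i (ch i (pr s).2) : R) +
      x (ch i (pr s).2) * (wv 0 t i (ch i (pr s).1) : R) := rfl

/-- The pairs containing `i`. -/
def mem_pr (i : Fin 6) (t : Fin 10) : Prop := (pr t).1.succ = i ∨ (pr t).2.succ = i

instance (i : Fin 6) (t : Fin 10) : Decidable (mem_pr i t) := by unfold mem_pr; infer_instance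

theorem wv_of_mem_of_not_mem : ∀ i : Fin 6, i ≠ 0 → ∀ s t, mem_pr i s → ¬ mem_pr i t →
    wv 0 t (ch i (pr s).1) (ch i (pr s).2) = 0 ∧ wv 0 t i (ch i (pr s).2) = 0 ∧
      wv 0 t i (ch i (pr s).1) = 0 := by decide +kernel

theorem wv_of_mem_of_mem : ∀ i : Fin 6, i ≠ 0 → ∀ s t, mem_pr i s → mem_pr i t → s ≠ t →
    wv 0 t (ch i (pr s).1) (ch i (pr s).2) = 0 ∧ wv 0 t i (ch i (pr s).2) = 0 ∧
      wv 0 t i (ch i (pr s).1) = 0 := by decide +kernel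

theorem wv_of_mem_self : ∀ i : Fin 6, i ≠ 0 → ∀ t, mem_pr i t →
    wv 0 t (ch i (pr t).1) (ch i (pr t).2) = 0 ∧
      ((wv 0 t i (ch i (pr t).2) = 1 ∧ wv 0 t i (ch i (pr t).1) = 0 ∧ ch i (pr t).1 = 0) ∨
      (wv 0 t i (ch i (pr t).2) = 0 ∧ wv 0 t i (ch i (pr t).1) = -1 ∧ ch i (pr t).2 = 0)) := by
  decide +kernel

theorem wv_of_not_mem : ∀ i : Fin 6, i ≠ 0 → ∀ s t, ¬ mem_pr i s → ¬ mem_pr i t →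
    wv 0 t (ch i (pr s).1) (ch i (pr s).2) = (if s = t then 1 else 0) ∧
      wv 0 t i (ch i (pr s).2) = 0 ∧ wv 0 t i (ch i (pr s).1) = 0 := by decide +kernel

theorem card_mem_pr : ∀ i : Fin 6, i ≠ 0 → Fintype.card {t // mem_pr i t} = 4 ∧
    Fintype.card {t // ¬ mem_pr i t} = 6 := by decide +kernel

/-- Sorting the pairs by whether they contain i makes the matrix block triangular with diagonal
blocks: four entries -x₀ and six entries xᵢ. -/
theorem det_chartChange (i : Fin 6) (hi : i ≠ 0) (x : Fin 6 → R) :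
    (chartChange i 0 x).det = x i ^ 6 * x 0 ^ 4 := by
  rw [Matrix.twoBlockTriangular_det' _ (mem_pr i)]
  · have h1 : (chartChange i 0 x).toSquareBlockProp (mem_pr i) =
        Matrix.diagonal fun _ => -x 0 := by
      ext ⟨s, hs⟩ ⟨t, ht⟩
      rw [Matrix.toSquareBlockProp_def, Matrix.of_apply, chartChange_apply, Matrix.diagonal_apply]
      split_ifs with h
      · obtain rfl : s = t := congrArg Subtype.val h
        obtain ⟨h1, h2 | h2⟩ := wv_of_mem_self i hi s hs
        · rw [h1, h2.1, h2.2.1, h2.2.2]; push_cast; ring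
        · rw [h1, h2.1, h2.2.1, h2.2.2]; push_cast; ring
      · obtain ⟨h1, h2, h3⟩ := wv_of_mem_of_mem i hi s t hs ht fun h' => h (Subtype.ext h')
        rw [h1, h2, h3]; push_cast; ring
    have h2 : (chartChange i 0 x).toSquareBlockProp (fun t => ¬ mem_pr i t) =
        Matrix.diagonal fun _ => x i := by
      ext ⟨s, hs⟩ ⟨t, ht⟩
      rw [Matrix.toSquareBlockProp_def, Matrix.of_apply, chartChange_apply, Matrix.diagonal_apply]
      obtain ⟨h1, h2, h3⟩ := wv_of_not_mem i hi s t hs ht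
      rw [h1, h2, h3]
      simp only [Subtype.mk.injEq]
      split_ifs <;> push_cast <;> ring
    rw [h1, h2, Matrix.det_diagonal, Matrix.det_diagonal, Finset.prod_const, Finset.prod_const,
      Finset.card_univ, Finset.card_univ, (card_mem_pr i hi).1, (card_mem_pr i hi).2]
    ring
  · intro s hs t ht
    obtain ⟨h1, h2, h3⟩ := wv_of_mem_of_not_mem i hi s t hs ht
    rw [chartChange_apply, h1, h2, h3]; push_cast; ring

end Charts

end

end KleinEPW

namespace KleinEPW

noncomputable section

/-! ### The determinants of the chart matrices -/

section Det

variable {R : Type*} [CommRing R]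

/-- The entries `0`, `xₗ` and `-xₗ`. -/
def ent (x : Fin 6 → R) : Fin 13 → R :=
  ![0, x 0, x 1, x 2, x 3, x 4, x 5, -x 0, -x 1, -x 2, -x 3, -x 4, -x 5]

/-- The positions of the entries in the matrix of the chart `0`. -/
def code : Matrix (Fin 10) (Fin 10) (Fin 13) :=
  !![0, 1, 0, 0, 0, 0, 0, 6, 11, 4;
    1, 0, 0, 0, 0, 12, 5, 0, 0, 9;
    0, 0, 0, 0, 6, 0, 10, 0, 3, 7;
    0, 0, 0, 0, 11, 4, 1, 9, 0, 0;
    0, 0, 6, 11, 0, 1, 0, 0, 0, 2;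
    0, 12, 0, 4, 1, 0, 0, 0, 8, 0;
    0, 5, 10, 1, 0, 0, 0, 2, 0, 0;
    6, 0, 0, 9, 0, 0, 2, 0, 1, 0;
    11, 0, 3, 0, 0, 8, 0, 1, 0, 0;
    4, 9, 7, 0, 2, 0, 0, 0, 0, 0]

theorem ent_eq_sum (x : Fin 6 → R) (k : Fin 13) :
    ent x k = ∑ l, x l * ((ent (fun j => if j = l then (1 : ℤ) else 0) k : ℤ) : R) := by
  fin_cases k <;> simp [ent]

/-- The coefficients of the entries of the chart matrices. -/
def bco (i : Fin 6) (s t : Fin 10) (l : Fin 6) : ℤ :=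
  bC (wdg (fun j => if j = l then 1 else 0) (wv i t)) s

/-- The entries are linear in x with integer coefficients, so the explicit form of the matrix over
any ring rests on finitely many decidable integer identities. -/
theorem bMat_apply (i : Fin 6) (x : Fin 6 → R) (s t : Fin 10) :
    bMat i x s t = ∑ l, x l * (bco i s t l : R) := by
  have hx : x = ∑ l, x l • (fun j => if j = l then (1 : R) else 0) := by
    funext j; simp [Finset.sum_apply]
  have h (y : Fin 6 → R) : bMat i y s t =
      (LinearMap.proj s ∘ₗ bL R ∘ₗ wdgL fun l m => (wv i t l m : R)) y := rfl
  rw [h]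
  conv_lhs => rw [hx]
  rw [map_sum]
  refine Finset.sum_congr rfl fun l _ => ?_
  rw [map_smul, ← h, smul_eq_mul]
  congr 1
  have h3 := bC_map (Int.castRingHom R) (wdg (fun j => if j = l then (1 : ℤ) else 0) (wv i t)) s
  rw [wdg_map] at h3
  simp only [eq_intCast, Int.cast_ite, Int.cast_one, Int.cast_zero] at h3
  exact h3.symm

theorem wv_zero_eq : ∀ t l m, wv 0 t l m =
    if l = (pr t).1.succ ∧ m = (pr t).2.succ then 1
    else if l = (pr t).2.succ ∧ m = (pr t).1.succ then -1 else 0 := by decide +kernel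

theorem bco_zero_eq (l : Fin 6) (s t : Fin 10) :
    bco 0 s t l = ent (fun j => if j = l then (1 : ℤ) else 0) (code s t) := by
  have h : ∀ (l : Fin 6) (s t : Fin 10),
      bC (wdg (fun j => if j = l then 1 else 0) (fun l m =>
        if l = (pr t).1.succ ∧ m = (pr t).2.succ then 1
        else if l = (pr t).2.succ ∧ m = (pr t).1.succ then -1 else 0)) s =
      ent (fun j => if j = l then (1 : ℤ) else 0) (code s t) := by decide +kernel
  rw [← h, bco]
  congr 2
  funext l m
  exact wv_zero_eq t l m

theorem bMat_zero_eq (x : Fin 6 → R) : bMat 0 x = Matrix.of fun s t => ent x (code s t) := by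
  ext s t
  rw [bMat_apply, Matrix.of_apply, ent_eq_sum]
  simp only [bco_zero_eq]

/-- A splitting of the ten rows. -/
def splitEquiv : Fin 6 ⊕ Fin 4 ≃ Fin 10 :=
  finSumFinEquiv.trans ⟨![0, 1, 4, 6, 8, 9, 2, 3, 5, 7], ![0, 1, 6, 7, 2, 8, 3, 9, 4, 5],
    by decide, by decide⟩

/-- The top left block of the chart matrix. -/
def blk (x : Fin 6 → R) : Matrix (Fin 6) (Fin 6) R :=
  !![0, x 0, 0, 0, -x 4, x 3;
    x 0, 0, 0, x 4, 0, -x 2;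
    0, 0, 0, 0, 0, x 1;
    0, x 4, 0, 0, 0, 0;
    -x 4, 0, 0, 0, 0, 0;
    x 3, -x 2, x 1, 0, 0, 0]

theorem bMat_zero_submatrix (x : Fin 6 → R) :
    (bMat 0 x).submatrix splitEquiv splitEquiv = Matrix.fromBlocks (blk x)
      !![0, 0, 0, x 5;
    0, 0, -x 5, 0;
    x 5, -x 4, x 0, 0;
    -x 3, x 0, 0, x 1;
    x 2, 0, -x 1, x 0;
    -x 0, 0, 0, 0]
      !![0, 0, x 5, -x 3, x 2, -x 0;
    0, 0, -x 4, x 0, 0, 0;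
    0, -x 5, x 0, 0, -x 1, 0;
    x 5, 0, 0, x 1, x 0, 0]
      !![0, 0, 0, 0;
    0, 0, x 3, -x 2;
    0, x 3, 0, 0;
    0, -x 2, 0, 0] := by
  rw [bMat_zero_eq]
  ext s t
  rcases s with s | s <;> rcases t with t | t <;> fin_cases s <;> fin_cases t <;> rfl

theorem det_blk (x : Fin 6 → R) : (blk x).det = -(x 1 ^ 2 * x 4 ^ 4) := by
  simp [blk, Matrix.det_succ_row_zero, Fin.sum_univ_succ, Fin.succAbove]
  ring

/-- The matrix clearing the top right block. -/
def clr (x : Fin 6 → R) : Matrix (Fin 6) (Fin 4) R :=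
  !![x 1 * x 2 * x 4, 0, -x 1 ^ 2 * x 4, x 0 * x 1 * x 4;
    x 1 * x 3 * x 4, -x 0 * x 1 * x 4, 0, -x 1 ^ 2 * x 4;
    x 0 * x 4 ^ 2, -x 0 * x 2 * x 4, x 1 * x 3 * x 4, -x 0 * x 3 * x 4 - x 1 * x 2 * x 4;
    -x 0 * x 1 * x 2 - x 2 * x 4 * x 5, x 2 * x 4 ^ 2, x 0 * x 1 ^ 2 - x 0 * x 2 * x 4 + x 1 * x 4 * x 5, -x 0 ^ 2 * x 1;
    x 0 * x 1 * x 3 - x 3 * x 4 * x 5, -x 0 ^ 2 * x 1 + x 3 * x 4 ^ 2, -x 0 * x 3 * x 4, -x 0 * x 1 ^ 2 + x 1 * x 4 * x 5;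
    -x 4 ^ 2 * x 5, x 4 ^ 3, -x 0 * x 4 ^ 2, 0]

/-- The Schur complement, up to a monomial. -/
def schur (x : Fin 6 → R) : Matrix (Fin 4) (Fin 4) R :=
  !![-2 * x 1 * x 2 * x 3 - 2 * x 4 ^ 2 * x 5, x 0 * x 1 * x 2 + x 2 * x 4 * x 5 + x 4 ^ 3, -x 0 * x 4 ^ 2 + x 1 ^ 2 * x 3, -x 0 * x 1 * x 3 + x 1 ^ 2 * x 2 + x 3 * x 4 * x 5;
    x 0 * x 1 * x 2 + x 2 * x 4 * x 5 + x 4 ^ 3, -2 * x 2 * x 4 ^ 2, -x 0 * x 1 ^ 2 + x 0 * x 2 * x 4 - x 1 * x 4 * x 5, x 0 ^ 2 * x 1 - x 3 * x 4 ^ 2;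
    -x 0 * x 4 ^ 2 + x 1 ^ 2 * x 3, -x 0 * x 1 ^ 2 + x 0 * x 2 * x 4 - x 1 * x 4 * x 5, -2 * x 1 * x 3 * x 4, x 0 * x 3 * x 4 - x 1 ^ 3 + x 1 * x 2 * x 4;
    -x 0 * x 1 * x 3 + x 1 ^ 2 * x 2 + x 3 * x 4 * x 5, x 0 ^ 2 * x 1 - x 3 * x 4 ^ 2, x 0 * x 3 * x 4 - x 1 ^ 3 + x 1 * x 2 * x 4, 2 * x 0 * x 1 ^ 2 - 2 * x 1 * x 4 * x 5]

-- Block elimination without denominators: with B the top right block, `clr` satisfies blk · clr =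
-- -x₁x₄² B. The bottom right block becomes x₀ times a symmetric 4 × 4 matrix, which reduces the
-- determinant from size ten to size four and produces the factor x₀⁴.
set_option maxHeartbeats 2000000 in
theorem bMat_zero_mul_clr (x : Fin 6 → R) :
    (bMat 0 x).submatrix splitEquiv splitEquiv *
      Matrix.fromBlocks 1 (-clr x) 0 (-(x 1 * x 4 ^ 2) • (1 : Matrix (Fin 4) (Fin 4) R)) =
    Matrix.fromBlocks (blk x) 0
      !![0, 0, x 5, -x 3, x 2, -x 0;
    0, 0, -x 4, x 0, 0, 0;
    0, -x 5, x 0, 0, -x 1, 0;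
    x 5, 0, 0, x 1, x 0, 0]
      (x 0 • schur x) := by
  rw [bMat_zero_submatrix, Matrix.fromBlocks_multiply]
  congr 1
  · simp
  · ext s t
    fin_cases s <;> fin_cases t <;> simp [blk, clr] <;> ring
  · simp
  · ext s t
    fin_cases s <;> fin_cases t <;> simp [schur, clr] <;> ring

theorem det_schur (x : Fin 6 → R) : (schur x).det =
    x 1 ^ 2 * x 4 ^ 4 * sexticForm (x 0) (x 1) (x 2) (x 3) (x 4) (x 5) := by
  simp [schur, Matrix.det_succ_row_zero, Fin.sum_univ_succ, Fin.succAbove, sexticForm]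
  ring

theorem det_bMat_zero_X : (bMat 0 (MvPolynomial.X : Fin 6 → CoordRing)).det =
    -(MvPolynomial.X 0 ^ 4 * kleinSextic) := by
  have h := congrArg Matrix.det (bMat_zero_mul_clr (MvPolynomial.X : Fin 6 → CoordRing))
  rw [Matrix.det_mul, Matrix.det_submatrix_equiv_self, Matrix.det_fromBlocks_zero₂₁,
    Matrix.det_fromBlocks_zero₁₂, det_blk, Matrix.det_smul, Matrix.det_smul, det_schur] at h
  simp only [Matrix.det_one, Fintype.card_fin, mul_one, one_mul] at h
  have hX : ∀ i, (MvPolynomial.X i : CoordRing) ≠ 0 := fun i => MvPolynomial.X_ne_zero i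
  -- This is the determinant of the column operation. It also equals, up to sign, the product of det
  -- `blk` and the monomial in `det_schur`, so it cancels in the polynomial ring.
  refine mul_right_cancel₀ (b := (-(MvPolynomial.X 1 * MvPolynomial.X 4 ^ 2) : CoordRing) ^ 4)
    (pow_ne_zero _ (neg_ne_zero.2 (mul_ne_zero (hX 1) (pow_ne_zero _ (hX 4))))) ?_
  rw [h, kleinSextic]
  ring

theorem det_bMat_X (i : Fin 6) : (bMat i (MvPolynomial.X : Fin 6 → CoordRing)).det =
    -(MvPolynomial.X i ^ 4 * kleinSextic) := by
  by_cases hi : i = 0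
  · rw [hi, det_bMat_zero_X]
  have h := congrArg Matrix.det (bMat_mul_chartChange i 0 (MvPolynomial.X : Fin 6 → CoordRing))
  rw [Matrix.det_mul, det_chartChange i hi, Matrix.det_smul, det_bMat_zero_X, Fintype.card_fin] at h
  have hX : ∀ i, (MvPolynomial.X i : CoordRing) ≠ 0 := fun i => MvPolynomial.X_ne_zero i
  refine mul_right_cancel₀ (b := ((MvPolynomial.X i ^ 6 * MvPolynomial.X 0 ^ 4 : CoordRing)))
    (mul_ne_zero (pow_ne_zero _ (hX i)) (pow_ne_zero _ (hX 0))) ?_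
  rw [h]
  ring

end Det

end

end KleinEPW

namespace KleinEPW

noncomputable section

/-! ### Ideals of minors -/

section Minors

variable {R S : Type*} [CommRing R] [CommRing S] {m n m' n' : Type*}

/-- The ideal generated by the minors of size `k`. -/
def minors (M : Matrix m n R) (k : ℕ) : Ideal R :=
  Ideal.span {p | ∃ (f : Fin k → m) (g : Fin k → n), p = (M.submatrix f g).det}

theorem det_submatrix_mem_minors (M : Matrix m n R) {k : ℕ} (f : Fin k → m) (g : Fin k → n) :
    (M.submatrix f g).det ∈ minors M k :=
  Ideal.subset_span ⟨f, g, rfl⟩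

theorem minors_map (φ : R →+* S) (M : Matrix m n R) (k : ℕ) :
    (minors M k).map φ = minors (M.map φ) k := by
  rw [minors, minors, Ideal.map_span]
  congr 1
  ext p
  constructor
  · rintro ⟨_, ⟨f, g, rfl⟩, rfl⟩
    exact ⟨f, g, by rw [RingHom.map_det]; rfl⟩
  · rintro ⟨f, g, rfl⟩
    exact ⟨_, ⟨f, g, rfl⟩, by rw [RingHom.map_det]; rfl⟩

/-- The rows of P * M are combinations of rows of M, so multilinearity expands the determinant over
all selections of rows of M, repetitions included. This weak form of Cauchy–Binet is all that ideal
membership needs. -/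
theorem det_mul_mem_of_forall_submatrix [Fintype m] {k : ℕ} (I : Ideal R)
    (P : Matrix (Fin k) m R) (M : Matrix m (Fin k) R)
    (h : ∀ f : Fin k → m, (M.submatrix f id).det ∈ I) : (P * M).det ∈ I := by
  classical
  have h1 : (P * M).det = Matrix.detRowAlternating (fun a => ∑ s, P a s • M s) := by
    change (P * M).det = Matrix.det _
    congr 1
    ext a b
    simp [Matrix.mul_apply, Finset.sum_apply]
  rw [h1]
  change (Matrix.detRowAlternating (R := R) (n := Fin k)).toMultilinearMap _ ∈ I
  rw [MultilinearMap.map_sum]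
  refine I.sum_mem fun f _ => ?_
  rw [MultilinearMap.map_smul_univ]
  exact I.mul_mem_left _ (h f)

theorem det_mul_mul_mem_minors [Fintype m] [Fintype n] {k : ℕ} (P : Matrix (Fin k) m R)
    (M : Matrix m n R) (Q : Matrix n (Fin k) R) : (P * M * Q).det ∈ minors M k := by
  rw [Matrix.mul_assoc]
  refine det_mul_mem_of_forall_submatrix _ _ _ fun f => ?_
  rw [← Matrix.det_transpose]
  have : ((M * Q).submatrix f id).transpose = Q.transpose * (M.submatrix f id).transpose := by
    ext a b; simp [Matrix.mul_apply, mul_comm]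
  rw [this]
  refine det_mul_mem_of_forall_submatrix _ _ _ fun g => ?_
  have : ((M.submatrix f id).transpose.submatrix g id) = (M.submatrix f g).transpose := rfl
  rw [this, Matrix.det_transpose]
  exact det_submatrix_mem_minors M f g

theorem minors_mul_mul_le [Fintype m] [Fintype n] (U : Matrix m' m R) (M : Matrix m n R)
    (V : Matrix n n' R) (k : ℕ) : minors (U * M * V) k ≤ minors M k := by
  rw [minors, Ideal.span_le]
  rintro _ ⟨f, g, rfl⟩
  have : (U * M * V).submatrix f g = U.submatrix f id * M * V.submatrix id g := by
    ext a b; simp [Matrix.mul_apply]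
  rw [this]
  exact det_mul_mul_mem_minors _ _ _

theorem minors_mul_mul_eq [Fintype m] [Fintype n] [Fintype m'] [Fintype n'] [DecidableEq m]
    [DecidableEq n]
    {U : Matrix m' m R} {U' : Matrix m m' R} {V : Matrix n n' R} {V' : Matrix n' n R}
    (hU : U' * U = 1) (hV : V * V' = 1) (M : Matrix m n R) (k : ℕ) :
    minors (U * M * V) k = minors M k := by
  refine le_antisymm (minors_mul_mul_le _ _ _ _) ?_
  have : M = U' * (U * M * V) * V' := by
    calc M = (U' * U) * M * (V * V') := by rw [hU, hV]; simp
      _ = _ := by simp only [Matrix.mul_assoc]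
  conv_lhs => rw [this]
  exact minors_mul_mul_le _ _ _ _

theorem minors_square (n : ℕ) (M : Matrix (Fin n) (Fin n) R) : minors M n = Ideal.span {M.det} := by
  apply le_antisymm
  · rw [minors, Ideal.span_le]
    rintro _ ⟨f, g, rfl⟩
    have : M.submatrix f g = (1 : Matrix (Fin n) (Fin n) R).submatrix f id * M *
        (1 : Matrix (Fin n) (Fin n) R).submatrix id g := by
      ext a b; simp [Matrix.mul_apply, Matrix.one_apply]
    rw [this, Matrix.det_mul, Matrix.det_mul]
    exact Ideal.mul_mem_right _ _ (Ideal.mul_mem_left _ _ (Ideal.mem_span_singleton_self _))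
  · rw [Ideal.span_le, Set.singleton_subset_iff]
    exact det_submatrix_mem_minors M id id

/-- The ideal generated by the entries of a matrix. -/
def entries (M : Matrix m n R) : Ideal R := Ideal.span (Set.range fun p : m × n => M p.1 p.2)

theorem mem_entries (M : Matrix m n R) (a : m) (b : n) : M a b ∈ entries M :=
  Ideal.subset_span ⟨(a, b), rfl⟩

/-- Among r + 1 chosen rows, either one comes from T, and is zero modulo the entries of T, or a row
of A is repeated. Conversely, bordering A by one entry of T gives that entry times the unit det A.
-/
theorem minors_fromBlocks_diagonal {r c : ℕ} {A : Matrix (Fin r) (Fin r) R} (hA : IsUnit A.det)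
    (T : Matrix (Fin c) (Fin c) R) :
    minors (Matrix.fromBlocks A 0 0 T) (r + 1) = entries T := by
  apply le_antisymm
  · rw [minors, Ideal.span_le]
    rintro _ ⟨f, g, rfl⟩
    rw [SetLike.mem_coe, ← Ideal.Quotient.eq_zero_iff_mem, RingHom.map_det]
    set N := (Ideal.Quotient.mk (entries T)).mapMatrix
      ((Matrix.fromBlocks A 0 0 T).submatrix f g) with hN
    have hN' : ∀ a b, N a b = Ideal.Quotient.mk (entries T) (Matrix.fromBlocks A 0 0 T (f a) (g b)) :=
      fun _ _ => rfl
    by_cases h : ∃ a j, f a = Sum.inr j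
    · obtain ⟨a, j, ha⟩ := h
      refine Matrix.det_eq_zero_of_row_eq_zero a fun b => ?_
      rw [hN', ha]
      rcases g b with u | u
      · simp
      · rw [Matrix.fromBlocks_apply₂₂]
        exact Ideal.Quotient.eq_zero_iff_mem.2 (mem_entries T j u)
    · push Not at h
      have h' : ∀ a, ∃ u, f a = Sum.inl u := fun a => by
        rcases hf : f a with u | u
        · exact ⟨u, rfl⟩
        · exact absurd hf (h a u)
      choose u hu using h'
      obtain ⟨a, b, hab, hab'⟩ := Fintype.exists_ne_map_eq_of_card_lt u (by simp)
      refine Matrix.det_zero_of_row_eq hab ?_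
      funext v
      rw [hN', hN', hu, hu, hab']
  · rw [entries, Ideal.span_le]
    rintro _ ⟨⟨a, b⟩, rfl⟩
    have h := det_submatrix_mem_minors (Matrix.fromBlocks A 0 0 T)
      (Sum.elim Sum.inl (fun _ : Fin 1 => Sum.inr a) ∘ finSumFinEquiv.symm)
      (Sum.elim Sum.inl (fun _ : Fin 1 => Sum.inr b) ∘ finSumFinEquiv.symm)
    rw [← Matrix.submatrix_submatrix, Matrix.det_submatrix_equiv_self] at h
    have h2 : (Matrix.fromBlocks A 0 0 T).submatrix
        (Sum.elim Sum.inl (fun _ : Fin 1 => Sum.inr a))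
        (Sum.elim Sum.inl (fun _ : Fin 1 => Sum.inr b)) =
        Matrix.fromBlocks A 0 0 (Matrix.of fun _ _ : Fin 1 => T a b) := by
      ext s t
      rcases s with s | s <;> rcases t with t | t <;> simp
    rw [h2, Matrix.det_fromBlocks_zero₂₁] at h
    simp only [Matrix.det_unique, Matrix.of_apply] at h
    exact (Ideal.unit_mul_mem_iff_mem _ hA).1 h

theorem fromBlocks_eq_schur {r c : ℕ} (A : Matrix (Fin r) (Fin r) R) (B : Matrix (Fin r) (Fin c) R)
    (C : Matrix (Fin c) (Fin r) R) (D : Matrix (Fin c) (Fin c) R) (hA : IsUnit A.det) :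
    Matrix.fromBlocks A B C D = Matrix.fromBlocks 1 0 (C * A⁻¹) 1 *
      Matrix.fromBlocks A 0 0 (D - C * A⁻¹ * B) * Matrix.fromBlocks 1 (A⁻¹ * B) 0 1 := by
  have := A.invertibleOfIsUnitDet hA
  rw [Matrix.fromBlocks_eq_of_invertible₁₁, Matrix.invOf_eq_nonsing_inv]

theorem minors_fromBlocks {r c : ℕ} (A : Matrix (Fin r) (Fin r) R) (B : Matrix (Fin r) (Fin c) R)
    (C : Matrix (Fin c) (Fin r) R) (D : Matrix (Fin c) (Fin c) R) (hA : IsUnit A.det) :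
    minors (Matrix.fromBlocks A B C D) (r + 1) = entries (D - C * A⁻¹ * B) := by
  rw [fromBlocks_eq_schur A B C D hA, minors_mul_mul_eq
    (U' := Matrix.fromBlocks 1 0 (-(C * A⁻¹)) 1) (V' := Matrix.fromBlocks 1 (-(A⁻¹ * B)) 0 1),
    minors_fromBlocks_diagonal hA]
  · simp [Matrix.fromBlocks_multiply]
  · simp [Matrix.fromBlocks_multiply]

theorem entries_smul {u : R} (hu : IsUnit u) (M : Matrix m n R) : entries (u • M) = entries M := by
  apply le_antisymm
  · rw [entries, Ideal.span_le]
    rintro _ ⟨⟨a, b⟩, rfl⟩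
    exact Ideal.mul_mem_left _ _ (mem_entries M a b)
  · rw [entries, Ideal.span_le]
    rintro _ ⟨⟨a, b⟩, rfl⟩
    exact (Ideal.unit_mul_mem_iff_mem _ hu).1 (mem_entries (u • M) a b)

/-- The Schur complement with the denominators cleared. -/
def schurNum {r c : ℕ} (A : Matrix (Fin r) (Fin r) R) (B : Matrix (Fin r) (Fin c) R)
    (C : Matrix (Fin c) (Fin r) R) (D : Matrix (Fin c) (Fin c) R) : Matrix (Fin c) (Fin c) R :=
  A.det • D - C * A.adjugate * B

theorem schurNum_eq {r c : ℕ} (A : Matrix (Fin r) (Fin r) R) (B : Matrix (Fin r) (Fin c) R)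
    (C : Matrix (Fin c) (Fin r) R) (D : Matrix (Fin c) (Fin c) R) (hA : IsUnit A.det) :
    schurNum A B C D = A.det • (D - C * A⁻¹ * B) := by
  have : A.adjugate = A.det • A⁻¹ := by
    rw [Matrix.inv_def, smul_smul, Ring.mul_inverse_cancel _ hA, one_smul]
  rw [schurNum, smul_sub, this]
  simp

theorem schurNum_map {r c : ℕ} (A : Matrix (Fin r) (Fin r) R) (B : Matrix (Fin r) (Fin c) R)
    (C : Matrix (Fin c) (Fin r) R) (D : Matrix (Fin c) (Fin c) R) (φ : R →+* S) :
    (schurNum A B C D).map φ = schurNum (A.map φ) (B.map φ) (C.map φ) (D.map φ) := by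
  have h := φ.map_adjugate A
  have h2 := φ.map_det A
  simp only [RingHom.mapMatrix_apply] at h h2
  rw [schurNum, schurNum, ← h, ← h2, ← Matrix.map_mul, ← Matrix.map_mul]
  ext a b
  simp only [Matrix.map_apply, Matrix.sub_apply, Matrix.smul_apply, smul_eq_mul, map_sub, map_mul]

theorem det_fromBlocks_eq_schur {r c : ℕ} (A : Matrix (Fin r) (Fin r) R)
    (B : Matrix (Fin r) (Fin c) R)
    (C : Matrix (Fin c) (Fin r) R) (D : Matrix (Fin c) (Fin c) R) (hA : IsUnit A.det) :
    (Matrix.fromBlocks A B C D).det = A.det * (D - C * A⁻¹ * B).det := by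
  rw [fromBlocks_eq_schur A B C D hA, Matrix.det_mul, Matrix.det_mul,
    Matrix.det_fromBlocks_zero₁₂, Matrix.det_fromBlocks_zero₁₂, Matrix.det_fromBlocks_zero₂₁]
  simp

/-- If `Lᵀ N` is symmetric, so is the product of the Schur complements. -/
theorem isSymm_schur {r c : ℕ} {A : Matrix (Fin r) (Fin r) R} {B : Matrix (Fin r) (Fin c) R}
    {C : Matrix (Fin c) (Fin r) R} {D : Matrix (Fin c) (Fin c) R} (hA : IsUnit A.det)
    {A' : Matrix (Fin r) (Fin r) R} {B' : Matrix (Fin r) (Fin c) R}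
    {C' : Matrix (Fin c) (Fin r) R} {D' : Matrix (Fin c) (Fin c) R}
    (h : ((Matrix.fromBlocks A' B' C' D').transpose * Matrix.fromBlocks A B C D).IsSymm) :
    ((D' - C' * A⁻¹ * B).transpose * (D - C * A⁻¹ * B)).IsSymm := by
  -- Multiplying by G kills the upper block of the second matrix and leaves its Schur complement
  -- below. Hence only the lower block of the first matrix survives in Gᵀ(LᵀN)G, a congruence that
  -- preserves symmetry.
  set G : Matrix (Fin r ⊕ Fin c) (Fin c) R := Matrix.fromRows (-(A⁻¹ * B)) 1 with hG
  have key : (G.transpose * ((Matrix.fromBlocks A' B' C' D').transpose *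
      Matrix.fromBlocks A B C D) * G).IsSymm := by
    rw [Matrix.IsSymm, Matrix.transpose_mul, Matrix.transpose_mul, Matrix.transpose_transpose,
      h.eq, ← Matrix.mul_assoc]
  have h1 : Matrix.fromBlocks A B C D * G = Matrix.fromRows 0 (D - C * A⁻¹ * B) := by
    rw [hG, Matrix.fromBlocks_mul_fromRows]
    congr 1
    · rw [Matrix.mul_neg, ← Matrix.mul_assoc, Matrix.mul_nonsing_inv _ hA]; simp
    · rw [Matrix.mul_neg, ← Matrix.mul_assoc, Matrix.mul_one]; abel
  have h2 : Matrix.fromBlocks A' B' C' D' * G =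
      Matrix.fromRows (B' - A' * A⁻¹ * B) (D' - C' * A⁻¹ * B) := by
    rw [hG, Matrix.fromBlocks_mul_fromRows]
    congr 1 <;>
    · rw [Matrix.mul_neg, ← Matrix.mul_assoc, Matrix.mul_one]; abel
  rw [Matrix.mul_assoc, Matrix.mul_assoc, h1, ← Matrix.mul_assoc, ← Matrix.transpose_mul, h2,
    Matrix.transpose_fromRows, Matrix.fromCols_mul_fromRows, Matrix.mul_zero, zero_add] at key
  exact key

end Minors

/-! ### The degeneracy ideals and the minors of the chart matrices -/

section DegeneracyMinors

variable {R : Type*} [CommRing R]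

/-- The factor φ(xᵢ) pays for replacing each bivector by the contraction from `wdg_contract`; after
that, every matrix of pairings factors through `bMat`. -/
theorem map_minorMatrix (φ : CoordRing →+* R) {k : ℕ} (c : Fin k → Fin 10 → ℂ)
    (w : Fin k → Fin 6 → Fin 6 → ℂ) (i : Fin 6) (hw : ∀ b, IsAlt (w b)) :
    φ (MvPolynomial.X i) • (minorMatrix c w).map φ =
      (Matrix.of fun a s => φ (MvPolynomial.C (c a s))) * bMat i (fun j => φ (MvPolynomial.X j)) *
      Matrix.of fun t b => yv i (fun j => φ (MvPolynomial.X j))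
        (fun j k => φ (MvPolynomial.C (w b j k))) t := by
  rw [Matrix.mul_assoc]
  ext a b
  rw [Matrix.mul_apply]
  have h : ∀ s, (bMat i (fun j => φ (MvPolynomial.X j)) * Matrix.of fun t b =>
      yv i (fun j => φ (MvPolynomial.X j)) (fun j k => φ (MvPolynomial.C (w b j k))) t) s b =
      φ (MvPolynomial.X i) * bC (wdg (fun j => φ (MvPolynomial.X j))
        (fun j k => φ (MvPolynomial.C (w b j k)))) s := by
    intro s
    refine congrFun (bMat_mulVec_yv i (fun j => φ (MvPolynomial.X j))
      (w := fun j k => φ (MvPolynomial.C (w b j k))) ⟨fun j => ?_, fun j k => ?_⟩) s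
    · simp [(hw b).1]
    · simp [(hw b).2 j k]
  simp only [h, Matrix.smul_apply, Matrix.map_apply, minorMatrix, Matrix.of_apply, map_sum, map_mul,
    bC_map, wdg_map, smul_eq_mul, Finset.mul_sum]
  exact Finset.sum_congr rfl fun s _ => by ring

theorem minors_le_map_degeneracyIdeal (φ : CoordRing →+* R) (i : Fin 6) (l : ℕ) :
    minors (bMat i fun j => φ (MvPolynomial.X j)) (11 - l) ≤
      (degeneracyIdeal kleinLagrangian l).map φ := by
  rw [← bMat_map φ, ← minors_map]
  refine Ideal.map_mono ?_
  rw [degeneracyIdeal_eq, minors]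
  refine Ideal.span_mono ?_
  rintro _ ⟨f, g, rfl⟩
  refine ⟨fun a => Pi.single (f a) 1, fun b l m => (wv i (g b) l m : ℂ),
    fun b => isAlt_wv i (g b), ?_⟩
  congr 1
  ext a b : 2
  simp only [minorMatrix, Matrix.of_apply, Matrix.submatrix_apply, bMat]
  rw [Finset.sum_eq_single (f a)]
  · simp
  · intro s _ hs; simp [hs]
  · simp

/-- By `map_minorMatrix`, a generator times a power of the unit φ(xᵢ) is the determinant of a
product P · bMat · Q, and so lies in the ideal of minors of `bMat`. -/
theorem map_degeneracyIdeal (φ : CoordRing →+* R) (i : Fin 6) (hi : IsUnit (φ (MvPolynomial.X i)))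
    (l : ℕ) : (degeneracyIdeal kleinLagrangian l).map φ =
      minors (bMat i fun j => φ (MvPolynomial.X j)) (11 - l) := by
  refine le_antisymm ?_ (minors_le_map_degeneracyIdeal φ i l)
  rw [degeneracyIdeal_eq, Ideal.map_span, Ideal.span_le]
  rintro _ ⟨_, ⟨c, w, hw, rfl⟩, rfl⟩
  have h := congrArg Matrix.det (map_minorMatrix φ c w i hw)
  rw [Matrix.det_smul] at h
  have h2 := det_mul_mul_mem_minors (Matrix.of fun a s => φ (MvPolynomial.C (c a s)))
    (bMat i (fun j => φ (MvPolynomial.X j))) (Matrix.of fun t b =>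
      yv i (fun j => φ (MvPolynomial.X j)) (fun j k => φ (MvPolynomial.C (w b j k))) t)
  rw [← h] at h2
  rw [RingHom.map_det]
  exact (Ideal.unit_mul_mem_iff_mem _ (hi.pow _)).1 h2

theorem det_bMat (φ : CoordRing →+* R) (i : Fin 6) :
    (bMat i fun j => φ (MvPolynomial.X j)).det = -(φ (MvPolynomial.X i) ^ 4 * φ kleinSextic) := by
  rw [← bMat_map φ]
  have := φ.map_det (bMat i MvPolynomial.X)
  rw [RingHom.mapMatrix_apply] at this
  rw [← this, det_bMat_X]
  simp

/-- On each chart, the degeneracy locus `Y_A^{≥ 1}` is defined by the sextic. -/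
theorem map_degeneracyIdeal_one (φ : CoordRing →+* R) (i : Fin 6)
    (hi : IsUnit (φ (MvPolynomial.X i))) :
    (degeneracyIdeal kleinLagrangian 1).map φ = (Ideal.span {kleinSextic}).map φ := by
  rw [map_degeneracyIdeal φ i hi, minors_square, det_bMat, Ideal.map_span, Set.image_singleton,
    ← Ideal.span_singleton_neg, neg_neg, Ideal.span_singleton_mul_left_unit (hi.pow 4)]

theorem chartIdeal_degeneracyIdeal_one (i : Fin 6) :
    chartIdeal (degeneracyIdeal kleinLagrangian 1) i =
      chartIdeal (Ideal.span {kleinSextic}) i := by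
  rw [chartIdeal, chartIdeal, map_degeneracyIdeal_one _ i
    (IsLocalization.Away.algebraMap_isUnit _)]

/-- The closed subscheme of the chart `xᵢ ≠ 0` attached to an ideal of its coordinate ring. -/
def chartMapOf (i : Fin 6)
    (J : Ideal (HomogeneousLocalization.Away grading (MvPolynomial.X i : CoordRing))) :
    Spec (CommRingCat.of
      (HomogeneousLocalization.Away grading (MvPolynomial.X i : CoordRing) ⧸ J)) ⟶ P5 :=
  Spec.map (CommRingCat.ofHom (Ideal.Quotient.mk J)) ≫
    Proj.awayι grading (MvPolynomial.X i) (X_mem_grading i) Nat.one_pos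

theorem idealSheaf_congr {I J : Ideal CoordRing} (h : ∀ i, chartIdeal I i = chartIdeal J i) :
    idealSheaf I = idealSheaf J := by
  unfold idealSheaf
  congr 1
  funext i
  -- The source of `chartMap` depends on the ideal. Abstracting that ideal lets the equality be
  -- substituted.
  exact congrArg (fun J => (chartMapOf i J).ker) (h i)

end DegeneracyMinors

end

end KleinEPW

namespace KleinEPW

noncomputable section

/-! ### Local equations of the degeneracy loci -/

section LocalForm

/-- The derivation of the coordinate ring in the direction `t`. -/
def dd (t : Fin 6 → ℂ) : Derivation ℂ CoordRing CoordRing :=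
  MvPolynomial.mkDerivation ℂ fun j => MvPolynomial.C (t j)

theorem dd_X (t : Fin 6 → ℂ) (j : Fin 6) : dd t (MvPolynomial.X j) = MvPolynomial.C (t j) := by
  simp [dd, MvPolynomial.mkDerivation_X]

theorem dd_C (t : Fin 6 → ℂ) (z : ℂ) : dd t (MvPolynomial.C z) = 0 := by
  simp [dd]

theorem eval_dd_mul (p t : Fin 6 → ℂ) (f g : CoordRing) :
    MvPolynomial.eval p (dd t (f * g)) = MvPolynomial.eval p f * MvPolynomial.eval p (dd t g) +
      MvPolynomial.eval p g * MvPolynomial.eval p (dd t f) := by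
  simp [Derivation.leibniz]

/-- The bilinear pairing `(w, w') ↦ ⟨p ∧ w, t ∧ w'⟩`. -/
def bet (p t : Fin 6 → ℂ) (w w' : Fin 6 → Fin 6 → ℂ) : ℂ :=
  ∑ s, aC (wdg p w) s * bC (wdg t w') s

/-- Local equations near `p` of the degeneracy loci, where the corank at `p` is `c`. -/
structure LocalForm (p : Fin 6 → ℂ) (c : ℕ) where
  -- In the construction, `m` and `α` are Schur complements, multiplied by a determinant, obtained
  -- from `bMat` and `aMat`; `d` is xᵢ times the determinant of the pivot block, `u` is the value of
  -- that determinant at p, and the vectors p ∧ κ_a span the intersection with A.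
  m : Matrix (Fin c) (Fin c) CoordRing
  α : Matrix (Fin c) (Fin c) CoordRing
  d : CoordRing
  u : ℂ
  κ : Fin c → Fin 6 → Fin 6 → ℂ
  i : Fin 6
  isUnit_X : ∀ {R : Type} [CommRing R] (φ : CoordRing →+* R), IsUnit (φ d) →
    IsUnit (φ (MvPolynomial.X i))
  eval_d : MvPolynomial.eval p d ≠ 0
  u_ne : u ≠ 0
  eval_m : ∀ a b, MvPolynomial.eval p (m a b) = 0
  eval_α : ∀ a b, MvPolynomial.eval p (α a b) = if a = b then u else 0
  eval_dd_m : ∀ t a b, MvPolynomial.eval p (dd t (m a b)) = u * bet p t (κ a) (κ b)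
  isAlt_κ : ∀ a, IsAlt (κ a)
  bC_κ : ∀ a, bC (wdg p (κ a)) = 0
  indep_κ : ∀ z : Fin c → ℂ, wdg p (∑ a, z a • κ a) = 0 → z = 0
  map_eq : ∀ {R : Type} [CommRing R] (φ : CoordRing →+* R), IsUnit (φ d) →
    (degeneracyIdeal kleinLagrangian c).map φ = entries (m.map φ)
  map_succ : ∀ {R : Type} [CommRing R] (φ : CoordRing →+* R), IsUnit (φ d) →
    (degeneracyIdeal kleinLagrangian (c + 1)).map φ = ⊤
  map_one : ∀ {R : Type} [CommRing R] (φ : CoordRing →+* R), IsUnit (φ d) →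
    (degeneracyIdeal kleinLagrangian 1).map φ = Ideal.span {φ m.det}
  symm : ∀ {R : Type} [CommRing R] (φ : CoordRing →+* R), IsUnit (φ d) →
    ((α.map φ).transpose * m.map φ).IsSymm

/-- The kernel of the chart matrix at a point. -/
abbrev kerAt (i : Fin 6) (p : Fin 6 → ℂ) : Submodule ℂ (Fin 10 → ℂ) :=
  LinearMap.ker (Matrix.mulVecLin (bMat i p))

theorem eq_zero_of_alternating {η : Fin 6 → Fin 6 → Fin 6 → ℂ} (h1 : ∀ i j k, η j i k = -η i j k)
    (h2 : ∀ i j k, η i k j = -η i j k) (h : ∀ i j k, i < j → j < k → η i j k = 0) : η = 0 := by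
  have d1 : ∀ i k, η i i k = 0 := fun i k => self_eq_neg.1 (h1 i i k)
  have d2 : ∀ i k, η i k k = 0 := fun i k => self_eq_neg.1 (h2 i k k)
  have d3 : ∀ i k, η i k i = 0 := fun i k => by rw [h2, d1, neg_zero]
  have key : ∀ i j k, i < j → η i j k = 0 := by
    intro i j k hij
    rcases lt_trichotomy j k with hjk | rfl | hjk
    · exact h i j k hij hjk
    · exact d2 _ _
    · rw [h2, neg_eq_zero]
      rcases lt_trichotomy i k with hik | rfl | hik
      · exact h i k j hik hjk
      · exact d1 _ _
      · rw [h1, neg_eq_zero]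
        exact h k i j hik hij
  funext i j k
  rcases lt_trichotomy i j with hij | rfl | hij
  · exact key i j k hij
  · exact d1 _ _
  · rw [h1, key j i k hij]; exact neg_zero

/-- The forms `aC` and `bC` together are coordinates on ⋀³V₆: once `aC` vanishes, `bC` is, up to
signs, the list of the other ten coordinates. -/
theorem eq_zero_of_aC_bC {η : Fin 6 → Fin 6 → Fin 6 → ℂ} (h1 : ∀ i j k, η j i k = -η i j k)
    (h2 : ∀ i j k, η i k j = -η i j k) (ha : aC η = 0) (hb : bC η = 0) : η = 0 := by
  have a0 : η 0 1 2 = 0 := congrFun ha 0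
  have a1 : η 0 1 3 = 0 := congrFun ha 1
  have a2 : η 0 1 4 = 0 := congrFun ha 2
  have a3 : η 0 1 5 = 0 := congrFun ha 3
  have a4 : η 0 2 3 = 0 := congrFun ha 4
  have a5 : η 0 2 4 = 0 := congrFun ha 5
  have a6 : η 0 2 5 = 0 := congrFun ha 6
  have a7 : η 0 3 4 = 0 := congrFun ha 7
  have a8 : η 0 3 5 = 0 := congrFun ha 8
  have a9 : η 0 4 5 = 0 := congrFun ha 9
  have b0 : η 3 4 5 + η 0 1 3 = 0 := congrFun hb 0
  have b1 : -η 2 4 5 + η 0 1 2 = 0 := congrFun hb 1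
  have b2 : η 2 3 5 - η 0 4 5 = 0 := congrFun hb 2
  have b3 : -η 2 3 4 + η 0 2 5 = 0 := congrFun hb 3
  have b4 : η 1 4 5 + η 0 2 4 = 0 := congrFun hb 4
  have b5 : -η 1 3 5 + η 0 2 3 = 0 := congrFun hb 5
  have b6 : η 1 3 4 + η 0 1 5 = 0 := congrFun hb 6
  have b7 : η 1 2 5 + η 0 3 5 = 0 := congrFun hb 7
  have b8 : -η 1 2 4 + η 0 3 4 = 0 := congrFun hb 8
  have b9 : η 1 2 3 - η 0 1 4 = 0 := congrFun hb 9
  simp only [a0, a1, a2, a3, a4, a5, a6, a7, a8, a9, add_zero, sub_zero, neg_eq_zero] at b0 b1 b2 b3 b4 b5 b6 b7 b8 b9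
  refine eq_zero_of_alternating h1 h2 fun i j k hij hjk => ?_
  fin_cases i <;> fin_cases j <;> first | exact absurd hij (by decide) | skip
  all_goals fin_cases k <;> first | exact absurd hjk (by decide) | assumption

theorem wdg_eq_zero_of_aC_bC {x : Fin 6 → ℂ} {w : Fin 6 → Fin 6 → ℂ} (hw : IsAlt w)
    (ha : aC (wdg x w) = 0) (hb : bC (wdg x w) = 0) : wdg x w = 0 := by
  refine eq_zero_of_aC_bC (fun i j k => ?_) (fun i j k => ?_) ha hb
  · simp only [wdg]; rw [hw.2 i j]; ring
  · simp only [wdg]; rw [hw.2 j k]; ring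

theorem wv_self : ∀ i t k, wv i t i k = 0 := by decide +kernel

theorem wv_pr : ∀ i s t, wv i s (ch i (pr t).1) (ch i (pr t).2) = if s = t then 1 else 0 := by
  decide +kernel

theorem arr_self {R : Type*} [CommRing R] (i : Fin 6) (y : Fin 10 → R) (k : Fin 6) :
    arr i y i k = 0 := by
  simp [arr, wv_self]

theorem arr_pr {R : Type*} [CommRing R] (i : Fin 6) (y : Fin 10 → R) (t : Fin 10) :
    arr i y (ch i (pr t).1) (ch i (pr t).2) = y t := by
  simp [arr, wv_pr]

theorem eq_zero_of_wdg_arr {i : Fin 6} {p : Fin 6 → ℂ} (hp : p i ≠ 0) {y : Fin 10 → ℂ}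
    (h : wdg p (arr i y) = 0) : y = 0 := by
  funext t
  have h1 := congrFun (congrFun (congrFun h i) (ch i (pr t).1)) (ch i (pr t).2)
  simp only [wdg, arr_self, arr_pr] at h1
  simpa [hp] using h1

/-- Completion of a linearly independent family to an invertible matrix. -/
theorem exists_matrix_completion {r c n : ℕ} (hrc : r + c = n) (k : Fin c → Fin n → ℂ)
    (hk : LinearIndependent ℂ k) : ∃ (V : Matrix (Fin n) (Fin r ⊕ Fin c) ℂ)
      (V' : Matrix (Fin r ⊕ Fin c) (Fin n) ℂ), V * V' = 1 ∧ V' * V = 1 ∧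
      ∀ a s, V s (Sum.inr a) = k a s := by
  have h1 : Module.finrank ℂ ((Fin n → ℂ) ⧸ Submodule.span ℂ (Set.range k)) = r := by
    have := Submodule.finrank_quotient_add_finrank (Submodule.span ℂ (Set.range k))
    rw [finrank_span_eq_card hk, Module.finrank_fin_fun, Fintype.card_fin] at this
    omega
  let B := (Module.Basis.sumQuot (Module.Basis.span hk)
    (Module.finBasisOfFinrankEq ℂ _ h1)).reindex (Equiv.sumComm _ _)
  refine ⟨(Pi.basisFun ℂ (Fin n)).toMatrix B, B.toMatrix (Pi.basisFun ℂ (Fin n)),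
    Module.Basis.toMatrix_mul_toMatrix_flip _ _, Module.Basis.toMatrix_mul_toMatrix_flip _ _,
    fun a s => ?_⟩
  rw [Module.Basis.toMatrix_apply, Pi.basisFun_repr, Module.Basis.reindex_apply]
  have : (Equiv.sumComm (Fin c) (Fin r)).symm (Sum.inr a) = Sum.inl a := rfl
  rw [this, Module.Basis.sumQuot_inl, Module.Basis.span_apply]

theorem minors_submatrix_equiv {R m n m' n' : Type*} [CommRing R] (M : Matrix m n R)
    (e : m' ≃ m) (e' : n' ≃ n) (k : ℕ) : minors (M.submatrix e e') k = minors M k := by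
  rw [minors, minors]
  congr 1
  ext p
  constructor
  · rintro ⟨f, g, rfl⟩
    exact ⟨e ∘ f, e' ∘ g, rfl⟩
  · rintro ⟨f, g, rfl⟩
    refine ⟨e.symm ∘ f, e'.symm ∘ g, ?_⟩
    congr 1
    ext a b
    simp

theorem minors_card {R m : Type*} [CommRing R] [Fintype m] [DecidableEq m] {k : ℕ}
    (hk : Fintype.card m = k) (M : Matrix m m R) : minors M k = Ideal.span {M.det} := by
  have e := (Fintype.equivFinOfCardEq hk).symm
  rw [← minors_submatrix_equiv M e e, minors_square, Matrix.det_submatrix_equiv_self]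

theorem eval_dd_bMat (i : Fin 6) (p t : Fin 6 → ℂ) (s s' : Fin 10) :
    MvPolynomial.eval p (dd t (bMat i MvPolynomial.X s s')) = bMat i t s s' := by
  rw [bMat_apply, bMat_apply, map_sum, map_sum]
  refine Finset.sum_congr rfl fun l _ => ?_
  rw [eval_dd_mul, dd_X]
  have : ((bco i s s' l : ℤ) : CoordRing) = MvPolynomial.C ((bco i s s' l : ℤ) : ℂ) := by simp
  rw [this, dd_C]
  simp [mul_comm]

/-- Left kernel vectors of the chart matrix. -/
theorem aMat_mulVec_vecMul_bMat {i : Fin 6} {p : Fin 6 → ℂ} {k : Fin 10 → ℂ}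
    (hk : (bMat i p).mulVec k = 0) :
    Matrix.vecMul ((aMat i p).mulVec k) (bMat i p) = 0 := by
  rw [← Matrix.vecMul_transpose, Matrix.vecMul_vecMul, ← (aMat_transpose_mul_bMat_symm i p).eq,
    Matrix.transpose_mul, Matrix.transpose_transpose, ← Matrix.vecMul_vecMul,
    Matrix.vecMul_transpose, hk, Matrix.zero_vecMul]

/-- Constant changes of basis adapted to the right kernel of `bMat i p` and to its left kernel, the
image of the right one under `aMat i p`, make the matrix at p an invertible block bordered by zeros.
Eliminating that block gives the local equations. -/
theorem nonempty_localForm {p : Fin 6 → ℂ} {i : Fin 6} (hp : p i ≠ 0) {c : ℕ}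
    (hc : Module.finrank ℂ (kerAt i p) = c) : Nonempty (LocalForm p c) := by
  have hc10 : c ≤ 10 := by
    rw [← hc]
    exact (Submodule.finrank_le _).trans (by simp)
  obtain ⟨r, hr⟩ : ∃ r, r + c = 10 := ⟨10 - c, by omega⟩
  have hrc : 11 - c = r + 1 := by omega
  let bk := Module.finBasisOfFinrankEq ℂ (kerAt i p) hc
  let k : Fin c → Fin 10 → ℂ := fun a => (bk a : Fin 10 → ℂ)
  have hkker : ∀ a, (bMat i p).mulVec (k a) = 0 := fun a => (bk a).2
  have hki : LinearIndependent ℂ k :=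
    bk.linearIndependent.map' (kerAt i p).subtype (Submodule.ker_subtype _)
  have hspan : ∀ v, (bMat i p).mulVec v = 0 → ∃ z : Fin c → ℂ, v = ∑ a, z a • k a := by
    intro v hv
    refine ⟨bk.repr ⟨v, hv⟩, ?_⟩
    have := congrArg Subtype.val (bk.sum_repr ⟨v, hv⟩)
    rw [Submodule.coe_sum] at this
    exact this.symm
  have hzero : ∀ z : Fin c → ℂ, wdg p (arr i (∑ a, z a • k a)) = 0 → z = 0 := by
    intro z hz
    have h1 := eq_zero_of_wdg_arr hp hz
    funext a
    exact Fintype.linearIndependent_iff.1 hki z h1 a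
  let k' : Fin c → Fin 10 → ℂ := fun a => (aMat i p).mulVec (k a)
  have hk'i : LinearIndependent ℂ k' := by
    rw [Fintype.linearIndependent_iff]
    intro z hz
    have h1 : (aMat i p).mulVec (∑ a, z a • k a) = 0 := by
      rw [← hz, Matrix.mulVec_sum]
      exact Finset.sum_congr rfl fun a _ => Matrix.mulVec_smul _ _ _
    have h2 : (bMat i p).mulVec (∑ a, z a • k a) = 0 := by
      rw [Matrix.mulVec_sum]
      refine Finset.sum_eq_zero fun a _ => ?_
      rw [Matrix.mulVec_smul, hkker, smul_zero]
    rw [aMat_mulVec] at h1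
    rw [bMat_mulVec] at h2
    -- A relation between the left kernel vectors gives a kernel vector whose `aC` coordinates also
    -- vanish. It then represents the zero trivector, and the wedge with p is injective on bivectors
    -- without i-component.
    exact congrFun (hzero z (wdg_eq_zero_of_aC_bC (isAlt_arr _ _) h1 h2))
  obtain ⟨V, V', hV, hV', hVk⟩ := exists_matrix_completion hr k hki
  obtain ⟨Ut, Ut', hU, hU', hUk⟩ := exists_matrix_completion hr k' hk'i
  let C' : ℂ →+* CoordRing := MvPolynomial.C
  let N : Matrix (Fin r ⊕ Fin c) (Fin r ⊕ Fin c) CoordRing :=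
    (Ut.map C').transpose * bMat (R := CoordRing) i MvPolynomial.X * V.map C'
  -- The inverse of `Ut` is used here so that LᵀN is congruent to aMatᵀ · bMat and inherits its
  -- symmetry. As the last columns of `Ut` are aMat · k, the lower right block of L at p is the
  -- identity.
  let L : Matrix (Fin r ⊕ Fin c) (Fin r ⊕ Fin c) CoordRing :=
    Ut'.map C' * aMat (R := CoordRing) i MvPolynomial.X * V.map C'
  have hNb : Matrix.fromBlocks N.toBlocks₁₁ N.toBlocks₁₂ N.toBlocks₂₁ N.toBlocks₂₂ = N :=
    Matrix.fromBlocks_toBlocks N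
  have hLb : Matrix.fromBlocks L.toBlocks₁₁ L.toBlocks₁₂ L.toBlocks₂₁ L.toBlocks₂₂ = L :=
    Matrix.fromBlocks_toBlocks L
  have hLN : (L.transpose * N).IsSymm := by
    have : L.transpose * N = (V.map C').transpose *
        ((aMat (R := CoordRing) i MvPolynomial.X).transpose * bMat (R := CoordRing) i MvPolynomial.X) * V.map C' := by
      have h1 : (Ut'.map C').transpose * (Ut.map C').transpose = 1 := by
        rw [← Matrix.transpose_mul, ← Matrix.map_mul, hU]
        simp
      calc L.transpose * N = (V.map C').transpose * (aMat (R := CoordRing) i MvPolynomial.X).transpose *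
          ((Ut'.map C').transpose * (Ut.map C').transpose) * bMat (R := CoordRing) i MvPolynomial.X * V.map C' := by
            simp only [L, N, Matrix.transpose_mul, Matrix.mul_assoc]
        _ = _ := by rw [h1, Matrix.mul_one]; simp only [Matrix.mul_assoc]
    rw [this, Matrix.IsSymm, Matrix.transpose_mul, Matrix.transpose_mul,
      (aMat_transpose_mul_bMat_symm i _).eq, Matrix.transpose_transpose]
    simp only [Matrix.mul_assoc]
  have hNp : N.map (MvPolynomial.eval p) = Ut.transpose * bMat i p * V := by
    have hbp := bMat_map (MvPolynomial.eval p) i MvPolynomial.X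
    simp only [MvPolynomial.eval_X] at hbp
    simp only [N, Matrix.map_mul, hbp]
    congr 2 <;> ext <;> simp [C']
  have hrow : ∀ a j, (Ut.transpose * bMat i p * V) (Sum.inr a) j = 0 := by
    intro a j
    rw [Matrix.mul_apply]
    refine Finset.sum_eq_zero fun s _ => ?_
    have h1 : (Ut.transpose * bMat i p) (Sum.inr a) s = Matrix.vecMul (k' a) (bMat i p) s := by
      simp [Matrix.mul_apply, Matrix.vecMul, dotProduct, hUk]
    rw [h1, aMat_mulVec_vecMul_bMat (hkker a)]
    simp
  have hcol : ∀ a j, (Ut.transpose * bMat i p * V) j (Sum.inr a) = 0 := by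
    intro a j
    rw [Matrix.mul_assoc, Matrix.mul_apply]
    refine Finset.sum_eq_zero fun s _ => ?_
    have h1 : (bMat i p * V) s (Sum.inr a) = (bMat i p).mulVec (k a) s := by
      simp [Matrix.mul_apply, Matrix.mulVec, dotProduct, hVk]
    rw [h1, hkker a]
    simp
  have e12 : ∀ a b, MvPolynomial.eval p (N.toBlocks₁₂ a b) = 0 := fun a b => by
    have := congrFun (congrFun hNp (Sum.inl a)) (Sum.inr b)
    rw [hcol] at this; exact this
  have e21 : ∀ a b, MvPolynomial.eval p (N.toBlocks₂₁ a b) = 0 := fun a b => by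
    have := congrFun (congrFun hNp (Sum.inr a)) (Sum.inl b)
    rw [hrow] at this; exact this
  have e22 : ∀ a b, MvPolynomial.eval p (N.toBlocks₂₂ a b) = 0 := fun a b => by
    have := congrFun (congrFun hNp (Sum.inr a)) (Sum.inr b)
    rw [hrow] at this; exact this
  -- A null vector of the pivot block, extended by zero, is null for all of N(p) because the lower
  -- rows vanish. It then corresponds to a combination of the `k`, which occupy the complementary
  -- coordinates, so it is zero.
  have hdet : MvPolynomial.eval p N.toBlocks₁₁.det ≠ 0 := by
    rw [RingHom.map_det]
    intro h0
    obtain ⟨v, hv, hv0⟩ := Matrix.exists_mulVec_eq_zero_iff.2 h0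
    apply hv
    have h1 : (Ut.transpose * bMat i p * V).mulVec (Sum.elim v 0) = 0 := by
      funext j
      rcases j with j | j
      · have := congrFun hv0 j
        rw [← hNp]
        simpa [Matrix.mulVec, dotProduct, Fintype.sum_sum_type, Matrix.toBlocks₁₁] using this
      · simp only [Matrix.mulVec, dotProduct, hrow, zero_mul, Finset.sum_const_zero, Pi.zero_apply]
    have h2 : (bMat i p).mulVec (V.mulVec (Sum.elim v 0)) = 0 := by
      have h3 : Ut'.transpose * (Ut.transpose * bMat i p * V) = bMat i p * V := by
        rw [← Matrix.mul_assoc, ← Matrix.mul_assoc, ← Matrix.transpose_mul, hU]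
        simp
      rw [Matrix.mulVec_mulVec, ← h3, ← Matrix.mulVec_mulVec, h1, Matrix.mulVec_zero]
    obtain ⟨z, hz⟩ := hspan _ h2
    have h4 : V.mulVec (Sum.elim v 0) = V.mulVec (Sum.elim 0 z) := by
      rw [hz]
      funext s
      simp [Matrix.mulVec, dotProduct, hVk, mul_comm]
    have h5 := congrArg V'.mulVec h4
    rw [Matrix.mulVec_mulVec, Matrix.mulVec_mulVec, hV', Matrix.one_mulVec, Matrix.one_mulVec] at h5
    funext j
    simpa using congrFun h5 (Sum.inl j)
  have hNφ : ∀ {R : Type} [CommRing R] (φ : CoordRing →+* R), N.map φ =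
      (Ut.map (φ.comp C')).transpose * bMat i (fun j => φ (MvPolynomial.X j)) *
        V.map (φ.comp C') := by
    intro R _ φ
    simp only [N, Matrix.map_mul, bMat_map]
    rfl
  have hNφb : ∀ {R : Type} [CommRing R] (φ : CoordRing →+* R), N.map φ =
      Matrix.fromBlocks (N.toBlocks₁₁.map φ) (N.toBlocks₁₂.map φ) (N.toBlocks₂₁.map φ)
        (N.toBlocks₂₂.map φ) := by
    intro R _ φ
    rw [← Matrix.fromBlocks_map, hNb]
  have hmin : ∀ {R : Type} [CommRing R] (φ : CoordRing →+* R) (n : ℕ), minors (N.map φ) n =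
      minors (bMat i (fun j => φ (MvPolynomial.X j))) n := by
    intro R _ φ n
    rw [hNφ]
    refine minors_mul_mul_eq (U' := (Ut'.map (φ.comp C')).transpose) (V' := V'.map (φ.comp C'))
      ?_ ?_ _ _
    · rw [← Matrix.transpose_mul, ← Matrix.map_mul, hU]; simp
    · rw [← Matrix.map_mul, hV]; simp
  have hunit : ∀ {R : Type} [CommRing R] (φ : CoordRing →+* R),
      IsUnit (φ (MvPolynomial.X i * N.toBlocks₁₁.det)) →
      IsUnit (φ (MvPolynomial.X i)) ∧ IsUnit (N.toBlocks₁₁.map φ).det := by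
    intro R _ φ h
    rw [map_mul, RingHom.map_det] at h
    exact ⟨isUnit_of_mul_isUnit_left h, isUnit_of_mul_isUnit_right h⟩
  refine ⟨{
    m := schurNum N.toBlocks₁₁ N.toBlocks₁₂ N.toBlocks₂₁ N.toBlocks₂₂
    α := schurNum N.toBlocks₁₁ N.toBlocks₁₂ L.toBlocks₂₁ L.toBlocks₂₂
    d := MvPolynomial.X i * N.toBlocks₁₁.det
    u := MvPolynomial.eval p N.toBlocks₁₁.det
    κ := fun a => arr i (k a)
    i := i
    isUnit_X := fun φ hφ => (hunit φ hφ).1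
    eval_d := by
      rw [map_mul, MvPolynomial.eval_X]
      exact mul_ne_zero hp hdet
    u_ne := hdet
    eval_m := ?_
    eval_α := ?_
    eval_dd_m := ?_
    isAlt_κ := fun a => isAlt_arr _ _
    bC_κ := fun a => by rw [← bMat_mulVec]; exact hkker a
    indep_κ := ?_
    map_eq := ?_
    map_succ := ?_
    map_one := ?_
    symm := ?_ }⟩
  · intro a b
    simp only [schurNum, Matrix.sub_apply, Matrix.smul_apply, smul_eq_mul, map_sub, map_mul, e22,
      Matrix.mul_apply, map_sum, e12, mul_zero, Finset.sum_const_zero, sub_zero]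
  · intro a b
    simp only [schurNum, Matrix.sub_apply, Matrix.smul_apply, smul_eq_mul, map_sub, map_mul,
      Matrix.mul_apply, map_sum, e12, mul_zero, Finset.sum_const_zero, sub_zero]
    have hap := aMat_map (MvPolynomial.eval p) i MvPolynomial.X
    simp only [MvPolynomial.eval_X] at hap
    have h1 : L.map (MvPolynomial.eval p) = Ut' * (aMat i p * V) := by
      simp only [L, Matrix.map_mul, hap, Matrix.mul_assoc]
      congr 2 <;> ext <;> simp [C']
    have h2 : MvPolynomial.eval p (L.toBlocks₂₂ a b) = (Ut' * Ut) (Sum.inr a) (Sum.inr b) := by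
      have h3 := congrFun (congrFun h1 (Sum.inr a)) (Sum.inr b)
      refine h3.trans ?_
      rw [Matrix.mul_apply, Matrix.mul_apply]
      refine Finset.sum_congr rfl fun s _ => ?_
      congr 1
      rw [hUk]
      simp [Matrix.mul_apply, Matrix.mulVec, dotProduct, hVk, k']
    rw [h2, hU', Matrix.one_apply]
    simp
  · intro t a b
    -- The off-diagonal blocks both vanish at p, so the correction term of the Schur complement has
    -- zero differential, and only the linear block N₂₂ contributes.
    have h0 : ∀ l, MvPolynomial.eval p ((N.toBlocks₂₁ * N.toBlocks₁₁.adjugate) a l) = 0 := by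
      intro l
      simp [Matrix.mul_apply, e21]
    simp only [schurNum, Matrix.sub_apply, Matrix.smul_apply, smul_eq_mul, map_sub]
    rw [eval_dd_mul, e22, zero_mul, add_zero, Matrix.mul_apply, map_sum, map_sum]
    simp only [eval_dd_mul, h0, e12, zero_mul, add_zero, Finset.sum_const_zero, sub_zero]
    congr 1
    have h1 : N.toBlocks₂₂ a b = ∑ s', (∑ s, C' (Ut s (Sum.inr a)) *
        bMat (R := CoordRing) i MvPolynomial.X s s') * C' (V s' (Sum.inr b)) := by
      simp only [N, Matrix.toBlocks₂₂, Matrix.of_apply, Matrix.mul_apply, Matrix.map_apply,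
        Matrix.transpose_apply]
    rw [h1]
    simp only [map_sum, eval_dd_mul, C', dd_C, eval_dd_bMat, MvPolynomial.eval_C, map_zero,
      mul_zero, zero_add, add_zero, hUk, hVk]
    have h2 : bet p t (arr i (k a)) (arr i (k b)) = ∑ s, k' a s * ∑ s', bMat i t s s' * k b s' := by
      simp only [bet, ← aMat_mulVec, ← bMat_mulVec]
      rfl
    rw [h2]
    simp only [Finset.mul_sum]
    rw [Finset.sum_comm]
    refine Finset.sum_congr rfl fun s _ => Finset.sum_congr rfl fun s' _ => by ring
  · intro z hz
    apply hzero
    rw [← hz]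
    congr 1
    funext l m
    simp only [arr, Finset.sum_apply, Pi.smul_apply, smul_eq_mul, Finset.sum_mul, Finset.mul_sum]
    rw [Finset.sum_comm]
    refine Finset.sum_congr rfl fun s _ => Finset.sum_congr rfl fun s' _ => by ring
  · intro R _ φ hφ
    obtain ⟨h1, h2⟩ := hunit φ hφ
    rw [map_degeneracyIdeal φ i h1, hrc, ← hmin, hNφb, minors_fromBlocks _ _ _ _ h2, schurNum_map,
      schurNum_eq _ _ _ _ h2, entries_smul h2]
  · intro R _ φ hφ
    obtain ⟨h1, h2⟩ := hunit φ hφ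
    -- For corank c + 1 the minors have size 10 - c, the size of the pivot block, whose determinant
    -- is a unit.
    have hrc' : 11 - (c + 1) = r := by omega
    rw [map_degeneracyIdeal φ i h1, hrc', ← hmin]
    exact Ideal.eq_top_of_isUnit_mem _
      (det_submatrix_mem_minors (N.map φ) (fun a : Fin r => Sum.inl a) fun a => Sum.inl a) h2
  · intro R _ φ hφ
    obtain ⟨h1, h2⟩ := hunit φ hφ
    rw [map_degeneracyIdeal φ i h1, ← hmin, minors_card (by simp [hr]), hNφb,
      det_fromBlocks_eq_schur _ _ _ _ h2, RingHom.map_det, RingHom.mapMatrix_apply, schurNum_map,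
      schurNum_eq _ _ _ _ h2, Matrix.det_smul, Ideal.span_singleton_mul_left_unit h2,
      Ideal.span_singleton_mul_left_unit (h2.pow _)]
  · intro R _ φ hφ
    obtain ⟨h1, h2⟩ := hunit φ hφ
    rw [schurNum_map, schurNum_map, schurNum_eq _ _ _ _ h2, schurNum_eq _ _ _ _ h2,
      Matrix.transpose_smul, Matrix.smul_mul, Matrix.mul_smul]
    refine ((isSymm_schur h2 (A' := L.toBlocks₁₁.map φ) (B' := L.toBlocks₁₂.map φ) ?_).smul _).smul _
    rw [← Matrix.fromBlocks_map, ← Matrix.fromBlocks_map, hNb, hLb]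
    have h3 : (L.map φ).transpose = L.transpose.map φ := rfl
    rw [h3, ← Matrix.map_mul]
    exact congrArg (fun M => M.map φ) hLN.eq

end LocalForm

end

end KleinEPW

namespace KleinEPW

noncomputable section

/-! ### No decomposable vectors in the Klein Lagrangian -/

section Decomposable

variable {R : Type*} [CommRing R]

/-- Coordinates of the product of two bivectors. -/
def w2 (w w' : Fin 6 → Fin 6 → R) (a b c d : Fin 6) : R :=
  w a b * w' c d + w' a b * w c d - (w a c * w' b d + w' a c * w b d) +
    (w a d * w' b c + w' a d * w b c)

/-- Coordinates of the product of a vector and two bivectors. -/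
def w5 (p : Fin 6 → R) (w w' : Fin 6 → Fin 6 → R) (a b c d f : Fin 6) : R :=
  p a * w2 w w' b c d f - p b * w2 w w' a c d f + p c * w2 w w' a b d f -
    p d * w2 w w' a b c f + p f * w2 w w' a b c d

/-- The product of a vector and two bivectors, as a linear form. -/
def tht (p : Fin 6 → R) (w w' : Fin 6 → Fin 6 → R) : Fin 6 → R :=
  ![w5 p w w' 1 2 3 4 5, -w5 p w w' 0 2 3 4 5, w5 p w w' 0 1 3 4 5, -w5 p w w' 0 1 2 4 5,
    w5 p w w' 0 1 2 3 5, -w5 p w w' 0 1 2 3 4]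

theorem tht_comm (p : Fin 6 → R) (w w' : Fin 6 → Fin 6 → R) : tht p w w' = tht p w' w := by
  have h : ∀ a b c d, w2 w w' a b c d = w2 w' w a b c d := fun a b c d => by simp only [w2]; ring
  simp only [tht, w5, h]

theorem w5_combination (p : Fin 6 → R) (w w' v v' : Fin 6 → Fin 6 → R) (a b c d : R)
    (i j k l m : Fin 6) : w5 p (a • w + b • w') (c • v + d • v') i j k l m =
      a * c * w5 p w v i j k l m + a * d * w5 p w v' i j k l m + b * c * w5 p w' v i j k l m +
        b * d * w5 p w' v' i j k l m := by
  simp only [w5, w2, Pi.add_apply, Pi.smul_apply, smul_eq_mul]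
  ring

theorem tht_combination (p : Fin 6 → R) (w w' v v' : Fin 6 → Fin 6 → R) (a b c d : R) :
    tht p (a • w + b • w') (c • v + d • v') = (a * c) • tht p w v + (a * d) • tht p w v' +
      (b * c) • tht p w' v + (b * d) • tht p w' v' := by
  funext n
  simp only [Pi.add_apply, Pi.smul_apply, smul_eq_mul]
  fin_cases n <;> simp [tht, w5_combination] <;> ring

theorem bet_sub (p t : Fin 6 → R) (w w' : Fin 6 → Fin 6 → R) :
    ∑ s, aC (wdg p w) s * bC (wdg t w') s - ∑ s, bC (wdg p w) s * aC (wdg t w') s =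
      -∑ n, t n * tht p w w' n := by
  simp only [Fin.sum_univ_succ, aC, bC, wdg, tht, w5, w2]
  simp
  ring

theorem w5_swap₁ {w w' : Fin 6 → Fin 6 → R} (hw : IsAlt w) (hw' : IsAlt w') (p : Fin 6 → R)
    (a b c d f : Fin 6) : w5 p w w' b a c d f = -w5 p w w' a b c d f := by
  simp only [w5, w2]; rw [hw.2 a b, hw'.2 a b]; ring

theorem w5_swap₂ {w w' : Fin 6 → Fin 6 → R} (hw : IsAlt w) (hw' : IsAlt w') (p : Fin 6 → R)
    (a b c d f : Fin 6) : w5 p w w' a c b d f = -w5 p w w' a b c d f := by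
  simp only [w5, w2]; rw [hw.2 b c, hw'.2 b c]; ring

theorem w5_swap₃ {w w' : Fin 6 → Fin 6 → R} (hw : IsAlt w) (hw' : IsAlt w') (p : Fin 6 → R)
    (a b c d f : Fin 6) : w5 p w w' a b d c f = -w5 p w w' a b c d f := by
  simp only [w5, w2]; rw [hw.2 c d, hw'.2 c d]; ring

theorem w5_swap₄ {w w' : Fin 6 → Fin 6 → R} (hw : IsAlt w) (hw' : IsAlt w') (p : Fin 6 → R)
    (a b c d f : Fin 6) : w5 p w w' a b c f d = -w5 p w w' a b c d f := by
  simp only [w5, w2]; rw [hw.2 d f, hw'.2 d f]; ring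

/-- The contractions of `p ∧ w` satisfy the Plücker relations up to `p ∧ w ∧ w`. -/
theorem plucker (p : Fin 6 → R) (w : Fin 6 → Fin 6 → R) (a j k l m : Fin 6) :
    2 * (wdg p w a j k * wdg p w a l m - wdg p w a j l * wdg p w a k m +
      wdg p w a j m * wdg p w a k l) = p a * w5 p w w a j k l m := by
  simp only [wdg, w5, w2]; ring

/-- The common zeros of the Plücker relations on the Klein Lagrangian. -/
theorem eq_zero_of_quadrics (y12 y13 y14 y15 y23 y24 y25 y34 y35 y45 : ℂ)
    (h0 : y12 * y34 - y13 * y24 + y14 * y23 = 0)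
    (h1 : y12 * y35 - y13 * y25 + y15 * y23 = 0)
    (h2 : y12 * y45 - y14 * y25 + y15 * y24 = 0)
    (h3 : y13 * y45 - y14 * y35 + y15 * y34 = 0)
    (h4 : y23 * y45 - y24 * y35 + y25 * y34 = 0)
    (h5 : y12 * y15 + y13 * y34 - y14 ^ 2 = 0)
    (h6 : y12 * y23 + y13 * y35 + y14 * y15 = 0)
    (h7 : y12 * y24 - y14 * y35 - y15 * y34 = 0)
    (h8 : y13 * y24 + y14 * y23 + y15 ^ 2 = 0)
    (h9 : y14 * y24 + y23 * y34 - y15 * y35 = 0)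
    (h10 : y12 * y25 - y23 * y34 + y14 * y24 = 0)
    (h11 : y12 * y45 + y23 * y35 + y14 * y25 = 0)
    (h12 : y12 ^ 2 + y24 * y35 + y25 * y34 = 0)
    (h13 : y12 * y23 - y24 * y45 + y25 ^ 2 = 0)
    (h14 : -y12 * y14 + y34 * y45 + y25 * y35 = 0)
    (h15 : y13 * y25 + y15 * y23 + y14 * y34 = 0)
    (h16 : -y13 * y45 + y23 ^ 2 - y14 * y35 = 0)
    (h17 : y13 ^ 2 + y23 * y34 + y15 * y35 = 0)
    (h18 : -y13 * y23 - y34 * y45 + y25 * y35 = 0)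
    (h19 : -y13 * y14 + y15 * y45 + y23 * y25 = 0)
    (h20 : y14 * y25 + y15 * y24 + y34 ^ 2 = 0)
    (h21 : y12 * y14 + y24 ^ 2 + y34 * y45 = 0)
    (h22 : y13 * y14 - y24 * y34 + y15 * y45 = 0)
    (h23 : y13 * y24 + y12 * y34 - y25 * y45 = 0)
    (h24 : y13 * y34 - y12 * y15 + y24 * y25 = 0)
    (h25 : y15 * y45 - y23 * y25 - y35 ^ 2 = 0)
    (h26 : y12 * y15 + y24 * y25 - y35 * y45 = 0)
    (h27 : -y13 * y15 + y24 * y35 + y23 * y45 = 0)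
    (h28 : -y13 * y25 - y12 * y35 + y45 ^ 2 = 0)
    (h29 : y13 * y35 - y12 * y23 - y24 * y45 = 0) :
    y12 = 0 ∧ y13 = 0 ∧ y14 = 0 ∧ y15 = 0 ∧ y23 = 0 ∧ y24 = 0 ∧ y25 = 0 ∧ y34 = 0 ∧ y35 = 0 ∧
      y45 = 0 := by
  -- The relations have the origin as only common zero; `grind` is asked for the vanishing of the
  -- fifth power of each coordinate.
  have key : ∀ y : ℂ, y ^ 5 = 0 → y = 0 := fun y hy => pow_eq_zero_iff (by norm_num) |>.1 hy
  refine ⟨key _ ?_, key _ ?_, key _ ?_, key _ ?_, key _ ?_, key _ ?_, key _ ?_, key _ ?_, key _ ?_,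
    key _ ?_⟩
  all_goals grind

theorem w5_eq_zero {p : Fin 6 → ℂ} {w : Fin 6 → Fin 6 → ℂ} (h : tht p w w = 0) :
    w5 p w w 1 2 3 4 5 = 0 ∧ w5 p w w 0 2 3 4 5 = 0 ∧ w5 p w w 0 1 3 4 5 = 0 ∧
      w5 p w w 0 1 2 4 5 = 0 ∧ w5 p w w 0 1 2 3 5 = 0 ∧ w5 p w w 0 1 2 3 4 = 0 :=
  ⟨congrFun h 0, neg_eq_zero.1 (congrFun h 1), congrFun h 2, neg_eq_zero.1 (congrFun h 3),
    congrFun h 4, neg_eq_zero.1 (congrFun h 5)⟩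

/-- The Klein Lagrangian contains no vector `p ∧ w ≠ 0` with `p ∧ w ∧ w = 0`. -/
theorem tht_self_ne_zero {p : Fin 6 → ℂ} {w : Fin 6 → Fin 6 → ℂ} (hw : IsAlt w)
    (hb : bC (wdg p w) = 0) (h : tht p w w = 0) : wdg p w = 0 := by
  obtain ⟨t0, t1, t2, t3, t4, t5⟩ := w5_eq_zero h
  -- With p ∧ w ∧ w = 0, `plucker` makes every contraction of p ∧ w satisfy the quadratic relations
  -- of decomposable bivectors, after cancelling the factor 2.
  have q : ∀ a j k l m, w5 p w w a j k l m = 0 → wdg p w a j k * wdg p w a l m -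
      wdg p w a j l * wdg p w a k m + wdg p w a j m * wdg p w a k l = 0 := by
    intro a j k l m h0
    have := plucker p w a j k l m
    rw [h0, mul_zero] at this
    exact (mul_eq_zero.1 this).resolve_left two_ne_zero
  have s1 := w5_swap₁ hw hw p
  have s2 := w5_swap₂ hw hw p
  have s3 := w5_swap₃ hw hw p
  have s4 := w5_swap₄ hw hw p
  have g1 : ∀ i j k, wdg p w j i k = -wdg p w i j k := fun i j k => by
    simp only [wdg]; rw [hw.2 i j]; ring
  have g2 : ∀ i j k, wdg p w i k j = -wdg p w i j k := fun i j k => by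
    simp only [wdg]; rw [hw.2 j k]; ring
  set η := wdg p w with hη
  have b0 : η 3 4 5 + η 0 1 3 = 0 := congrFun hb 0
  have b1 : -η 2 4 5 + η 0 1 2 = 0 := congrFun hb 1
  have b2 : η 2 3 5 - η 0 4 5 = 0 := congrFun hb 2
  have b3 : -η 2 3 4 + η 0 2 5 = 0 := congrFun hb 3
  have b4 : η 1 4 5 + η 0 2 4 = 0 := congrFun hb 4
  have b5 : -η 1 3 5 + η 0 2 3 = 0 := congrFun hb 5
  have b6 : η 1 3 4 + η 0 1 5 = 0 := congrFun hb 6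
  have b7 : η 1 2 5 + η 0 3 5 = 0 := congrFun hb 7
  have b8 : -η 1 2 4 + η 0 3 4 = 0 := congrFun hb 8
  have b9 : η 1 2 3 - η 0 1 4 = 0 := congrFun hb 9
  have e3 : ∀ i j k, η k i j = η i j k := fun i j k => by rw [g1, g2, neg_neg]
  -- On A the coordinates without index 0 are ± those with index 0, so the Plücker relations become
  -- thirty quadrics in ten unknowns.
  have c0 : η 3 4 5 = -η 0 1 3 := by linear_combination b0
  have c1 : η 2 4 5 = η 0 1 2 := by linear_combination -b1
  have c2 : η 2 3 5 = η 0 4 5 := by linear_combination b2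
  have c3 : η 2 3 4 = η 0 2 5 := by linear_combination -b3
  have c4 : η 1 4 5 = -η 0 2 4 := by linear_combination b4
  have c5 : η 1 3 5 = η 0 2 3 := by linear_combination -b5
  have c6 : η 1 3 4 = -η 0 1 5 := by linear_combination b6
  have c7 : η 1 2 5 = -η 0 3 5 := by linear_combination b7
  have c8 : η 1 2 4 = η 0 3 4 := by linear_combination -b8
  have c9 : η 1 2 3 = η 0 1 4 := by linear_combination b9
  have h := eq_zero_of_quadrics (η 0 1 2) (η 0 1 3) (η 0 1 4) (η 0 1 5) (η 0 2 3) (η 0 2 4) (η 0 2 5)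
    (η 0 3 4) (η 0 3 5) (η 0 4 5)
    (by have := q 0 1 2 3 4 (by exact t5); linear_combination this)
    (by have := q 0 1 2 3 5 (by exact t4); linear_combination this)
    (by have := q 0 1 2 4 5 (by exact t3); linear_combination this)
    (by have := q 0 1 3 4 5 (by exact t2); linear_combination this)
    (by have := q 0 2 3 4 5 (by exact t1); linear_combination this)
    (by have := q 1 0 2 3 4 (by rw [s1, t5]; simp); rw [g1 0 1 2, g1 0 1 3, g1 0 1 4, c6, c8, c9] at this; linear_combination this)
    (by have := q 1 0 2 3 5 (by rw [s1, t4]; simp); rw [g1 0 1 2, g1 0 1 3, g1 0 1 5, c5, c7, c9] at this; linear_combination -this)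
    (by have := q 1 0 2 4 5 (by rw [s1, t3]; simp); rw [g1 0 1 2, g1 0 1 4, g1 0 1 5, c4, c7, c8] at this; linear_combination this)
    (by have := q 1 0 3 4 5 (by rw [s1, t2]; simp); rw [g1 0 1 3, g1 0 1 4, g1 0 1 5, c4, c5, c6] at this; linear_combination this)
    (by have := q 1 2 3 4 5 (by exact t0); rw [c9, c4, c8, c5, c7, c6] at this; linear_combination -this)
    (by have := q 2 0 1 3 4 (by rw [s1, s2, t5]; simp); rw [e3 0 1 2, g1 0 2 3, g1 1 2 4, g1 0 2 4, g1 1 2 3, c3, c8, c9] at this; linear_combination this)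
    (by have := q 2 0 1 3 5 (by rw [s1, s2, t4]; simp); rw [e3 0 1 2, g1 0 2 3, g1 1 2 5, g1 0 2 5, g1 1 2 3, c2, c7, c9] at this; linear_combination this)
    (by have := q 2 0 1 4 5 (by rw [s1, s2, t3]; simp); rw [e3 0 1 2, g1 0 2 4, g1 1 2 5, g1 0 2 5, g1 1 2 4, c1, c7, c8] at this; linear_combination this)
    (by have := q 2 0 3 4 5 (by rw [s1, t1]; simp); rw [g1 0 2 3, g1 0 2 4, g1 0 2 5, c1, c2, c3] at this; linear_combination -this)
    (by have := q 2 1 3 4 5 (by rw [s1, t0]; simp); rw [g1 1 2 3, g1 1 2 4, g1 1 2 5, c9, c1, c8, c2, c7, c3] at this; linear_combination this)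
    (by have := q 3 0 1 2 4 (by rw [s1, s2, s3, t5]; simp); rw [e3 0 1 3, g1 2 3 4, e3 0 2 3, g1 1 3 4, g1 0 3 4, e3 1 2 3, c3, c6, c9] at this; linear_combination -this)
    (by have := q 3 0 1 2 5 (by rw [s1, s2, s3, t4]; simp); rw [e3 0 1 3, g1 2 3 5, e3 0 2 3, g1 1 3 5, g1 0 3 5, e3 1 2 3, c2, c5, c9] at this; linear_combination this)
    (by have := q 3 0 1 4 5 (by rw [s1, s2, t2]; simp); rw [e3 0 1 3, g1 0 3 4, g1 1 3 5, g1 0 3 5, g1 1 3 4, c0, c5, c6] at this; linear_combination -this)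
    (by have := q 3 0 2 4 5 (by rw [s1, s2, t1]; simp); rw [e3 0 2 3, g1 0 3 4, g1 2 3 5, g1 0 3 5, g1 2 3 4, c0, c2, c3] at this; linear_combination this)
    (by have := q 3 1 2 4 5 (by rw [s1, s2, t0]; simp); rw [e3 1 2 3, g1 1 3 4, g1 2 3 5, g1 1 3 5, g1 2 3 4, c9, c0, c6, c2, c5, c3] at this; linear_combination this)
    (by have := q 4 0 1 2 3 (by rw [s1, s2, s3, s4, t5]; simp); rw [e3 0 1 4, e3 2 3 4, e3 0 2 4, e3 1 3 4, e3 0 3 4, e3 1 2 4, c3, c6, c8] at this; linear_combination this)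
    (by have := q 4 0 1 2 5 (by rw [s1, s2, s3, t3]; simp); rw [e3 0 1 4, g1 2 4 5, e3 0 2 4, g1 1 4 5, g1 0 4 5, e3 1 2 4, c1, c4, c8] at this; linear_combination -this)
    (by have := q 4 0 1 3 5 (by rw [s1, s2, s3, t2]; simp); rw [e3 0 1 4, g1 3 4 5, e3 0 3 4, g1 1 4 5, g1 0 4 5, e3 1 3 4, c0, c4, c6] at this; linear_combination this)
    (by have := q 4 0 2 3 5 (by rw [s1, s2, s3, t1]; simp); rw [e3 0 2 4, g1 3 4 5, e3 0 3 4, g1 2 4 5, g1 0 4 5, e3 2 3 4, c0, c1, c3] at this; linear_combination this)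
    (by have := q 4 1 2 3 5 (by rw [s1, s2, s3, t0]; simp); rw [e3 1 2 4, g1 3 4 5, e3 1 3 4, g1 2 4 5, g1 1 4 5, e3 2 3 4, c8, c0, c6, c1, c4, c3] at this; linear_combination this)
    (by have := q 5 0 1 2 3 (by rw [s1, s2, s3, s4, t4]; simp); rw [e3 0 1 5, e3 2 3 5, e3 0 2 5, e3 1 3 5, e3 0 3 5, e3 1 2 5, c2, c5, c7] at this; linear_combination this)
    (by have := q 5 0 1 2 4 (by rw [s1, s2, s3, s4, t3]; simp); rw [e3 0 1 5, e3 2 4 5, e3 0 2 5, e3 1 4 5, e3 0 4 5, e3 1 2 5, c1, c4, c7] at this; linear_combination this)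
    (by have := q 5 0 1 3 4 (by rw [s1, s2, s3, s4, t2]; simp); rw [e3 0 1 5, e3 3 4 5, e3 0 3 5, e3 1 4 5, e3 0 4 5, e3 1 3 5, c0, c4, c5] at this; linear_combination this)
    (by have := q 5 0 2 3 4 (by rw [s1, s2, s3, s4, t1]; simp); rw [e3 0 2 5, e3 3 4 5, e3 0 3 5, e3 2 4 5, e3 0 4 5, e3 2 3 5, c0, c1, c2] at this; linear_combination this)
    (by have := q 5 1 2 3 4 (by rw [s1, s2, s3, s4, t0]; simp); rw [e3 1 2 5, e3 3 4 5, e3 1 3 5, e3 2 4 5, e3 1 4 5, e3 2 3 5, c7, c0, c5, c1, c4, c2] at this; linear_combination this)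
  obtain ⟨y0, y1, y2, y3, y4, y5, y6, y7, y8, y9⟩ := h
  refine eq_zero_of_aC_bC g1 g2 ?_ hb
  simp only [aC, y0, y1, y2, y3, y4, y5, y6, y7, y8, y9]
  ext s
  fin_cases s <;> rfl

end Decomposable

end

end KleinEPW

namespace KleinEPW

noncomputable section

/-! ### Independence of the differentials at points of corank two -/

section Independence

/-- Let θ be the covector of p ∧ w ∧ w' and u the contraction of w by θ. The difference of the two
products is four times the (b, c, d, f) coordinate of p ∧ u ∧ w', so it vanishes with θ. In the
proof, the signed mixed terms are the coordinates of θ and `ub`, …, `uf` are those of u. -/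
theorem tht_minor {R : Type*} [CommRing R] (p : Fin 6 → R) (w w' : Fin 6 → Fin 6 → R)
    (l m b c d f : Fin 6) (hl : w5 p w w' m b c d f = 0) (hm : w5 p w w' l b c d f = 0)
    (hb : w5 p w w' l m c d f = 0) (hc : w5 p w w' l m b d f = 0)
    (hd : w5 p w w' l m b c f = 0) (hf : w5 p w w' l m b c d = 0) :
    w5 p w w m b c d f * w5 p w' w' l b c d f = w5 p w w l b c d f * w5 p w' w' m b c d f := by
  have key : w5 p w w m b c d f * w5 p w' w' l b c d f -
      w5 p w w l b c d f * w5 p w' w' m b c d f =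
      (fun hl hm hb hc hd hf => (fun ub uc ud uf => 4 * (
        p b * (uc * w' d f - ud * w' c f + uf * w' c d) -
        p c * (ub * w' d f - ud * w' b f + uf * w' b d) +
        p d * (ub * w' c f - uc * w' b f + uf * w' b c) -
        p f * (ub * w' c d - uc * w' b d + ud * w' b c)))
        (hl * w l b + hm * w m b - hc * w b c - hd * w b d - hf * w b f)
        (hl * w l c + hm * w m c + hb * w b c - hd * w c d - hf * w c f)
        (hl * w l d + hm * w m d + hb * w b d + hc * w c d - hf * w d f)
        (hl * w l f + hm * w m f + hb * w b f + hc * w c f + hd * w d f))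
      (w5 p w w' m b c d f) (-w5 p w w' l b c d f) (w5 p w w' l m c d f) (-w5 p w w' l m b d f)
      (w5 p w w' l m b c f) (-w5 p w w' l m b c d) := by
    simp only [w5, w2]
    ring
  rw [hl, hm, hb, hc, hd, hf] at key
  simp at key
  exact sub_eq_zero.1 key

/-- Two bivectors with zero product modulo p have proportional squares. Each pair of indices is
moved to the front by transpositions in order to apply `tht_minor`; the long case list only tracks
their signs. -/
theorem tht_proportional {R : Type*} [CommRing R] {p : Fin 6 → R} {w w' : Fin 6 → Fin 6 → R}
    (hw : IsAlt w) (hw' : IsAlt w') (h : tht p w w' = 0) (l m : Fin 6) :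
    tht p w w l * tht p w' w' m = tht p w w m * tht p w' w' l := by
  have s1 := @w5_swap₁ R _
  have s2 := @w5_swap₂ R _
  have s3 := @w5_swap₃ R _
  have s4 := @w5_swap₄ R _
  have t0 : w5 p w w' 1 2 3 4 5 = 0 := congrFun h 0
  have t1 : w5 p w w' 0 2 3 4 5 = 0 := neg_eq_zero.1 (congrFun h 1)
  have t2 : w5 p w w' 0 1 3 4 5 = 0 := congrFun h 2
  have t3 : w5 p w w' 0 1 2 4 5 = 0 := neg_eq_zero.1 (congrFun h 3)
  have t4 : w5 p w w' 0 1 2 3 5 = 0 := congrFun h 4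
  have t5 : w5 p w w' 0 1 2 3 4 = 0 := neg_eq_zero.1 (congrFun h 5)
  have aux : ∀ l m : Fin 6, l < m →
      tht p w w l * tht p w' w' m = tht p w w m * tht p w' w' l := by
    intro l m hlm
    fin_cases l <;> fin_cases m <;> first | exact absurd hlm (by decide) | skip
    · have := tht_minor p w w' 0 1 2 3 4 5
        t0
        t1
        t2
        t3
        t4
        t5
      simp only [tht]
      simp
      linear_combination this
    · have := tht_minor p w w' 0 2 1 3 4 5
        (by rw [s1 hw hw', t0]; simp)
        t2
        t1
        (by rw [s2 hw hw', t3]; simp)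
        (by rw [s2 hw hw', t4]; simp)
        (by rw [s2 hw hw', t5]; simp)
      rw [s1 hw hw p 1 2 3 4 5,
        s1 hw' hw' p 1 2 3 4 5] at this
      simp only [tht]
      simp
      linear_combination -this
    · have := tht_minor p w w' 0 3 1 2 4 5
        (by rw [s1 hw hw', s2 hw hw', t0]; simp)
        t3
        (by rw [s2 hw hw', t1]; simp)
        (by rw [s2 hw hw', t2]; simp)
        (by rw [s2 hw hw', s3 hw hw', t4]; simp)
        (by rw [s2 hw hw', s3 hw hw', t5]; simp)
      rw [s1 hw hw p 1 3 2 4 5,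
        s1 hw' hw' p 1 3 2 4 5,
        s2 hw hw p 1 2 3 4 5,
        s2 hw' hw' p 1 2 3 4 5] at this
      simp only [tht]
      simp
      linear_combination this
    · have := tht_minor p w w' 0 4 1 2 3 5
        (by rw [s1 hw hw', s2 hw hw', s3 hw hw', t0]; simp)
        t4
        (by rw [s2 hw hw', s3 hw hw', t1]; simp)
        (by rw [s2 hw hw', s3 hw hw', t2]; simp)
        (by rw [s2 hw hw', s3 hw hw', t3]; simp)
        (by rw [s2 hw hw', s3 hw hw', s4 hw hw', t5]; simp)
      rw [s1 hw hw p 1 4 2 3 5,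
        s1 hw' hw' p 1 4 2 3 5,
        s2 hw hw p 1 2 4 3 5,
        s2 hw' hw' p 1 2 4 3 5,
        s3 hw hw p 1 2 3 4 5,
        s3 hw' hw' p 1 2 3 4 5] at this
      simp only [tht]
      simp
      linear_combination -this
    · have := tht_minor p w w' 0 5 1 2 3 4
        (by rw [s1 hw hw', s2 hw hw', s3 hw hw', s4 hw hw', t0]; simp)
        t5
        (by rw [s2 hw hw', s3 hw hw', s4 hw hw', t1]; simp)
        (by rw [s2 hw hw', s3 hw hw', s4 hw hw', t2]; simp)
        (by rw [s2 hw hw', s3 hw hw', s4 hw hw', t3]; simp)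
        (by rw [s2 hw hw', s3 hw hw', s4 hw hw', t4]; simp)
      rw [s1 hw hw p 1 5 2 3 4,
        s1 hw' hw' p 1 5 2 3 4,
        s2 hw hw p 1 2 5 3 4,
        s2 hw' hw' p 1 2 5 3 4,
        s3 hw hw p 1 2 3 5 4,
        s3 hw' hw' p 1 2 3 5 4,
        s4 hw hw p 1 2 3 4 5,
        s4 hw' hw' p 1 2 3 4 5] at this
      simp only [tht]
      simp
      linear_combination this
    · have := tht_minor p w w' 1 2 0 3 4 5
        (by rw [s1 hw hw', t1]; simp)
        (by rw [s1 hw hw', t2]; simp)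
        t0
        (by rw [s2 hw hw', s1 hw hw', t3]; simp)
        (by rw [s2 hw hw', s1 hw hw', t4]; simp)
        (by rw [s2 hw hw', s1 hw hw', t5]; simp)
      rw [s1 hw hw p 0 2 3 4 5,
        s1 hw' hw' p 0 2 3 4 5,
        s1 hw hw p 0 1 3 4 5,
        s1 hw' hw' p 0 1 3 4 5] at this
      simp only [tht]
      simp
      linear_combination this
    · have := tht_minor p w w' 1 3 0 2 4 5
        (by rw [s1 hw hw', s2 hw hw', t1]; simp)
        (by rw [s1 hw hw', t3]; simp)
        (by rw [s2 hw hw', t0]; simp)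
        (by rw [s2 hw hw', s1 hw hw', t2]; simp)
        (by rw [s2 hw hw', s3 hw hw', s1 hw hw', t4]; simp)
        (by rw [s2 hw hw', s3 hw hw', s1 hw hw', t5]; simp)
      rw [s1 hw hw p 0 3 2 4 5,
        s1 hw' hw' p 0 3 2 4 5,
        s2 hw hw p 0 2 3 4 5,
        s2 hw' hw' p 0 2 3 4 5,
        s1 hw hw p 0 1 2 4 5,
        s1 hw' hw' p 0 1 2 4 5] at this
      simp only [tht]
      simp
      linear_combination -this
    · have := tht_minor p w w' 1 4 0 2 3 5
        (by rw [s1 hw hw', s2 hw hw', s3 hw hw', t1]; simp)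
        (by rw [s1 hw hw', t4]; simp)
        (by rw [s2 hw hw', s3 hw hw', t0]; simp)
        (by rw [s2 hw hw', s3 hw hw', s1 hw hw', t2]; simp)
        (by rw [s2 hw hw', s3 hw hw', s1 hw hw', t3]; simp)
        (by rw [s2 hw hw', s3 hw hw', s4 hw hw', s1 hw hw', t5]; simp)
      rw [s1 hw hw p 0 4 2 3 5,
        s1 hw' hw' p 0 4 2 3 5,
        s2 hw hw p 0 2 4 3 5,
        s2 hw' hw' p 0 2 4 3 5,
        s3 hw hw p 0 2 3 4 5,
        s3 hw' hw' p 0 2 3 4 5,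
        s1 hw hw p 0 1 2 3 5,
        s1 hw' hw' p 0 1 2 3 5] at this
      simp only [tht]
      simp
      linear_combination this
    · have := tht_minor p w w' 1 5 0 2 3 4
        (by rw [s1 hw hw', s2 hw hw', s3 hw hw', s4 hw hw', t1]; simp)
        (by rw [s1 hw hw', t5]; simp)
        (by rw [s2 hw hw', s3 hw hw', s4 hw hw', t0]; simp)
        (by rw [s2 hw hw', s3 hw hw', s4 hw hw', s1 hw hw', t2]; simp)
        (by rw [s2 hw hw', s3 hw hw', s4 hw hw', s1 hw hw', t3]; simp)
        (by rw [s2 hw hw', s3 hw hw', s4 hw hw', s1 hw hw', t4]; simp)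
      rw [s1 hw hw p 0 5 2 3 4,
        s1 hw' hw' p 0 5 2 3 4,
        s2 hw hw p 0 2 5 3 4,
        s2 hw' hw' p 0 2 5 3 4,
        s3 hw hw p 0 2 3 5 4,
        s3 hw' hw' p 0 2 3 5 4,
        s4 hw hw p 0 2 3 4 5,
        s4 hw' hw' p 0 2 3 4 5,
        s1 hw hw p 0 1 2 3 4,
        s1 hw' hw' p 0 1 2 3 4] at this
      simp only [tht]
      simp
      linear_combination -this
    · have := tht_minor p w w' 2 3 0 1 4 5
        (by rw [s1 hw hw', s2 hw hw', t2]; simp)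
        (by rw [s1 hw hw', s2 hw hw', t3]; simp)
        (by rw [s2 hw hw', s1 hw hw', t0]; simp)
        (by rw [s2 hw hw', s1 hw hw', t1]; simp)
        (by rw [s2 hw hw', s3 hw hw', s1 hw hw', s2 hw hw', t4]; simp)
        (by rw [s2 hw hw', s3 hw hw', s1 hw hw', s2 hw hw', t5]; simp)
      rw [s1 hw hw p 0 3 1 4 5,
        s1 hw' hw' p 0 3 1 4 5,
        s2 hw hw p 0 1 3 4 5,
        s2 hw' hw' p 0 1 3 4 5,
        s1 hw hw p 0 2 1 4 5,
        s1 hw' hw' p 0 2 1 4 5,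
        s2 hw hw p 0 1 2 4 5,
        s2 hw' hw' p 0 1 2 4 5] at this
      simp only [tht]
      simp
      linear_combination this
    · have := tht_minor p w w' 2 4 0 1 3 5
        (by rw [s1 hw hw', s2 hw hw', s3 hw hw', t2]; simp)
        (by rw [s1 hw hw', s2 hw hw', t4]; simp)
        (by rw [s2 hw hw', s3 hw hw', s1 hw hw', t0]; simp)
        (by rw [s2 hw hw', s3 hw hw', s1 hw hw', t1]; simp)
        (by rw [s2 hw hw', s3 hw hw', s1 hw hw', s2 hw hw', t3]; simp)
        (by rw [s2 hw hw', s3 hw hw', s4 hw hw', s1 hw hw', s2 hw hw', t5]; simp)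
      rw [s1 hw hw p 0 4 1 3 5,
        s1 hw' hw' p 0 4 1 3 5,
        s2 hw hw p 0 1 4 3 5,
        s2 hw' hw' p 0 1 4 3 5,
        s3 hw hw p 0 1 3 4 5,
        s3 hw' hw' p 0 1 3 4 5,
        s1 hw hw p 0 2 1 3 5,
        s1 hw' hw' p 0 2 1 3 5,
        s2 hw hw p 0 1 2 3 5,
        s2 hw' hw' p 0 1 2 3 5] at this
      simp only [tht]
      simp
      linear_combination -this
    · have := tht_minor p w w' 2 5 0 1 3 4
        (by rw [s1 hw hw', s2 hw hw', s3 hw hw', s4 hw hw', t2]; simp)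
        (by rw [s1 hw hw', s2 hw hw', t5]; simp)
        (by rw [s2 hw hw', s3 hw hw', s4 hw hw', s1 hw hw', t0]; simp)
        (by rw [s2 hw hw', s3 hw hw', s4 hw hw', s1 hw hw', t1]; simp)
        (by rw [s2 hw hw', s3 hw hw', s4 hw hw', s1 hw hw', s2 hw hw', t3]; simp)
        (by rw [s2 hw hw', s3 hw hw', s4 hw hw', s1 hw hw', s2 hw hw', t4]; simp)
      rw [s1 hw hw p 0 5 1 3 4,
        s1 hw' hw' p 0 5 1 3 4,
        s2 hw hw p 0 1 5 3 4,
        s2 hw' hw' p 0 1 5 3 4,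
        s3 hw hw p 0 1 3 5 4,
        s3 hw' hw' p 0 1 3 5 4,
        s4 hw hw p 0 1 3 4 5,
        s4 hw' hw' p 0 1 3 4 5,
        s1 hw hw p 0 2 1 3 4,
        s1 hw' hw' p 0 2 1 3 4,
        s2 hw hw p 0 1 2 3 4,
        s2 hw' hw' p 0 1 2 3 4] at this
      simp only [tht]
      simp
      linear_combination this
    · have := tht_minor p w w' 3 4 0 1 2 5
        (by rw [s1 hw hw', s2 hw hw', s3 hw hw', t3]; simp)
        (by rw [s1 hw hw', s2 hw hw', s3 hw hw', t4]; simp)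
        (by rw [s2 hw hw', s3 hw hw', s1 hw hw', s2 hw hw', t0]; simp)
        (by rw [s2 hw hw', s3 hw hw', s1 hw hw', s2 hw hw', t1]; simp)
        (by rw [s2 hw hw', s3 hw hw', s1 hw hw', s2 hw hw', t2]; simp)
        (by rw [s2 hw hw', s3 hw hw', s4 hw hw', s1 hw hw', s2 hw hw', s3 hw hw', t5]; simp)
      rw [s1 hw hw p 0 4 1 2 5,
        s1 hw' hw' p 0 4 1 2 5,
        s2 hw hw p 0 1 4 2 5,
        s2 hw' hw' p 0 1 4 2 5,
        s3 hw hw p 0 1 2 4 5,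
        s3 hw' hw' p 0 1 2 4 5,
        s1 hw hw p 0 3 1 2 5,
        s1 hw' hw' p 0 3 1 2 5,
        s2 hw hw p 0 1 3 2 5,
        s2 hw' hw' p 0 1 3 2 5,
        s3 hw hw p 0 1 2 3 5,
        s3 hw' hw' p 0 1 2 3 5] at this
      simp only [tht]
      simp
      linear_combination this
    · have := tht_minor p w w' 3 5 0 1 2 4
        (by rw [s1 hw hw', s2 hw hw', s3 hw hw', s4 hw hw', t3]; simp)
        (by rw [s1 hw hw', s2 hw hw', s3 hw hw', t5]; simp)
        (by rw [s2 hw hw', s3 hw hw', s4 hw hw', s1 hw hw', s2 hw hw', t0]; simp)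
        (by rw [s2 hw hw', s3 hw hw', s4 hw hw', s1 hw hw', s2 hw hw', t1]; simp)
        (by rw [s2 hw hw', s3 hw hw', s4 hw hw', s1 hw hw', s2 hw hw', t2]; simp)
        (by rw [s2 hw hw', s3 hw hw', s4 hw hw', s1 hw hw', s2 hw hw', s3 hw hw', t4]; simp)
      rw [s1 hw hw p 0 5 1 2 4,
        s1 hw' hw' p 0 5 1 2 4,
        s2 hw hw p 0 1 5 2 4,
        s2 hw' hw' p 0 1 5 2 4,
        s3 hw hw p 0 1 2 5 4,
        s3 hw' hw' p 0 1 2 5 4,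
        s4 hw hw p 0 1 2 4 5,
        s4 hw' hw' p 0 1 2 4 5,
        s1 hw hw p 0 3 1 2 4,
        s1 hw' hw' p 0 3 1 2 4,
        s2 hw hw p 0 1 3 2 4,
        s2 hw' hw' p 0 1 3 2 4,
        s3 hw hw p 0 1 2 3 4,
        s3 hw' hw' p 0 1 2 3 4] at this
      simp only [tht]
      simp
      linear_combination -this
    · have := tht_minor p w w' 4 5 0 1 2 3
        (by rw [s1 hw hw', s2 hw hw', s3 hw hw', s4 hw hw', t4]; simp)
        (by rw [s1 hw hw', s2 hw hw', s3 hw hw', s4 hw hw', t5]; simp)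
        (by rw [s2 hw hw', s3 hw hw', s4 hw hw', s1 hw hw', s2 hw hw', s3 hw hw', t0]; simp)
        (by rw [s2 hw hw', s3 hw hw', s4 hw hw', s1 hw hw', s2 hw hw', s3 hw hw', t1]; simp)
        (by rw [s2 hw hw', s3 hw hw', s4 hw hw', s1 hw hw', s2 hw hw', s3 hw hw', t2]; simp)
        (by rw [s2 hw hw', s3 hw hw', s4 hw hw', s1 hw hw', s2 hw hw', s3 hw hw', t3]; simp)
      rw [s1 hw hw p 0 5 1 2 3,
        s1 hw' hw' p 0 5 1 2 3,
        s2 hw hw p 0 1 5 2 3,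
        s2 hw' hw' p 0 1 5 2 3,
        s3 hw hw p 0 1 2 5 3,
        s3 hw' hw' p 0 1 2 5 3,
        s4 hw hw p 0 1 2 3 5,
        s4 hw' hw' p 0 1 2 3 5,
        s1 hw hw p 0 4 1 2 3,
        s1 hw' hw' p 0 4 1 2 3,
        s2 hw hw p 0 1 4 2 3,
        s2 hw' hw' p 0 1 4 2 3,
        s3 hw hw p 0 1 2 4 3,
        s3 hw' hw' p 0 1 2 4 3,
        s4 hw hw p 0 1 2 3 4,
        s4 hw' hw' p 0 1 2 3 4] at this
      simp only [tht]
      simp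
      linear_combination this
  rcases lt_trichotomy l m with hlm | rfl | hlm
  · exact aux l m hlm
  · rfl
  · exact (aux m l hlm).symm

/-- A quadratic form in two variables is a product of two linear forms. -/
theorem exists_factorization {l0 l1 l2 : ℂ} (h : ¬(l0 = 0 ∧ l1 = 0 ∧ l2 = 0)) :
    ∃ a b c d : ℂ, ¬(a = 0 ∧ b = 0) ∧ ¬(c = 0 ∧ d = 0) ∧ a * c = l0 ∧ a * d + b * c = l1 ∧
      b * d = l2 := by
  by_cases h0 : l0 = 0
  · subst h0
    exact ⟨0, 1, l1, l2, by simp, by simpa using h, by ring, by ring, by ring⟩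
  · obtain ⟨s, hs⟩ := IsAlgClosed.exists_pow_nat_eq (l1 ^ 2 - 4 * l0 * l2) (n := 2) (by norm_num)
    refine ⟨1, -((-l1 + s) / (2 * l0)), l0, l1 + l0 * ((-l1 + s) / (2 * l0)), by simp,
      fun h => h0 h.1, by ring, by ring, ?_⟩
    field_simp
    linear_combination -hs

/-- At a point of corank two the three differentials are linearly independent. -/
theorem tht_independent {p : Fin 6 → ℂ} {κ κ' : Fin 6 → Fin 6 → ℂ} (hκ : IsAlt κ) (hκ' : IsAlt κ')
    (hb : bC (wdg p κ) = 0) (hb' : bC (wdg p κ') = 0)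
    (hi : ∀ a b : ℂ, wdg p (a • κ + b • κ') = 0 → a = 0 ∧ b = 0) {l0 l1 l2 : ℂ}
    (h : l0 • tht p κ κ + l1 • tht p κ κ' + l2 • tht p κ' κ' = 0) : l0 = 0 ∧ l1 = 0 ∧ l2 = 0 := by
  by_contra hne
  -- A linear relation between the three products is a binary quadratic form. Splitting it into
  -- linear factors turns the relation into p ∧ v ∧ v' = 0 for two nonzero members v, v' of the
  -- pencil.
  obtain ⟨a, b, c, d, hab, hcd, h0, h1, h2⟩ := exists_factorization hne
  have alt : ∀ x y : ℂ, IsAlt (x • κ + y • κ') := fun x y =>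
    ⟨fun i => by simp [hκ.1, hκ'.1], fun i j => by simp [hκ.2 i j, hκ'.2 i j]; ring⟩
  have hbb : ∀ x y : ℂ, bC (wdg p (x • κ + y • κ')) = 0 := fun x y => by
    rw [wdg_add_right, wdg_smul_right, wdg_smul_right, bC_add, bC_smul, bC_smul, hb, hb']
    simp
  have nd : ∀ x y : ℂ, tht p (x • κ + y • κ') (x • κ + y • κ') = 0 → x = 0 ∧ y = 0 :=
    fun x y hxy => hi x y (tht_self_ne_zero (alt x y) (hbb x y) hxy)
  have hvv : tht p (a • κ + b • κ') (c • κ + d • κ') = 0 := by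
    rw [tht_combination, tht_comm p κ' κ, h0, h2, add_assoc (l0 • _), ← add_smul, h1, h]
  have hprop := tht_proportional (alt a b) (alt c d) hvv
  set v := a • κ + b • κ' with hv
  set v' := c • κ + d • κ' with hv'
  have hθ' : tht p v' v' ≠ 0 := fun h' => hcd (nd c d h')
  obtain ⟨m, hm⟩ := Function.ne_iff.1 hθ'
  -- The squares of v and v' are proportional and the cross term vanishes, so this s makes p ∧ (v +
  -- s v') ∧ (v + s v') zero.
  obtain ⟨s, hs⟩ := IsAlgClosed.exists_pow_nat_eq (-(tht p v v m / tht p v' v' m)) (n := 2)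
    (by norm_num)
  have hm' : tht p v' v' m ≠ 0 := hm
  have hsum : tht p (v + s • v') (v + s • v') = 0 := by
    have := tht_combination p v v' v v' 1 s 1 s
    rw [one_smul, tht_comm p v' v, hvv] at this
    rw [this]
    funext l
    simp only [Pi.add_apply, Pi.smul_apply, smul_eq_mul, Pi.zero_apply]
    have h3 := hprop l m
    have h4 : tht p v v l = tht p v v m / tht p v' v' m * tht p v' v' l := by
      field_simp; exact h3
    rw [h4]
    linear_combination tht p v' v' l * hs
  have hvs : v + s • v' = (a + s * c) • κ + (b + s * d) • κ' := by
    rw [hv, hv']; module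
  rw [hvs] at hsum
  obtain ⟨e1, e2⟩ := nd _ _ hsum
  -- As A has no decomposable vectors, v + s v' = 0. Then p ∧ v ∧ v' = 0 reads s · p ∧ v' ∧ v' = 0,
  -- which contradicts v ≠ 0 or v' ≠ 0.
  have h5 : v = (-s) • v' := by
    have : v + s • v' = 0 := by rw [hvs, e1, e2]; simp
    rw [neg_smul]; exact eq_neg_of_add_eq_zero_left this
  have h6 : (-s) • tht p v' v' = 0 := by
    have := tht_combination p v' 0 v' 0 (-s) 0 1 0
    simp only [zero_smul, add_zero, one_smul, mul_one, mul_zero] at this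
    rw [← this, ← h5, hvv]
  rcases smul_eq_zero.1 h6 with hs0 | h7
  · rw [hs0, zero_smul] at h5
    apply hab
    apply nd
    rw [← hv, h5]
    have := tht_combination p κ κ' κ κ' 0 0 0 0
    simpa using this
  · exact hθ' h7

end Independence

end

end KleinEPW

namespace KleinEPW

noncomputable section

/-! ### Partial derivatives of the sextic -/

section Derivatives

/-- The partial derivative of the sextic with respect to the first variable. -/
def grad0 {R : Type*} [CommRing R] (x0 x1 x2 x3 x4 x5 : R) : R :=
  6 * x0 ^ 5 + 6 * x0 ^ 2 * x1 ^ 2 * x4 + 6 * x0 ^ 2 * x1 * x3 ^ 2 + 6 * x0 ^ 2 * x2 ^ 2 * x5 +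
  6 * x0 ^ 2 * x2 * x4 ^ 2 + 6 * x0 ^ 2 * x3 * x5 ^ 2 - 4 * x1 ^ 3 * x2 ^ 2 + 4 * x1 ^ 3 * x3 *
  x5 - 4 * x1 ^ 2 * x5 ^ 3 + 4 * x1 * x2 ^ 3 * x4 - 12 * x1 * x2 * x3 * x4 * x5 + 4 * x1 * x3 *
  x4 ^ 3 - 4 * x2 ^ 3 * x3 ^ 2 + 4 * x2 * x3 ^ 3 * x5 + 4 * x2 * x4 * x5 ^ 3 - 4 * x3 ^ 3 * x4 ^
  2 - 4 * x4 ^ 3 * x5 ^ 2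

/-- The partial derivative of the sextic with respect to the second variable. -/
def grad1 {R : Type*} [CommRing R] (x0 x1 x2 x3 x4 x5 : R) : R :=
  4 * x0 ^ 3 * x1 * x4 + 2 * x0 ^ 3 * x3 ^ 2 - 12 * x0 * x1 ^ 2 * x2 ^ 2 + 12 * x0 * x1 ^ 2 * x3
  * x5 - 8 * x0 * x1 * x5 ^ 3 + 4 * x0 * x2 ^ 3 * x4 - 12 * x0 * x2 * x3 * x4 * x5 + 4 * x0 * x3
  * x4 ^ 3 - 16 * x1 ^ 3 * x2 * x5 + 4 * x1 ^ 3 * x4 ^ 2 - 6 * x1 ^ 2 * x3 ^ 2 * x4 + 12 * x1 *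
  x2 ^ 2 * x4 * x5 - 4 * x1 * x2 * x4 ^ 3 + 2 * x1 * x3 ^ 4 + 12 * x1 * x3 * x4 * x5 ^ 2 - 4 *
  x2 ^ 4 * x3 + 6 * x2 ^ 2 * x3 ^ 2 * x5 + 6 * x2 * x3 ^ 2 * x4 ^ 2 - 2 * x3 ^ 3 * x5 ^ 2 - 4 *
  x4 * x5 ^ 4

/-- The second partial derivative of the sextic with respect to the variables `x0` and `x0`. -/
def hess00 {R : Type*} [CommRing R] (x0 x1 x2 x3 x4 x5 : R) : R :=
  30 * x0 ^ 4 + 12 * x0 * x1 ^ 2 * x4 + 12 * x0 * x1 * x3 ^ 2 + 12 * x0 * x2 ^ 2 * x5 + 12 * x0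
  * x2 * x4 ^ 2 + 12 * x0 * x3 * x5 ^ 2

/-- The second partial derivative of the sextic with respect to the variables `x0` and `x1`. -/
def hess01 {R : Type*} [CommRing R] (x0 x1 x2 x3 x4 x5 : R) : R :=
  12 * x0 ^ 2 * x1 * x4 + 6 * x0 ^ 2 * x3 ^ 2 - 12 * x1 ^ 2 * x2 ^ 2 + 12 * x1 ^ 2 * x3 * x5 - 8
  * x1 * x5 ^ 3 + 4 * x2 ^ 3 * x4 - 12 * x2 * x3 * x4 * x5 + 4 * x3 * x4 ^ 3

/-- The second partial derivative of the sextic with respect to the variables `x1` and `x1`. -/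
def hess11 {R : Type*} [CommRing R] (x0 x1 x2 x3 x4 x5 : R) : R :=
  4 * x0 ^ 3 * x4 - 24 * x0 * x1 * x2 ^ 2 + 24 * x0 * x1 * x3 * x5 - 8 * x0 * x5 ^ 3 - 48 * x1 ^
  2 * x2 * x5 + 12 * x1 ^ 2 * x4 ^ 2 - 12 * x1 * x3 ^ 2 * x4 + 12 * x2 ^ 2 * x4 * x5 - 4 * x2 *
  x4 ^ 3 + 2 * x3 ^ 4 + 12 * x3 * x4 * x5 ^ 2

/-- The second partial derivative of the sextic with respect to the variables `x1` and `x2`. -/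
def hess12 {R : Type*} [CommRing R] (x0 x1 x2 x3 x4 x5 : R) : R :=
  -24 * x0 * x1 ^ 2 * x2 + 12 * x0 * x2 ^ 2 * x4 - 12 * x0 * x3 * x4 * x5 - 16 * x1 ^ 3 * x5 +
  24 * x1 * x2 * x4 * x5 - 4 * x1 * x4 ^ 3 - 16 * x2 ^ 3 * x3 + 12 * x2 * x3 ^ 2 * x5 + 6 * x3 ^
  2 * x4 ^ 2

/-- The second partial derivative of the sextic with respect to the variables `x1` and `x3`. -/
def hess13 {R : Type*} [CommRing R] (x0 x1 x2 x3 x4 x5 : R) : R :=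
  4 * x0 ^ 3 * x3 + 12 * x0 * x1 ^ 2 * x5 - 12 * x0 * x2 * x4 * x5 + 4 * x0 * x4 ^ 3 - 12 * x1 ^
  2 * x3 * x4 + 8 * x1 * x3 ^ 3 + 12 * x1 * x4 * x5 ^ 2 - 4 * x2 ^ 4 + 12 * x2 ^ 2 * x3 * x5 +
  12 * x2 * x3 * x4 ^ 2 - 6 * x3 ^ 2 * x5 ^ 2

theorem derivation_ofNat {R A : Type*} [CommRing R] [CommRing A] [Algebra R A]
    (D : Derivation R A A) (n : ℕ) [n.AtLeastTwo] : D (ofNat(n) : A) = 0 :=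
  D.map_natCast n

variable {R A : Type*} [CommRing R] [CommRing A] [Algebra R A] (D : Derivation R A A)
  (x0 x1 x2 x3 x4 x5 : A)

/-- The sextic is invariant under the cyclic shift of x₁, …, x₅, so one function with shifted
arguments gives all five partials other than the one in x₀. -/
theorem derivation_sexticForm : D (sexticForm x0 x1 x2 x3 x4 x5) =
    grad0 x0 x1 x2 x3 x4 x5 * D x0 + grad1 x0 x1 x2 x3 x4 x5 * D x1 + grad1 x0 x2 x3 x4 x5 x1 * D
  x2 + grad1 x0 x3 x4 x5 x1 x2 * D x3 + grad1 x0 x4 x5 x1 x2 x3 * D x4 + grad1 x0 x5 x1 x2 x3 x4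
  * D x5 := by
  simp only [sexticForm, grad0, grad1, map_add, map_sub, Derivation.leibniz, Derivation.leibniz_pow,
    derivation_ofNat, smul_eq_mul, nsmul_eq_mul]
  push_cast
  ring

theorem derivation_grad0 : D (grad0 x0 x1 x2 x3 x4 x5) =
  hess00 x0 x1 x2 x3 x4 x5 * D x0 + hess01 x0 x1 x2 x3 x4 x5 * D x1 + hess01 x0 x2 x3 x4 x5 x1 *
  D x2 + hess01 x0 x3 x4 x5 x1 x2 * D x3 + hess01 x0 x4 x5 x1 x2 x3 * D x4 + hess01 x0 x5 x1 x2
  x3 x4 * D x5 := by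
  simp only [grad0, hess00, hess01, map_add, map_sub, Derivation.leibniz, Derivation.leibniz_pow,
    derivation_ofNat, smul_eq_mul, nsmul_eq_mul]
  push_cast
  ring

theorem derivation_grad1 : D (grad1 x0 x1 x2 x3 x4 x5) =
  hess01 x0 x1 x2 x3 x4 x5 * D x0 + hess11 x0 x1 x2 x3 x4 x5 * D x1 + hess12 x0 x1 x2 x3 x4 x5 *
  D x2 + hess13 x0 x1 x2 x3 x4 x5 * D x3 + hess13 x0 x4 x5 x1 x2 x3 * D x4 + hess12 x0 x5 x1 x2
  x3 x4 * D x5 := by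
  simp only [grad1, hess01, hess11, hess12, hess13, map_add, map_sub, Derivation.leibniz, Derivation.leibniz_pow,
    derivation_ofNat, smul_eq_mul, nsmul_eq_mul]
  push_cast
  ring

end Derivatives

/-! ### Common zeros of the second partials, and of the gradient on coordinate subspaces. -/

section CommonZeros

variable {x0 x1 x2 x3 x4 x5 : ℂ}

/-- First half of the absence of triple points. The next lemma treats x₁ once x₀ = 0, and its cyclic
shifts treat the remaining coordinates. -/
theorem eq_zero_of_hess₀ (h00 : hess00 x0 x1 x2 x3 x4 x5 = 0)
    (h01 : hess01 x0 x1 x2 x3 x4 x5 = 0) (h02 : hess01 x0 x2 x3 x4 x5 x1 = 0)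
    (h03 : hess01 x0 x3 x4 x5 x1 x2 = 0) (h04 : hess01 x0 x4 x5 x1 x2 x3 = 0)
    (h05 : hess01 x0 x5 x1 x2 x3 x4 = 0)
    (h11 : hess11 x0 x1 x2 x3 x4 x5 = 0) (h22 : hess11 x0 x2 x3 x4 x5 x1 = 0)
    (h33 : hess11 x0 x3 x4 x5 x1 x2 = 0) (h44 : hess11 x0 x4 x5 x1 x2 x3 = 0)
    (h55 : hess11 x0 x5 x1 x2 x3 x4 = 0)
    (h12 : hess12 x0 x1 x2 x3 x4 x5 = 0) (h23 : hess12 x0 x2 x3 x4 x5 x1 = 0)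
    (h34 : hess12 x0 x3 x4 x5 x1 x2 = 0) (h45 : hess12 x0 x4 x5 x1 x2 x3 = 0)
    (h51 : hess12 x0 x5 x1 x2 x3 x4 = 0)
    (h13 : hess13 x0 x1 x2 x3 x4 x5 = 0) (h24 : hess13 x0 x2 x3 x4 x5 x1 = 0)
    (h35 : hess13 x0 x3 x4 x5 x1 x2 = 0) (h41 : hess13 x0 x4 x5 x1 x2 x3 = 0)
    (h52 : hess13 x0 x5 x1 x2 x3 x4 = 0) : x0 = 0 := by
  simp only [hess00, hess01, hess11, hess12, hess13] at *
  grind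

theorem eq_zero_of_hess₁ (h0 : x0 = 0)
    (h01 : hess01 x0 x1 x2 x3 x4 x5 = 0) (h02 : hess01 x0 x2 x3 x4 x5 x1 = 0)
    (h03 : hess01 x0 x3 x4 x5 x1 x2 = 0) (h04 : hess01 x0 x4 x5 x1 x2 x3 = 0)
    (h05 : hess01 x0 x5 x1 x2 x3 x4 = 0)
    (h11 : hess11 x0 x1 x2 x3 x4 x5 = 0) (h22 : hess11 x0 x2 x3 x4 x5 x1 = 0)
    (h33 : hess11 x0 x3 x4 x5 x1 x2 = 0) (h44 : hess11 x0 x4 x5 x1 x2 x3 = 0)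
    (h55 : hess11 x0 x5 x1 x2 x3 x4 = 0)
    (h12 : hess12 x0 x1 x2 x3 x4 x5 = 0) (h23 : hess12 x0 x2 x3 x4 x5 x1 = 0)
    (h34 : hess12 x0 x3 x4 x5 x1 x2 = 0) (h45 : hess12 x0 x4 x5 x1 x2 x3 = 0)
    (h51 : hess12 x0 x5 x1 x2 x3 x4 = 0)
    (h13 : hess13 x0 x1 x2 x3 x4 x5 = 0) (h24 : hess13 x0 x2 x3 x4 x5 x1 = 0)
    (h35 : hess13 x0 x3 x4 x5 x1 x2 = 0) (h41 : hess13 x0 x4 x5 x1 x2 x3 = 0)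
    (h52 : hess13 x0 x5 x1 x2 x3 x4 = 0) : x1 = 0 := by
  subst h0
  simp only [hess01, hess11, hess12, hess13] at *
  grind

/-- At most one of the remaining coordinates can be nonzero: the singular points on this linear
section are coordinate points. -/
theorem mul_eq_zero_of_grad (h0 : x0 = 0) (h1 : x1 = 0) (g0 : grad0 x0 x1 x2 x3 x4 x5 = 0)
    (g1 : grad1 x0 x1 x2 x3 x4 x5 = 0) (g2 : grad1 x0 x2 x3 x4 x5 x1 = 0)
    (g3 : grad1 x0 x3 x4 x5 x1 x2 = 0) (g4 : grad1 x0 x4 x5 x1 x2 x3 = 0)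
    (g5 : grad1 x0 x5 x1 x2 x3 x4 = 0) :
    x2 * x3 = 0 ∧ x2 * x4 = 0 ∧ x2 * x5 = 0 ∧ x3 * x4 = 0 ∧ x3 * x5 = 0 ∧ x4 * x5 = 0 := by
  subst h0 h1
  simp only [grad0, grad1] at *
  refine ⟨?_, ?_, ?_, ?_, ?_, ?_⟩ <;> grind

end CommonZeros


end

end KleinEPW

namespace KleinEPW

noncomputable section

/-! ### Orders of vanishing at a point -/

section Vanishing

theorem derivation_mem_pow {R A : Type*} [CommRing R] [CommRing A] [Algebra R A]
    (D : Derivation R A A) (I : Ideal A) (n : ℕ) {f : A} (hf : f ∈ I ^ (n + 1)) : D f ∈ I ^ n := by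
  induction n generalizing f with
  | zero => simp
  | succ n ih =>
    rw [pow_succ] at hf
    refine Submodule.mul_induction_on hf (fun a ha b hb => ?_) fun a b ha hb => ?_
    · rw [Derivation.leibniz, smul_eq_mul, smul_eq_mul]
      refine add_mem (Ideal.mul_mem_right _ _ ha) ?_
      rw [mul_comm, pow_succ]
      exact Ideal.mul_mem_mul (ih ha) hb
    · rw [map_add]
      exact add_mem ha hb

/-- An element outside a maximal ideal is invertible modulo every power of that ideal. -/
theorem mem_pow_of_mul_mem {A : Type*} [CommRing A] {I : Ideal A} (hI : I.IsMaximal) (n : ℕ)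
    {d f : A} (hd : d ∉ I) (h : d * f ∈ I ^ n) : f ∈ I ^ n := by
  obtain ⟨b, hb⟩ := hI.exists_inv hd
  obtain ⟨i, hi, hbi⟩ := hb
  have h1 : ∃ j ∈ I ^ n, ∃ b', b' * d + j = 1 := by
    have h2 : Ideal.span {d} ⊔ I = ⊤ := by
      rw [Ideal.eq_top_iff_one, ← hbi]
      exact add_mem (Ideal.mem_sup_left (Ideal.mul_mem_left _ _ (Ideal.mem_span_singleton_self d)))
        (Ideal.mem_sup_right hi)
    have h3 := Ideal.sup_pow_eq_top (n := n) h2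
    rw [Ideal.eq_top_iff_one, Submodule.mem_sup] at h3
    obtain ⟨y, hy, z, hz, hyz⟩ := h3
    obtain ⟨b', rfl⟩ := Ideal.mem_span_singleton'.1 hy
    exact ⟨z, hz, b', hyz⟩
  obtain ⟨j, hj, b', hb'⟩ := h1
  have : f = b' * (d * f) + f * j := by linear_combination f * (-hb')
  rw [this]
  exact add_mem (Ideal.mul_mem_left _ _ h) (Ideal.mul_mem_left _ _ hj)

theorem det_mem_pow {A : Type*} [CommRing A] {c : ℕ} (M : Matrix (Fin c) (Fin c) A) (I : Ideal A)
    (h : ∀ a b, M a b ∈ I) : M.det ∈ I ^ c := by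
  rw [Matrix.det_apply']
  refine sum_mem fun σ _ => Ideal.mul_mem_left _ _ ?_
  have := Ideal.prod_mem_prod (s := Finset.univ) (I := fun _ : Fin c => I) (x := fun a => M (σ a) a)
    fun a _ => h _ _
  simpa using this

/-- The maximal ideal of the affine cone at a point. -/
abbrev pointIdeal (p : Fin 6 → ℂ) : Ideal CoordRing := RingHom.ker (MvPolynomial.eval p)

instance isMaximal_pointIdeal (p : Fin 6 → ℂ) : (pointIdeal p).IsMaximal :=
  RingHom.ker_isMaximal_of_surjective _ fun z => ⟨MvPolynomial.C z, MvPolynomial.eval_C z⟩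

theorem map_eval_eq_bot {p : Fin 6 → ℂ} {I : Ideal CoordRing} :
    I.map (MvPolynomial.eval p) = ⊥ ↔ I ≤ pointIdeal p := by
  rw [Ideal.map_eq_bot_iff_le_ker]

/-- After inverting `d`, both F and det m generate the first degeneracy ideal; the powers of `d`
clear denominators. -/
theorem LocalForm.exists_pow_mul {p : Fin 6 → ℂ} {c : ℕ} (Φ : LocalForm p c) :
    (∃ k g, Φ.d ^ k * kleinSextic = g * Φ.m.det) ∧ ∃ k g, Φ.d ^ k * Φ.m.det = g * kleinSextic := by
  have key : ∀ a b : CoordRing, (Ideal.span {a}).map (algebraMap CoordRing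
      (Localization.Away Φ.d)) ≤ Ideal.span {algebraMap CoordRing (Localization.Away Φ.d) b} →
      ∃ k g, Φ.d ^ k * a = g * b := by
    intro a b hab
    have h1 : algebraMap CoordRing (Localization.Away Φ.d) a ∈
        (Ideal.span {b}).map (algebraMap CoordRing (Localization.Away Φ.d)) := by
      rw [Ideal.map_span, Set.image_singleton]
      exact hab (Ideal.mem_map_of_mem _ (Ideal.mem_span_singleton_self a))
    rw [IsLocalization.algebraMap_mem_map_algebraMap_iff (Submonoid.powers Φ.d)] at h1
    obtain ⟨_, ⟨k, rfl⟩, h1⟩ := h1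
    obtain ⟨g, hg⟩ := Ideal.mem_span_singleton'.1 h1
    exact ⟨k, g, hg.symm⟩
  have hu := IsLocalization.Away.algebraMap_isUnit (S := Localization.Away Φ.d) Φ.d
  have h1 := Φ.map_one (algebraMap CoordRing (Localization.Away Φ.d)) hu
  have h2 : (degeneracyIdeal kleinLagrangian 1).map (algebraMap CoordRing
      (Localization.Away Φ.d)) = (Ideal.span {kleinSextic}).map (algebraMap CoordRing
      (Localization.Away Φ.d)) := map_degeneracyIdeal_one _ Φ.i (Φ.isUnit_X _ hu)
  refine ⟨key _ _ ?_, key _ _ ?_⟩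
  · rw [← h2, h1]
  · rw [Ideal.map_span, Set.image_singleton, ← h1, h2, Ideal.map_span, Set.image_singleton]

/-- All entries of m vanish at p, so its determinant vanishes there to order at least c, and F
differs from it by factors invertible at p. -/
theorem LocalForm.kleinSextic_mem {p : Fin 6 → ℂ} {c : ℕ} (Φ : LocalForm p c) :
    kleinSextic ∈ pointIdeal p ^ c := by
  obtain ⟨⟨k, g, h⟩, -⟩ := Φ.exists_pow_mul
  refine mem_pow_of_mul_mem (isMaximal_pointIdeal p) c (d := Φ.d ^ k) ?_ ?_
  · rw [RingHom.mem_ker, map_pow]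
    exact pow_ne_zero _ Φ.eval_d
  · rw [h]
    exact Ideal.mul_mem_left _ _ (det_mem_pow _ _ fun a b => Φ.eval_m a b)

end Vanishing

/-! ### The singular points of the sextic -/

section SingularPoints

/-- The partial derivatives of the sextic vanish at `p`. -/
structure IsSing (p : Fin 6 → ℂ) : Prop where
  g0 : grad0 (p 0) (p 1) (p 2) (p 3) (p 4) (p 5) = 0
  g1 : grad1 (p 0) (p 1) (p 2) (p 3) (p 4) (p 5) = 0
  g2 : grad1 (p 0) (p 2) (p 3) (p 4) (p 5) (p 1) = 0
  g3 : grad1 (p 0) (p 3) (p 4) (p 5) (p 1) (p 2) = 0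
  g4 : grad1 (p 0) (p 4) (p 5) (p 1) (p 2) (p 3) = 0
  g5 : grad1 (p 0) (p 5) (p 1) (p 2) (p 3) (p 4) = 0

theorem eval_kleinSextic (p : Fin 6 → ℂ) : MvPolynomial.eval p kleinSextic =
    sexticForm (p 0) (p 1) (p 2) (p 3) (p 4) (p 5) := by
  simp [kleinSextic, sexticForm]

theorem dd_kleinSextic (t : Fin 6 → ℂ) : dd t kleinSextic =
    grad0 (.X 0) (.X 1) (.X 2) (.X 3) (.X 4) (.X 5) * .C (t 0) +
    grad1 (.X 0) (.X 1) (.X 2) (.X 3) (.X 4) (.X 5) * .C (t 1) +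
    grad1 (.X 0) (.X 2) (.X 3) (.X 4) (.X 5) (.X 1) * .C (t 2) +
    grad1 (.X 0) (.X 3) (.X 4) (.X 5) (.X 1) (.X 2) * .C (t 3) +
    grad1 (.X 0) (.X 4) (.X 5) (.X 1) (.X 2) (.X 3) * .C (t 4) +
    grad1 (.X 0) (.X 5) (.X 1) (.X 2) (.X 3) (.X 4) * .C (t 5) := by
  rw [kleinSextic, derivation_sexticForm]
  simp only [dd_X]

theorem eval_grad0 (p : Fin 6 → ℂ) (a b c d e f : CoordRing) :
    MvPolynomial.eval p (grad0 a b c d e f) = grad0 (MvPolynomial.eval p a) (MvPolynomial.eval p b)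
      (MvPolynomial.eval p c) (MvPolynomial.eval p d) (MvPolynomial.eval p e)
      (MvPolynomial.eval p f) := by
  simp [grad0]

theorem eval_grad1 (p : Fin 6 → ℂ) (a b c d e f : CoordRing) :
    MvPolynomial.eval p (grad1 a b c d e f) = grad1 (MvPolynomial.eval p a) (MvPolynomial.eval p b)
      (MvPolynomial.eval p c) (MvPolynomial.eval p d) (MvPolynomial.eval p e)
      (MvPolynomial.eval p f) := by
  simp [grad1]

theorem eval_dd_kleinSextic (p t : Fin 6 → ℂ) : MvPolynomial.eval p (dd t kleinSextic) =
    grad0 (p 0) (p 1) (p 2) (p 3) (p 4) (p 5) * t 0 +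
    grad1 (p 0) (p 1) (p 2) (p 3) (p 4) (p 5) * t 1 +
    grad1 (p 0) (p 2) (p 3) (p 4) (p 5) (p 1) * t 2 +
    grad1 (p 0) (p 3) (p 4) (p 5) (p 1) (p 2) * t 3 +
    grad1 (p 0) (p 4) (p 5) (p 1) (p 2) (p 3) * t 4 +
    grad1 (p 0) (p 5) (p 1) (p 2) (p 3) (p 4) * t 5 := by
  rw [dd_kleinSextic]
  simp only [map_add, map_mul, eval_grad0, eval_grad1, MvPolynomial.eval_X, MvPolynomial.eval_C]

theorem isSing_iff {p : Fin 6 → ℂ} :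
    IsSing p ↔ ∀ t, MvPolynomial.eval p (dd t kleinSextic) = 0 := by
  constructor
  · intro h t
    rw [eval_dd_kleinSextic, h.g0, h.g1, h.g2, h.g3, h.g4, h.g5]
    ring
  · intro h
    have h' := fun j => h (Pi.single j 1)
    simp only [eval_dd_kleinSextic] at h'
    exact ⟨by simpa [Pi.single_apply] using h' 0, by simpa [Pi.single_apply] using h' 1,
      by simpa [Pi.single_apply] using h' 2, by simpa [Pi.single_apply] using h' 3,
      by simpa [Pi.single_apply] using h' 4, by simpa [Pi.single_apply] using h' 5⟩

theorem IsSing.eval_eq_zero {p : Fin 6 → ℂ} (h : IsSing p) :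
    MvPolynomial.eval p kleinSextic = 0 := by
  -- Euler's relation for a form of degree six.
  have h1 : 6 * MvPolynomial.eval p kleinSextic = MvPolynomial.eval p (dd p kleinSextic) := by
    rw [eval_dd_kleinSextic, eval_kleinSextic]
    simp only [sexticForm, grad0, grad1]
    ring
  rw [isSing_iff.1 h] at h1
  simpa using h1

/-- Cyclic invariance reduces the vanishing coordinate to x₁, the case of `mul_eq_zero_of_grad`. -/
theorem IsSing.mul_eq_zero {p : Fin 6 → ℂ} (h : IsSing p) (h0 : p 0 = 0) {i : Fin 6} (hi : i ≠ 0)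
    (hpi : p i = 0) : ∀ k l, k ≠ l → p k * p l = 0 := by
  obtain ⟨g0, g1, g2, g3, g4, g5⟩ := h
  have key : ∃ k l m n, ({0, i, k, l, m, n} : Finset (Fin 6)) = Finset.univ ∧
      p k * p l = 0 ∧ p k * p m = 0 ∧ p k * p n = 0 ∧ p l * p m = 0 ∧ p l * p n = 0 ∧
      p m * p n = 0 := by
    have r0 : ∀ x0 x1 x2 x3 x4 x5 : ℂ, grad0 x0 x2 x3 x4 x5 x1 = grad0 x0 x1 x2 x3 x4 x5 := by
      intros; simp only [grad0]; ring
    fin_cases i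
    · exact absurd rfl hi
    · exact ⟨2, 3, 4, 5, by decide, mul_eq_zero_of_grad h0 hpi g0 g1 g2 g3 g4 g5⟩
    · exact ⟨3, 4, 5, 1, by decide, mul_eq_zero_of_grad h0 hpi (by rw [r0]; exact g0)
        g2 g3 g4 g5 g1⟩
    · exact ⟨4, 5, 1, 2, by decide, mul_eq_zero_of_grad h0 hpi (by rw [r0, r0]; exact g0)
        g3 g4 g5 g1 g2⟩
    · exact ⟨5, 1, 2, 3, by decide, mul_eq_zero_of_grad h0 hpi (by rw [r0, r0, r0]; exact g0)
        g4 g5 g1 g2 g3⟩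
    · exact ⟨1, 2, 3, 4, by decide, mul_eq_zero_of_grad h0 hpi (by rw [r0, r0, r0, r0]; exact g0)
        g5 g1 g2 g3 g4⟩
  obtain ⟨k, l, m, n, hu, h1, h2, h3, h4, h5, h6⟩ := key
  intro a b hab
  have ha : a ∈ ({0, i, k, l, m, n} : Finset (Fin 6)) := hu ▸ Finset.mem_univ a
  have hb : b ∈ ({0, i, k, l, m, n} : Finset (Fin 6)) := hu ▸ Finset.mem_univ b
  simp only [Finset.mem_insert, Finset.mem_singleton] at ha hb
  rcases ha with rfl | rfl | rfl | rfl | rfl | rfl <;>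
    rcases hb with rfl | rfl | rfl | rfl | rfl | rfl <;>
    first
    | exact absurd rfl hab
    | simp only [h0, hpi, zero_mul, mul_zero]
    | assumption
    | (rw [mul_comm]; assumption)

theorem isSing_single {j : Fin 6} (hj : j ≠ 0) (z : ℂ) : IsSing (Pi.single j z) := by
  fin_cases j
  · exact absurd rfl hj
  all_goals constructor <;> simp [grad0, grad1]

end SingularPoints

end

end KleinEPW

namespace KleinEPW

noncomputable section

/-! ### Points of the degeneracy schemes -/

section Points

theorem minors_succ_le {R m n : Type*} [CommRing R] (M : Matrix m n R) (k : ℕ) :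
    minors M (k + 1) ≤ minors M k := by
  rw [minors, Ideal.span_le]
  rintro _ ⟨f, g, rfl⟩
  rw [SetLike.mem_coe, Matrix.det_succ_row_zero]
  refine sum_mem fun j _ => Ideal.mul_mem_left _ _ ?_
  rw [Matrix.submatrix_submatrix]
  exact det_submatrix_mem_minors _ _ _

theorem map_eval_degeneracyIdeal_le {p : Fin 6 → ℂ} (hp : p ≠ 0) {k l : ℕ} (h : k ≤ l) :
    (degeneracyIdeal kleinLagrangian k).map (MvPolynomial.eval p) ≤
      (degeneracyIdeal kleinLagrangian l).map (MvPolynomial.eval p) := by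
  obtain ⟨i, hi⟩ := Function.ne_iff.1 hp
  have hi' : IsUnit (MvPolynomial.eval p (MvPolynomial.X i)) := by
    rw [MvPolynomial.eval_X]; exact isUnit_iff_ne_zero.2 hi
  rw [map_degeneracyIdeal _ i hi', map_degeneracyIdeal _ i hi']
  have : 11 - l ≤ 11 - k := by omega
  generalize 11 - k = a, 11 - l = b at this
  induction this with
  | refl => exact le_rfl
  | step _ ih => exact (minors_succ_le _ _).trans ih

variable {p : Fin 6 → ℂ}

theorem LocalForm.isUnit_eval {c : ℕ} (Φ : LocalForm p c) : IsUnit (MvPolynomial.eval p Φ.d) :=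
  isUnit_iff_ne_zero.2 Φ.eval_d

theorem LocalForm.le_pointIdeal {c : ℕ} (Φ : LocalForm p c) :
    degeneracyIdeal kleinLagrangian c ≤ pointIdeal p := by
  rw [← map_eval_eq_bot, Φ.map_eq _ Φ.isUnit_eval, entries, Ideal.span_eq_bot]
  rintro _ ⟨⟨a, b⟩, rfl⟩
  exact Φ.eval_m a b

theorem LocalForm.not_le_pointIdeal {c l : ℕ} (Φ : LocalForm p c) (hl : c < l) (hp : p ≠ 0) :
    ¬ degeneracyIdeal kleinLagrangian l ≤ pointIdeal p := by
  rw [← map_eval_eq_bot]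
  have := map_eval_degeneracyIdeal_le hp hl
  rw [Φ.map_succ _ Φ.isUnit_eval, top_le_iff] at this
  rw [this]
  exact top_ne_bot

/-- Since p ∧ κ_a lies in A, its `bC` coordinates vanish, and by `bet_sub` the pairing reduces to
the wedge product of t with p ∧ κ_a ∧ κ_b. -/
theorem LocalForm.eval_dd_m' {c : ℕ} (Φ : LocalForm p c) (t : Fin 6 → ℂ) (a b : Fin c) :
    MvPolynomial.eval p (dd t (Φ.m a b)) =
      -Φ.u * ∑ n, t n * tht p (Φ.κ a) (Φ.κ b) n := by
  have h := bet_sub p t (Φ.κ a) (Φ.κ b)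
  rw [Φ.bC_κ a] at h
  simp only [Pi.zero_apply, zero_mul, Finset.sum_const_zero, sub_zero] at h
  rw [Φ.eval_dd_m, bet, h]
  ring

theorem LocalForm.wdg_κ_ne_zero {c : ℕ} (Φ : LocalForm p c) (a : Fin c) : wdg p (Φ.κ a) ≠ 0 := by
  intro h
  have h1 := Φ.indep_κ (Pi.single a 1) (by simpa [Pi.single_apply, Finset.sum_ite_eq] using h)
  simpa using congrFun h1 a

/-- Near p the equation is a unit times the single entry of m, whose differential is a nonzero
multiple of p ∧ κ ∧ κ. That product is nonzero because A has no decomposable vectors. -/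
theorem LocalForm.not_isSing_one (Φ : LocalForm p 1) : ¬ IsSing p := by
  intro hs
  obtain ⟨-, k, g, h⟩ := Φ.exists_pow_mul
  have h1 : ∀ t, MvPolynomial.eval p (dd t Φ.m.det) = 0 := by
    intro t
    have h2 := congrArg (fun f => MvPolynomial.eval p (dd t f)) h
    simp only [eval_dd_mul, hs.eval_eq_zero, isSing_iff.1 hs, Matrix.det_unique, Φ.eval_m, mul_zero,
      zero_mul, add_zero] at h2
    rw [Matrix.det_unique]
    refine (mul_eq_zero.1 h2).resolve_left ?_
    rw [map_pow]
    exact pow_ne_zero _ Φ.eval_d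
  have h2 : tht p (Φ.κ 0) (Φ.κ 0) = 0 := by
    funext n
    have h3 := h1 (Pi.single n 1)
    rw [Matrix.det_unique, Φ.eval_dd_m'] at h3
    simpa [Pi.single_apply, Φ.u_ne] using h3
  exact Φ.wdg_κ_ne_zero 0 (tht_self_ne_zero (Φ.isAlt_κ 0) (Φ.bC_κ 0) h2)

theorem LocalForm.isSing {c : ℕ} (Φ : LocalForm p c) (hc : 2 ≤ c) : IsSing p := by
  rw [isSing_iff]
  intro t
  obtain ⟨k, rfl⟩ : ∃ k, c = k + 1 + 1 := ⟨c - 2, by omega⟩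
  exact Ideal.pow_le_self k.succ_ne_zero (derivation_mem_pow (dd t) _ _ Φ.kleinSextic_mem)

theorem eval_hess00 (p : Fin 6 → ℂ) (a b c d e f : CoordRing) :
    MvPolynomial.eval p (hess00 a b c d e f) = hess00 (MvPolynomial.eval p a)
      (MvPolynomial.eval p b) (MvPolynomial.eval p c) (MvPolynomial.eval p d)
      (MvPolynomial.eval p e) (MvPolynomial.eval p f) := by
  simp [hess00]

theorem eval_hess01 (p : Fin 6 → ℂ) (a b c d e f : CoordRing) :
    MvPolynomial.eval p (hess01 a b c d e f) = hess01 (MvPolynomial.eval p a)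
      (MvPolynomial.eval p b) (MvPolynomial.eval p c) (MvPolynomial.eval p d)
      (MvPolynomial.eval p e) (MvPolynomial.eval p f) := by
  simp [hess01]

theorem eval_hess11 (p : Fin 6 → ℂ) (a b c d e f : CoordRing) :
    MvPolynomial.eval p (hess11 a b c d e f) = hess11 (MvPolynomial.eval p a)
      (MvPolynomial.eval p b) (MvPolynomial.eval p c) (MvPolynomial.eval p d)
      (MvPolynomial.eval p e) (MvPolynomial.eval p f) := by
  simp [hess11]

theorem eval_hess12 (p : Fin 6 → ℂ) (a b c d e f : CoordRing) :
    MvPolynomial.eval p (hess12 a b c d e f) = hess12 (MvPolynomial.eval p a)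
      (MvPolynomial.eval p b) (MvPolynomial.eval p c) (MvPolynomial.eval p d)
      (MvPolynomial.eval p e) (MvPolynomial.eval p f) := by
  simp [hess12]

theorem eval_hess13 (p : Fin 6 → ℂ) (a b c d e f : CoordRing) :
    MvPolynomial.eval p (hess13 a b c d e f) = hess13 (MvPolynomial.eval p a)
      (MvPolynomial.eval p b) (MvPolynomial.eval p c) (MvPolynomial.eval p d)
      (MvPolynomial.eval p e) (MvPolynomial.eval p f) := by
  simp [hess13]

/-- Corank at least three would make F vanish to order three, hence make all second partials vanish
at p. -/
theorem LocalForm.lt_three {c : ℕ} (Φ : LocalForm p c) (hp : p ≠ 0) : c < 3 := by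
  by_contra! hc
  obtain ⟨k, rfl⟩ : ∃ k, c = k + 1 + 1 + 1 := ⟨c - 3, by omega⟩
  have key : ∀ s t, MvPolynomial.eval p (dd s (dd t kleinSextic)) = 0 := fun s t =>
    Ideal.pow_le_self k.succ_ne_zero
      (derivation_mem_pow (dd s) _ _ (derivation_mem_pow (dd t) _ _ Φ.kleinSextic_mem))
  have key' : ∀ i j, MvPolynomial.eval p
      (dd (Pi.single i 1) (dd (Pi.single j 1) kleinSextic)) = 0 := fun i j => key _ _
  simp only [dd_kleinSextic] at key'
  have h00 := key' 0 0
  simp [derivation_grad0, dd_X, eval_hess00] at h00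
  have h01 := key' 1 0
  simp [derivation_grad0, dd_X, eval_hess01] at h01
  have h02 := key' 2 0
  simp [derivation_grad0, dd_X, eval_hess01] at h02
  have h03 := key' 3 0
  simp [derivation_grad0, dd_X, eval_hess01] at h03
  have h04 := key' 4 0
  simp [derivation_grad0, dd_X, eval_hess01] at h04
  have h05 := key' 5 0
  simp [derivation_grad0, dd_X, eval_hess01] at h05
  have h11 := key' 1 1
  simp [derivation_grad1, dd_X, eval_hess11] at h11
  have h22 := key' 2 2
  simp [derivation_grad1, dd_X, eval_hess11] at h22
  have h33 := key' 3 3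
  simp [derivation_grad1, dd_X, eval_hess11] at h33
  have h44 := key' 4 4
  simp [derivation_grad1, dd_X, eval_hess11] at h44
  have h55 := key' 5 5
  simp [derivation_grad1, dd_X, eval_hess11] at h55
  have h12 := key' 2 1
  simp [derivation_grad1, dd_X, eval_hess12] at h12
  have h23 := key' 3 2
  simp [derivation_grad1, dd_X, eval_hess12] at h23
  have h34 := key' 4 3
  simp [derivation_grad1, dd_X, eval_hess12] at h34
  have h45 := key' 5 4
  simp [derivation_grad1, dd_X, eval_hess12] at h45
  have h51 := key' 1 5
  simp [derivation_grad1, dd_X, eval_hess12] at h51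
  have h13 := key' 3 1
  simp [derivation_grad1, dd_X, eval_hess13] at h13
  have h24 := key' 4 2
  simp [derivation_grad1, dd_X, eval_hess13] at h24
  have h35 := key' 5 3
  simp [derivation_grad1, dd_X, eval_hess13] at h35
  have h41 := key' 1 4
  simp [derivation_grad1, dd_X, eval_hess13] at h41
  have h52 := key' 2 5
  simp [derivation_grad1, dd_X, eval_hess13] at h52
  have x0 := eq_zero_of_hess₀ h00 h01 h02 h03 h04 h05 h11 h22 h33 h44 h55 h12 h23 h34 h45 h51 h13 h24 h35 h41 h52
  have x1 := eq_zero_of_hess₁ x0 h01 h02 h03 h04 h05 h11 h22 h33 h44 h55 h12 h23 h34 h45 h51 h13 h24 h35 h41 h52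
  have x2 := eq_zero_of_hess₁ x0 h02 h03 h04 h05 h01 h22 h33 h44 h55 h11 h23 h34 h45 h51 h12 h24 h35 h41 h52 h13
  have x3 := eq_zero_of_hess₁ x0 h03 h04 h05 h01 h02 h33 h44 h55 h11 h22 h34 h45 h51 h12 h23 h35 h41 h52 h13 h24
  have x4 := eq_zero_of_hess₁ x0 h04 h05 h01 h02 h03 h44 h55 h11 h22 h33 h45 h51 h12 h23 h34 h41 h52 h13 h24 h35
  have x5 := eq_zero_of_hess₁ x0 h05 h01 h02 h03 h04 h55 h11 h22 h33 h44 h51 h12 h23 h34 h45 h52 h13 h24 h35 h41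
  refine hp (funext fun i => ?_)
  fin_cases i
  exacts [x0, x1, x2, x3, x4, x5]

theorem exists_localForm (hp : p ≠ 0) : ∃ c, Nonempty (LocalForm p c) :=
  let ⟨_, hi⟩ := Function.ne_iff.1 hp
  ⟨_, nonempty_localForm hi rfl⟩

/-- Only coranks 0, 1 and 2 occur: F is nonzero in corank 0, has nonzero differential in corank 1,
and vanishes to order two in corank 2. -/
theorem degeneracyIdeal_two_le_iff (hp : p ≠ 0) :
    degeneracyIdeal kleinLagrangian 2 ≤ pointIdeal p ↔ IsSing p := by
  obtain ⟨c, ⟨Φ⟩⟩ := exists_localForm hp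
  constructor
  · intro h
    refine Φ.isSing ?_
    by_contra! hc
    exact Φ.not_le_pointIdeal hc hp h
  · intro h
    have hc := Φ.lt_three hp
    interval_cases c
    · exfalso
      have h1 := Φ.map_one _ Φ.isUnit_eval
      rw [map_degeneracyIdeal_one _ Φ.i (Φ.isUnit_X _ Φ.isUnit_eval), Ideal.map_span,
        Set.image_singleton, h.eval_eq_zero] at h1
      simp at h1
    · exact absurd h Φ.not_isSing_one
    · exact Φ.le_pointIdeal

theorem nonempty_localForm_two (hp : p ≠ 0)
    (h : degeneracyIdeal kleinLagrangian 2 ≤ pointIdeal p) : Nonempty (LocalForm p 2) := by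
  obtain ⟨c, ⟨Φ⟩⟩ := exists_localForm hp
  have hc := Φ.lt_three hp
  have hc' : ¬ c < 2 := fun hc' => Φ.not_le_pointIdeal hc' hp h
  obtain rfl : c = 2 := by omega
  exact ⟨Φ⟩

theorem degeneracyIdeal_three_le (h : degeneracyIdeal kleinLagrangian 3 ≤ pointIdeal p) :
    p = 0 := by
  by_contra hp
  obtain ⟨c, ⟨Φ⟩⟩ := exists_localForm hp
  exact Φ.not_le_pointIdeal (Φ.lt_three hp) hp h

end Points

end

end KleinEPW

namespace KleinEPW

noncomputable section

/-! ### Local equations of the locus of corank two -/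

section LocalEquations

/-- Three equations with independent differentials defining the degeneracy locus of corank two near
the point `p`. -/
structure LocalEquations (p : Fin 6 → ℂ) where
  f : Fin 3 → CoordRing
  h : CoordRing
  θ : Fin 3 → Fin 6 → ℂ
  eval_h : MvPolynomial.eval p h ≠ 0
  eval_f : ∀ a, MvPolynomial.eval p (f a) = 0
  eval_dd_f : ∀ a t, MvPolynomial.eval p (dd t (f a)) = ∑ n, t n * θ a n
  indep : LinearIndependent ℂ θ
  euler : ∀ a, ∑ n, p n * θ a n = 0
  map_eq : ∀ {R : Type} [CommRing R] (φ : CoordRing →+* R), IsUnit (φ h) →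
    (degeneracyIdeal kleinLagrangian 2).map φ = Ideal.span (Set.range (φ ∘ f))

theorem nonempty_localEquations {p : Fin 6 → ℂ} (hp : p ≠ 0)
    (hI : degeneracyIdeal kleinLagrangian 2 ≤ pointIdeal p) : Nonempty (LocalEquations p) := by
  obtain ⟨Φ⟩ := nonempty_localForm_two hp hI
  have hind : ∀ l : Fin 3 → ℂ, l 0 • tht p (Φ.κ 0) (Φ.κ 0) + l 1 • tht p (Φ.κ 0) (Φ.κ 1) +
      l 2 • tht p (Φ.κ 1) (Φ.κ 1) = 0 → l 0 = 0 ∧ l 1 = 0 ∧ l 2 = 0 := by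
    intro l hl
    refine tht_independent (Φ.isAlt_κ 0) (Φ.isAlt_κ 1) (Φ.bC_κ 0) (Φ.bC_κ 1) (fun a b hab => ?_) hl
    have := Φ.indep_κ ![a, b] (by simpa [Fin.sum_univ_two] using hab)
    exact ⟨by simpa using congrFun this 0, by simpa using congrFun this 1⟩
  have heuler : ∀ a b, ∑ n, p n * tht p (Φ.κ a) (Φ.κ b) n = 0 := by
    intro a b
    have := bet_sub p p (Φ.κ a) (Φ.κ b)
    rw [Φ.bC_κ a, Φ.bC_κ b] at this
    simpa using this.symm
  refine ⟨{
    f := ![Φ.m 0 0, Φ.m 0 1, Φ.m 1 1]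
    -- Inverting `α 1 1` as well lets the symmetry of αᵀm express m₁₀ through the other three
    -- entries, so three equations suffice.
    h := Φ.d * Φ.α 1 1
    θ := ![-Φ.u • tht p (Φ.κ 0) (Φ.κ 0), -Φ.u • tht p (Φ.κ 0) (Φ.κ 1),
      -Φ.u • tht p (Φ.κ 1) (Φ.κ 1)]
    eval_h := ?_
    eval_f := ?_
    eval_dd_f := ?_
    indep := ?_
    euler := ?_
    map_eq := ?_ }⟩
  · rw [map_mul, Φ.eval_α, if_pos rfl]
    exact mul_ne_zero Φ.eval_d Φ.u_ne
  · intro a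
    fin_cases a <;> exact Φ.eval_m _ _
  · intro a t
    have key : ∀ a b, MvPolynomial.eval p (dd t (Φ.m a b)) =
        ∑ n, t n * (-Φ.u • tht p (Φ.κ a) (Φ.κ b)) n := by
      intro a b
      rw [Φ.eval_dd_m', Finset.mul_sum]
      refine Finset.sum_congr rfl fun n _ => ?_
      simp only [Pi.smul_apply, smul_eq_mul]
      ring
    fin_cases a <;> exact key _ _
  · rw [Fintype.linearIndependent_iff]
    intro l hl
    have h1 := hind (fun a => l a * -Φ.u) (by
      rw [Fin.sum_univ_three] at hl
      simpa only [Matrix.cons_val_zero, Matrix.cons_val_one, Matrix.cons_val, smul_smul] using hl)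
    have hu : -Φ.u ≠ 0 := neg_ne_zero.2 Φ.u_ne
    intro a
    fin_cases a
    · exact (mul_eq_zero.1 h1.1).resolve_right hu
    · exact (mul_eq_zero.1 h1.2.1).resolve_right hu
    · exact (mul_eq_zero.1 h1.2.2).resolve_right hu
  · have key : ∀ a b, ∑ n, p n * (-Φ.u • tht p (Φ.κ a) (Φ.κ b)) n = 0 := by
      intro a b
      have : ∀ n, p n * (-Φ.u • tht p (Φ.κ a) (Φ.κ b)) n =
          -Φ.u * (p n * tht p (Φ.κ a) (Φ.κ b) n) := fun n => by
        simp only [Pi.smul_apply, smul_eq_mul]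
        ring
      simp only [this]
      rw [← Finset.mul_sum, heuler, mul_zero]
    intro a
    fin_cases a <;> exact key _ _
  · intro R _ φ hφ
    rw [map_mul] at hφ
    have h1 := isUnit_of_mul_isUnit_left hφ
    have h2 := isUnit_of_mul_isUnit_right hφ
    rw [Φ.map_eq φ h1]
    apply le_antisymm
    · rw [entries, Ideal.span_le]
      have h00 : φ (Φ.m 0 0) ∈ Ideal.span (Set.range (φ ∘ ![Φ.m 0 0, Φ.m 0 1, Φ.m 1 1])) :=
        Ideal.subset_span ⟨0, rfl⟩
      have h01 : φ (Φ.m 0 1) ∈ Ideal.span (Set.range (φ ∘ ![Φ.m 0 0, Φ.m 0 1, Φ.m 1 1])) :=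
        Ideal.subset_span ⟨1, rfl⟩
      have h11 : φ (Φ.m 1 1) ∈ Ideal.span (Set.range (φ ∘ ![Φ.m 0 0, Φ.m 0 1, Φ.m 1 1])) :=
        Ideal.subset_span ⟨2, rfl⟩
      have h10 : φ (Φ.m 1 0) ∈ Ideal.span (Set.range (φ ∘ ![Φ.m 0 0, Φ.m 0 1, Φ.m 1 1])) := by
        obtain ⟨v, hv⟩ := h2.exists_left_inv
        have h3 := (Φ.symm φ h1).apply 0 1
        simp only [Matrix.mul_apply, Matrix.transpose_apply, Matrix.map_apply, Fin.sum_univ_two]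
          at h3
        have h4 : φ (Φ.m 1 0) = v * φ (Φ.α 0 0) * φ (Φ.m 0 1) + v * φ (Φ.α 1 0) * φ (Φ.m 1 1) -
            v * φ (Φ.α 0 1) * φ (Φ.m 0 0) := by
          linear_combination v * h3 - φ (Φ.m 1 0) * hv
        rw [h4]
        exact sub_mem (add_mem (Ideal.mul_mem_left _ _ h01) (Ideal.mul_mem_left _ _ h11))
          (Ideal.mul_mem_left _ _ h00)
      rintro _ ⟨⟨a, b⟩, rfl⟩
      fin_cases a <;> fin_cases b
      exacts [h00, h01, h10, h11]
    · rw [Ideal.span_le]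
      rintro _ ⟨a, rfl⟩
      fin_cases a
      exacts [mem_entries (Φ.m.map φ) 0 0, mem_entries (Φ.m.map φ) 0 1,
        mem_entries (Φ.m.map φ) 1 1]

/-- A matrix with independent rows has a nonzero maximal minor. -/
theorem exists_det_submatrix_ne_zero {k : ℕ} {n : Type*} [Fintype n] [DecidableEq n]
    (M : Fin k → n → ℂ) (h : LinearIndependent ℂ M) :
    ∃ σ : Fin k → n, (Matrix.of fun a b => M a (σ b)).det ≠ 0 := by
  by_contra! hσ
  obtain ⟨g, hg⟩ := (Fintype.linearCombination ℂ M).exists_leftInverse_of_injective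
    (LinearMap.ker_eq_bot.2 (LinearIndependent.fintypeLinearCombination_injective h))
  -- Q is a right inverse of M. If all maximal minors of M vanished, expanding det(MQ) = 1 over them
  -- would give 0.
  let Q : Matrix n (Fin k) ℂ := Matrix.of fun s a => g (Pi.single s 1) a
  have hMQ : Matrix.of M * Q = 1 := by
    ext a b
    have h1 := congrFun (LinearMap.congr_fun hg (Pi.single a 1)) b
    rw [LinearMap.comp_apply, Fintype.linearCombination_apply_single, one_smul,
      LinearMap.pi_apply_eq_sum_univ g] at h1
    rw [Matrix.mul_apply, Matrix.one_apply]
    simp only [Finset.sum_apply, Pi.smul_apply, smul_eq_mul, LinearMap.id_apply] at h1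
    rw [Pi.single_apply] at h1
    simp only [Q, Matrix.of_apply]
    rw [show (if a = b then (1 : ℂ) else 0) = if b = a then 1 else 0 by simp [eq_comm], ← h1]
    refine Finset.sum_congr rfl fun s _ => ?_
    congr 1
    refine congrFun (congrArg g ?_) b
    funext l
    simp [Pi.single_apply, eq_comm]
  have h2 : (Q.transpose * (Matrix.of M).transpose).det ∈ (⊥ : Ideal ℂ) := by
    refine det_mul_mem_of_forall_submatrix _ _ _ fun f => ?_
    rw [← Matrix.det_transpose]
    exact hσ f
  rw [← Matrix.transpose_mul, hMQ] at h2
  simp at h2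

end LocalEquations

end

end KleinEPW

namespace KleinEPW

noncomputable section

/-! ### Local primality -/

section LocalPrimality

/-- For P minimal over J inside J + (x), an element j + wx of P has wx ∈ P, hence w ∈ P since x ∉ P.
Thus P ≤ J + xP, and Nakayama gives P = J. -/
theorem isPrime_of_isPrime_sup_span_singleton {R : Type*} [CommRing R] [IsNoetherianRing R]
    [IsLocalRing R] {J : Ideal R} {x : R} (hx : x ∈ IsLocalRing.maximalIdeal R)
    (hQ : (J ⊔ Ideal.span {x}).IsPrime) (h : ∀ P : Ideal R, P.IsPrime → J ≤ P →
      P ∈ J.minimalPrimes → x ∉ P) : J.IsPrime := by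
  obtain ⟨P, hP, hPQ⟩ := Ideal.exists_minimalPrimes_le (le_sup_left : J ≤ J ⊔ Ideal.span {x})
  have hPp : P.IsPrime := hP.1.1
  have hxP := h P hPp hP.1.2 hP
  suffices P ≤ J by rw [le_antisymm hP.1.2 this]; exact hPp
  refine Submodule.le_of_le_smul_of_le_jacobson_bot (I := Ideal.span {x})
    (IsNoetherian.noetherian P) ?_ ?_
  · rw [IsLocalRing.jacobson_eq_maximalIdeal _ bot_ne_top, Ideal.span_singleton_le_iff_mem]
    exact hx
  · intro y hy
    obtain ⟨j, hj, z, hz, rfl⟩ := Submodule.mem_sup.1 (hPQ hy)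
    obtain ⟨w, rfl⟩ := Ideal.mem_span_singleton'.1 hz
    refine add_mem (Submodule.mem_sup_left hj) (Submodule.mem_sup_right ?_)
    rw [mul_comm, smul_eq_mul]
    refine Ideal.mul_mem_mul (Ideal.mem_span_singleton_self x) ?_
    have h1 : w * x ∈ P := by
      have := sub_mem hy (hP.1.2 hj)
      simpa using this
    exact (hPp.mem_or_mem h1).resolve_right hxP

theorem maximalIdeal_quotient {R : Type*} [CommRing R] [IsLocalRing R] (J : Ideal R)
    [IsLocalRing (R ⧸ J)] :
    (IsLocalRing.maximalIdeal R).map (Ideal.Quotient.mk J) = IsLocalRing.maximalIdeal (R ⧸ J) := by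
  have h := Ideal.comap_isMaximal_of_surjective (Ideal.Quotient.mk J) Ideal.Quotient.mk_surjective
    (K := IsLocalRing.maximalIdeal (R ⧸ J))
  rw [← IsLocalRing.eq_maximalIdeal h,
    Ideal.map_comap_of_surjective _ Ideal.Quotient.mk_surjective]

/-- A Noetherian local ring of dimension at least `n` whose maximal ideal is generated by `n`
elements is a domain. -/
theorem isDomain_of_span_eq_maximalIdeal (n : ℕ) : ∀ {R : Type} [CommRing R] [IsNoetherianRing R]
    [IsLocalRing R] (g : Fin n → R), Ideal.span (Set.range g) = IsLocalRing.maximalIdeal R →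
    (n : ℕ∞) ≤ (IsLocalRing.maximalIdeal R).height → IsDomain R := by
  induction n with
  | zero =>
    intro R _ _ _ g hg _
    have : (⊥ : Ideal R).IsPrime := by
      rw [← Ideal.span_empty, ← Set.range_eq_empty g, hg]
      infer_instance
    exact IsDomain.of_bot_isPrime R
  | succ n ih =>
    intro R _ _ _ g hg hn
    have hpos : (IsLocalRing.maximalIdeal R).height ≠ 0 := by
      intro h0
      rw [h0] at hn
      simp at hn
    have hmin : ∀ P ∈ minimalPrimes R, ¬ IsLocalRing.maximalIdeal R ≤ P := by
      intro P hP h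
      have := Ideal.IsMinimalPrime.isPrime hP
      have h1 := IsLocalRing.le_maximalIdeal this.ne_top
      rw [le_antisymm h1 h] at hP
      exact hpos (Ideal.height_eq_zero_iff.2 hP)
    have hsq : ¬ IsLocalRing.maximalIdeal R ≤ IsLocalRing.maximalIdeal R ^ 2 := by
      intro h
      have h1 := Submodule.eq_bot_of_le_smul_of_le_jacobson_bot (IsLocalRing.maximalIdeal R)
        (IsLocalRing.maximalIdeal R) (IsNoetherian.noetherian _) (by rwa [smul_eq_mul, ← pow_two])
        (IsLocalRing.jacobson_eq_maximalIdeal _ bot_ne_top).ge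
      rw [h1] at hmin
      obtain ⟨P, hP⟩ := Ideal.nonempty_minimalPrimes (bot_ne_top : (⊥ : Ideal R) ≠ ⊤)
      exact hmin P hP bot_le
    -- Prime avoidance for the minimal primes together with 𝔪², the one ideal in the list that need
    -- not be prime.
    obtain ⟨x, hx, hx2, hxP⟩ : ∃ x ∈ IsLocalRing.maximalIdeal R,
        x ∉ IsLocalRing.maximalIdeal R ^ 2 ∧ ∀ P ∈ minimalPrimes R, x ∉ P := by
      classical
      have hfin := minimalPrimes.finite_of_isNoetherianRing R
      by_contra! hcon
      have h1 : (IsLocalRing.maximalIdeal R : Set R) ⊆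
          ⋃ i ∈ ((insert (IsLocalRing.maximalIdeal R ^ 2) hfin.toFinset : Finset (Ideal R)) :
            Set (Ideal R)), (id i : Ideal R) := by
        intro x hx
        simp only [Finset.coe_insert, Set.Finite.coe_toFinset, Set.mem_iUnion, Set.mem_insert_iff]
        by_cases h2 : x ∈ IsLocalRing.maximalIdeal R ^ 2
        · exact ⟨_, Or.inl rfl, h2⟩
        · obtain ⟨P, hP, hxP⟩ := hcon x hx h2
          exact ⟨P, Or.inr hP, hxP⟩
      rw [Ideal.subset_union_prime (IsLocalRing.maximalIdeal R ^ 2)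
        (IsLocalRing.maximalIdeal R ^ 2)] at h1
      · obtain ⟨P, hP, hle⟩ := h1
        rw [Finset.mem_insert, Set.Finite.mem_toFinset] at hP
        rcases hP with rfl | hP
        · exact hsq hle
        · exact hmin P hP hle
      · intro P hP hne _
        rw [Finset.mem_insert, Set.Finite.mem_toFinset] at hP
        exact Ideal.IsMinimalPrime.isPrime (hP.resolve_left hne)
    have hx' := hx
    rw [← hg, Ideal.mem_span_range_iff_exists_fun] at hx'
    obtain ⟨a, ha⟩ := hx'
    have hgm : ∀ j, g j ∈ IsLocalRing.maximalIdeal R := fun j => hg ▸ Ideal.subset_span ⟨j, rfl⟩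
    -- Because x ∉ 𝔪², some coefficient is a unit. So gᵢ becomes redundant modulo x, and the
    -- induction runs on R/(x), whose dimension drops by at most one.
    obtain ⟨i, hi⟩ : ∃ i, IsUnit (a i) := by
      by_contra! hcon
      apply hx2
      rw [← ha, pow_two]
      exact sum_mem fun j _ => Ideal.mul_mem_mul ((IsLocalRing.mem_maximalIdeal _).2 (hcon j)) (hgm j)
    have : Nontrivial (R ⧸ Ideal.span {x}) :=
      Ideal.Quotient.nontrivial_iff.2 fun h => by
        rw [Ideal.span_singleton_eq_top] at h
        exact hx h
    have : IsLocalRing (R ⧸ Ideal.span {x}) :=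
      IsLocalRing.of_surjective' (Ideal.Quotient.mk _) Ideal.Quotient.mk_surjective
    have hS : IsDomain (R ⧸ Ideal.span {x}) := by
      refine ih (fun j => Ideal.Quotient.mk _ (g (i.succAbove j))) ?_ ?_
      · rw [← maximalIdeal_quotient, ← hg, Ideal.map_span, ← Set.range_comp]
        apply le_antisymm
        · refine Ideal.span_mono ?_
          rintro _ ⟨j, rfl⟩
          exact ⟨i.succAbove j, rfl⟩
        · rw [Ideal.span_le]
          rintro _ ⟨j, rfl⟩
          rcases Fin.eq_self_or_eq_succAbove i j with rfl | ⟨j, rfl⟩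
          · obtain ⟨v, hv⟩ := hi.exists_left_inv
            have h1 : g j = v * x - ∑ l, v * a (j.succAbove l) * g (j.succAbove l) := by
              rw [← ha, Fin.sum_univ_succAbove _ j, mul_add, ← mul_assoc, hv, one_mul,
                Finset.mul_sum]
              simp only [mul_assoc, add_sub_cancel_right]
            have h2 : Ideal.Quotient.mk (Ideal.span {x}) x = 0 :=
              Ideal.Quotient.eq_zero_iff_mem.2 (Ideal.mem_span_singleton_self x)
            rw [Function.comp_apply, h1, map_sub, map_mul, h2, mul_zero, zero_sub, map_sum]
            refine neg_mem (sum_mem fun l _ => ?_)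
            rw [map_mul]
            exact Ideal.mul_mem_left _ _ (Ideal.subset_span ⟨l, rfl⟩)
          · exact Ideal.subset_span ⟨j, rfl⟩
      · have h1 := hn.trans (Ideal.height_le_height_add_one_of_mem hx)
        rw [maximalIdeal_quotient, Nat.cast_add, Nat.cast_one] at h1
        exact (ENat.add_le_add_iff_right ENat.one_ne_top).1 h1
    have hxp : (⊥ ⊔ Ideal.span {x} : Ideal R).IsPrime := by
      rw [bot_sup_eq]
      exact (Ideal.Quotient.isDomain_iff_prime _).1 hS
    have := isPrime_of_isPrime_sup_span_singleton hx hxp fun P _ _ hP => hxP P hP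
    exact IsDomain.of_bot_isPrime R

/-- Killing the m elements f lowers the height by at most m, so the quotient has dimension at least
n while n elements generate its maximal ideal. -/
theorem isPrime_span_range {R : Type} [CommRing R] [IsNoetherianRing R] [IsLocalRing R]
    {m n : ℕ} (f : Fin m → R) (g : Fin n → R)
    (h : Ideal.span (Set.range f) ⊔ Ideal.span (Set.range g) = IsLocalRing.maximalIdeal R)
    (hd : ((m + n : ℕ) : ℕ∞) ≤ (IsLocalRing.maximalIdeal R).height) :
    (Ideal.span (Set.range f)).IsPrime := by
  have hle : Ideal.span (Set.range f) ≤ IsLocalRing.maximalIdeal R := h ▸ le_sup_left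
  have : Nontrivial (R ⧸ Ideal.span (Set.range f)) :=
    Ideal.Quotient.nontrivial_iff.2 (ne_top_of_le_ne_top (Ideal.IsPrime.ne_top inferInstance) hle)
  have : IsLocalRing (R ⧸ Ideal.span (Set.range f)) :=
    IsLocalRing.of_surjective' (Ideal.Quotient.mk _) Ideal.Quotient.mk_surjective
  refine (Ideal.Quotient.isDomain_iff_prime _).1
    (isDomain_of_span_eq_maximalIdeal n (fun j => Ideal.Quotient.mk _ (g j)) ?_ ?_)
  · rw [← maximalIdeal_quotient, ← h, Ideal.map_sup, Ideal.map_quotient_self, bot_sup_eq,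
      Ideal.map_span, ← Set.range_comp]
    rfl
  · have h1 := hd.trans (Ideal.height_le_height_add_encard_of_subset (Set.range f)
      (Ideal.span_le.1 hle))
    rw [maximalIdeal_quotient] at h1
    have h2 : (Set.range f).encard ≤ m := by
      rw [← Set.image_univ]
      exact (Set.encard_image_le _ _).trans (by simp)
    have h3 := h1.trans (add_le_add_right h2 _)
    rw [Nat.cast_add, add_comm] at h3
    exact (ENat.add_le_add_iff_right (ENat.natCast_ne_top m)).1 h3

end LocalPrimality

end

end KleinEPW

namespace KleinEPW

noncomputable section

/-! ### The local ring of the affine cone at a point -/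

section PointLocalRing

open MvPolynomial in
/-- Translation of the affine space. -/
def translate (c : Fin 6 → ℂ) : CoordRing ≃ₐ[ℂ] CoordRing :=
  AlgEquiv.ofAlgHom (aeval fun j => X j + C (c j)) (aeval fun j => X j - C (c j))
    (by ext j; simp) (by ext j; simp)

theorem comap_translate (c p : Fin 6 → ℂ) :
    (pointIdeal p).comap (translate c) = pointIdeal (p + c) := by
  ext f
  have : (MvPolynomial.eval p).comp (translate c : CoordRing →+* CoordRing) =
      MvPolynomial.eval (p + c) := by
    apply MvPolynomial.ringHom_ext
    · intro r; simp [translate]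
    · intro i; simp [translate]
  rw [Ideal.mem_comap, RingHom.mem_ker, RingHom.mem_ker, ← this]
  rfl

theorem exists_pointIdeal_eq {I : Ideal CoordRing} (hI : I.IsMaximal) : ∃ p, I = pointIdeal p := by
  obtain ⟨p, rfl⟩ := (MvPolynomial.isMaximal_iff_eq_vanishingIdeal_singleton (I := I)).1 hI
  refine ⟨p, ?_⟩
  ext f
  rw [MvPolynomial.mem_vanishingIdeal_singleton_iff, RingHom.mem_ker, MvPolynomial.aeval_eq_eval]

/-- The Krull dimension six is the supremum of the heights of maximal ideals; these are all point
ideals, and translations make their heights equal. -/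
theorem height_pointIdeal (p : Fin 6 → ℂ) : 6 ≤ (pointIdeal p).height := by
  have h1 : ringKrullDim CoordRing ≤ (pointIdeal p).height := by
    rw [ringKrullDim_le_iff_isMaximal_height_le]
    intro M hM
    obtain ⟨q, rfl⟩ := exists_pointIdeal_eq hM
    have h2 := RingEquiv.height_comap (translate (q - p)).toRingEquiv (pointIdeal p)
    have h3 := comap_translate (q - p) p
    rw [add_sub_cancel] at h3
    rw [← h3]
    exact WithBot.coe_le_coe.2 h2.le
  rw [MvPolynomial.ringKrullDim_of_isNoetherianRing, ringKrullDim_eq_zero_of_field, zero_add,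
    Nat.card_fin] at h1
  exact WithBot.coe_le_coe.1 h1

theorem X_sub_C_mem (p : Fin 6 → ℂ) (n : Fin 6) :
    (MvPolynomial.X n - MvPolynomial.C (p n) : CoordRing) ∈ pointIdeal p := by
  simp [RingHom.mem_ker]

theorem sub_eval_mem (p : Fin 6 → ℂ) (f : CoordRing) :
    f - MvPolynomial.C (MvPolynomial.eval p f) ∈ pointIdeal p := by
  simp [RingHom.mem_ker]

/-- The Taylor expansion of order one. -/
theorem taylor_mem (p : Fin 6 → ℂ) (f : CoordRing) :
    f - MvPolynomial.C (MvPolynomial.eval p f) - ∑ n, MvPolynomial.C (MvPolynomial.eval p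
      (dd (Pi.single n 1) f)) * (MvPolynomial.X n - MvPolynomial.C (p n)) ∈ pointIdeal p ^ 2 := by
  induction f using MvPolynomial.induction_on with
  | C a => simp
  | add f g hf hg =>
    convert add_mem hf hg using 1
    simp only [map_add, add_mul, Finset.sum_add_distrib]
    ring
  | mul_X f i hf =>
    have h1 : (f - MvPolynomial.C (MvPolynomial.eval p f)) *
        (MvPolynomial.X i - MvPolynomial.C (p i)) ∈ pointIdeal p ^ 2 := by
      rw [pow_two]
      exact Ideal.mul_mem_mul (sub_eval_mem p f) (X_sub_C_mem p i)
    convert add_mem (Ideal.mul_mem_left _ (MvPolynomial.C (p i)) hf) h1 using 1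
    have h2 : ∀ n, MvPolynomial.C (MvPolynomial.eval p (dd (Pi.single n 1) (f * MvPolynomial.X i))) *
        (MvPolynomial.X n - MvPolynomial.C (p n) : CoordRing) =
        (if n = i then MvPolynomial.C (MvPolynomial.eval p f) *
          (MvPolynomial.X i - MvPolynomial.C (p i)) else 0) +
        MvPolynomial.C (p i) * (MvPolynomial.C (MvPolynomial.eval p (dd (Pi.single n 1) f)) *
        (MvPolynomial.X n - MvPolynomial.C (p n))) := by
      intro n
      rw [eval_dd_mul, dd_X, MvPolynomial.eval_C, MvPolynomial.eval_X, map_add, map_mul, map_mul]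
      by_cases h : n = i
      · subst h
        simp only [if_true, Pi.single_eq_same, map_one]
        ring
      · rw [if_neg h, Pi.single_eq_of_ne (Ne.symm h)]
        simp only [map_zero]
        ring
    simp only [h2, Finset.sum_add_distrib, Finset.sum_ite_eq', Finset.mem_univ, if_true,
      ← Finset.mul_sum, map_mul, MvPolynomial.eval_X]
    ring

/-- The local ring of the affine cone at a point. -/
abbrev PointRing (p : Fin 6 → ℂ) : Type := Localization.AtPrime (pointIdeal p)

theorem height_maximalIdeal_pointRing (p : Fin 6 → ℂ) :
    6 ≤ (IsLocalRing.maximalIdeal (PointRing p)).height := by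
  rw [← IsLocalization.height_under (pointIdeal p).primeCompl,
    IsLocalization.AtPrime.under_maximalIdeal _ (pointIdeal p)]
  exact height_pointIdeal p

variable {p : Fin 6 → ℂ} (E : LocalEquations p)

/-- Completing the three differentials to a basis of linear forms supplies the g. By Taylor
expansion, f and g generate the point ideal modulo its square; Nakayama will remove the square after
localization. -/
theorem LocalEquations.exists_generators : ∃ g : Fin 3 → CoordRing,
    pointIdeal p ≤ (Ideal.span (Set.range E.f) ⊔ Ideal.span (Set.range g)) ⊔ pointIdeal p ^ 2 ∧
    Ideal.span (Set.range E.f) ⊔ Ideal.span (Set.range g) ≤ pointIdeal p := by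
  obtain ⟨V, V', hV, -, hVθ⟩ := exists_matrix_completion (show 3 + 3 = 6 by norm_num) E.θ E.indep
  let l : Fin 3 ⊕ Fin 3 → CoordRing := fun j =>
    ∑ s, MvPolynomial.C (V s j) * (MvPolynomial.X s - MvPolynomial.C (p s))
  have hl : ∀ s, (MvPolynomial.X s - MvPolynomial.C (p s) : CoordRing) =
      ∑ j, MvPolynomial.C (V' j s) * l j := by
    intro s
    simp only [l, Finset.mul_sum]
    rw [Finset.sum_comm]
    have : ∀ s', ∑ j, MvPolynomial.C (V' j s) * (MvPolynomial.C (V s' j) *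
        (MvPolynomial.X s' - MvPolynomial.C (p s')) : CoordRing) =
        if s' = s then MvPolynomial.X s' - MvPolynomial.C (p s') else 0 := by
      intro s'
      have h1 := congrFun (congrFun hV s') s
      rw [Matrix.mul_apply, Matrix.one_apply] at h1
      calc _ = MvPolynomial.C (∑ j, V s' j * V' j s) *
            (MvPolynomial.X s' - MvPolynomial.C (p s')) := by
            rw [map_sum, Finset.sum_mul]
            refine Finset.sum_congr rfl fun j _ => ?_
            rw [map_mul]
            ring
        _ = _ := by rw [h1]; split_ifs <;> simp
    simp [this]
  refine ⟨fun b => l (Sum.inl b), ?_, ?_⟩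
  · have hgen : pointIdeal p = Ideal.span (Set.range fun s : Fin 6 =>
        (MvPolynomial.X s - MvPolynomial.C (p s) : CoordRing)) := by
      apply le_antisymm
      · intro f hf
        have h1 : ∀ f : CoordRing, f - MvPolynomial.C (MvPolynomial.eval p f) ∈
            Ideal.span (Set.range fun s : Fin 6 =>
              (MvPolynomial.X s - MvPolynomial.C (p s) : CoordRing)) := by
          intro f
          induction f using MvPolynomial.induction_on with
          | C a => simp
          | add f g hf hg =>
            convert add_mem hf hg using 1
            simp only [map_add]
            ring
          | mul_X f i hf =>
            have h2 : (MvPolynomial.X i - MvPolynomial.C (p i) : CoordRing) ∈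
              Ideal.span (Set.range fun s : Fin 6 =>
                (MvPolynomial.X s - MvPolynomial.C (p s) : CoordRing)) :=
              Ideal.subset_span ⟨i, rfl⟩
            convert add_mem (Ideal.mul_mem_left _ (MvPolynomial.C (p i)) hf)
              (Ideal.mul_mem_left _ f h2) using 1
            simp only [map_mul, MvPolynomial.eval_X]
            ring
        have := h1 f
        rw [(RingHom.mem_ker).1 hf, map_zero, sub_zero] at this
        exact this
      · rw [Ideal.span_le]
        rintro _ ⟨s, rfl⟩
        exact X_sub_C_mem p s
    conv_lhs => rw [hgen]
    rw [Ideal.span_le]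
    rintro _ ⟨s, rfl⟩
    simp only [SetLike.mem_coe]
    rw [hl]
    refine sum_mem fun j _ => Ideal.mul_mem_left _ _ ?_
    rcases j with b | a
    · exact Ideal.mem_sup_left (Ideal.mem_sup_right (Ideal.subset_span ⟨b, rfl⟩))
    · have h1 := taylor_mem p (E.f a)
      rw [E.eval_f, map_zero, sub_zero] at h1
      have h2 : l (Sum.inr a) = E.f a - (E.f a - ∑ n, MvPolynomial.C (MvPolynomial.eval p
          (dd (Pi.single n 1) (E.f a))) * (MvPolynomial.X n - MvPolynomial.C (p n))) := by
        rw [sub_sub_cancel]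
        refine Finset.sum_congr rfl fun n _ => ?_
        rw [E.eval_dd_f, hVθ]
        simp [Pi.single_apply]
      rw [h2]
      exact sub_mem (Ideal.mem_sup_left (Ideal.mem_sup_left (Ideal.subset_span ⟨a, rfl⟩)))
        (Ideal.mem_sup_right h1)
  · refine sup_le ?_ ?_ <;> rw [Ideal.span_le]
    · rintro _ ⟨a, rfl⟩
      exact E.eval_f a
    · rintro _ ⟨b, rfl⟩
      exact sum_mem fun s _ => Ideal.mul_mem_left _ _ (X_sub_C_mem p s)

/-- The ideal of the germ at `p` of the locus defined by the local equations. -/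
def LocalEquations.germ : Ideal CoordRing :=
  ((Ideal.span (Set.range E.f)).map (algebraMap CoordRing (PointRing p))).comap
    (algebraMap CoordRing (PointRing p))

/-- Three equations and three further functions generate the maximal ideal of a local ring of
dimension at least six, so the equations generate a prime ideal there. -/
theorem LocalEquations.isPrime_germ : E.germ.IsPrime := by
  obtain ⟨g, h1, h2⟩ := E.exists_generators
  have h3 : Ideal.span (Set.range (algebraMap CoordRing (PointRing p) ∘ E.f)) ⊔
      Ideal.span (Set.range (algebraMap CoordRing (PointRing p) ∘ g)) =
      IsLocalRing.maximalIdeal (PointRing p) := by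
    rw [Set.range_comp, Set.range_comp, ← Ideal.map_span, ← Ideal.map_span, ← Ideal.map_sup]
    have hm : (pointIdeal p).map (algebraMap CoordRing (PointRing p)) =
        IsLocalRing.maximalIdeal (PointRing p) := Localization.AtPrime.map_eq_maximalIdeal
    apply le_antisymm
    · rw [← hm]
      exact Ideal.map_mono h2
    · have h4 := Ideal.map_mono (f := algebraMap CoordRing (PointRing p)) h1
      rw [Ideal.map_sup, Ideal.map_pow, hm, pow_two] at h4
      exact Submodule.le_of_le_smul_of_le_jacobson_bot (IsNoetherian.noetherian _)
        (IsLocalRing.jacobson_eq_maximalIdeal _ bot_ne_top).ge h4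
  have h5 := isPrime_span_range _ _ h3 (height_maximalIdeal_pointRing p)
  rw [Set.range_comp, ← Ideal.map_span] at h5
  exact Ideal.IsPrime.comap _

theorem LocalEquations.mem_germ_iff {f : CoordRing} :
    f ∈ E.germ ↔ ∃ s ∉ pointIdeal p, s * f ∈ Ideal.span (Set.range E.f) := by
  rw [LocalEquations.germ, Ideal.mem_comap,
    IsLocalization.algebraMap_mem_map_algebraMap_iff (pointIdeal p).primeCompl]
  rfl

theorem LocalEquations.span_le_germ : Ideal.span (Set.range E.f) ≤ E.germ := Ideal.le_comap_map

theorem LocalEquations.germ_le {Q : Ideal CoordRing} (hQ : Q.IsPrime)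
    (h : Ideal.span (Set.range E.f) ≤ Q) (hQp : Q ≤ pointIdeal p) : E.germ ≤ Q := by
  intro f hf
  obtain ⟨s, hs, hsf⟩ := E.mem_germ_iff.1 hf
  exact (hQ.mem_or_mem (h hsf)).resolve_left fun h' => hs (hQp h')

theorem LocalEquations.germ_le_pointIdeal : E.germ ≤ pointIdeal p :=
  E.germ_le inferInstance (Ideal.span_le.2 (by rintro _ ⟨a, rfl⟩; exact E.eval_f a)) le_rfl

end PointLocalRing

end

end KleinEPW

namespace KleinEPW

noncomputable section

/-! ### The ideal of the singular locus of the sextic -/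

section SingularIdeal

/-- The polynomials vanishing at all nonzero singular points of the sextic. -/
def singIdeal : Ideal CoordRing := MvPolynomial.vanishingIdeal ℂ {p | p ≠ 0 ∧ IsSing p}

theorem mem_singIdeal {f : CoordRing} :
    f ∈ singIdeal ↔ ∀ p, p ≠ 0 → IsSing p → MvPolynomial.eval p f = 0 := by
  rw [singIdeal, MvPolynomial.mem_vanishingIdeal_iff]
  exact ⟨fun h p hp hs => h p ⟨hp, hs⟩, fun h p hp => h p hp.1 hp.2⟩

theorem singIdeal_le_pointIdeal {p : Fin 6 → ℂ} (hp : p ≠ 0) (hs : IsSing p) :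
    singIdeal ≤ pointIdeal p := fun _ hf => mem_singIdeal.1 hf p hp hs

theorem degeneracyIdeal_two_le_singIdeal : degeneracyIdeal kleinLagrangian 2 ≤ singIdeal :=
  fun _ hf => mem_singIdeal.2 fun _ hp hs => (degeneracyIdeal_two_le_iff hp).2 hs hf

theorem degeneracyIdeal_two_le {p : Fin 6 → ℂ} (hs : singIdeal ≤ pointIdeal p) :
    degeneracyIdeal kleinLagrangian 2 ≤ pointIdeal p := degeneracyIdeal_two_le_singIdeal.trans hs

/-- Nullstellensatz: f lies in the radical of J, hence in every prime over J. -/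
theorem mem_of_vanishing {J P : Ideal CoordRing} (hP : P.IsPrime) (hJ : J ≤ P) {f : CoordRing}
    (h : ∀ p, J ≤ pointIdeal p → MvPolynomial.eval p f = 0) : f ∈ P := by
  have h1 : f ∈ MvPolynomial.vanishingIdeal ℂ (MvPolynomial.zeroLocus ℂ J) := by
    rw [MvPolynomial.mem_vanishingIdeal_iff]
    intro p hp
    exact h p fun g hg => hp g hg
  rw [MvPolynomial.vanishingIdeal_zeroLocus_eq_radical] at h1
  exact (hP.radical_le_iff.2 hJ) h1

theorem LocalEquations.le_pointIdeal_iff {p : Fin 6 → ℂ} (E : LocalEquations p) {q : Fin 6 → ℂ}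
    (hq : MvPolynomial.eval q E.h ≠ 0) : degeneracyIdeal kleinLagrangian 2 ≤ pointIdeal q ↔
      Ideal.span (Set.range E.f) ≤ pointIdeal q := by
  rw [← map_eval_eq_bot, E.map_eq _ (isUnit_iff_ne_zero.2 hq), ← map_eval_eq_bot, Ideal.map_span,
    Set.range_comp]

variable {p : Fin 6 → ℂ} (E : LocalEquations p)

/-- Multiplying by `E.h` makes the local equations vanish at all singular points, including those
where they are not valid equations; as `E.h` is nonzero at p, it can be removed modulo P. -/
theorem LocalEquations.span_le_of_le {P : Ideal CoordRing} (hP : P.IsPrime) (hK : singIdeal ≤ P)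
    (hPp : P ≤ pointIdeal p) : Ideal.span (Set.range E.f) ≤ P := by
  rw [Ideal.span_le]
  rintro _ ⟨a, rfl⟩
  have h1 : E.h * E.f a ∈ P := by
    refine hK (mem_singIdeal.2 fun q hq hs => ?_)
    rw [map_mul]
    by_cases h : MvPolynomial.eval q E.h = 0
    · rw [h, zero_mul]
    · have := (E.le_pointIdeal_iff h).1 ((degeneracyIdeal_two_le_iff hq).2 hs)
        (Ideal.subset_span ⟨a, rfl⟩)
      rw [(RingHom.mem_ker).1 this, mul_zero]
  exact (hP.mem_or_mem h1).resolve_left fun h => E.eval_h (hPp h)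

/-- The factor xᵢ discards the origin, which `singIdeal` ignores, and `E.h` discards the points
where the local equations do not apply. Neither factor lies in the prime germ. -/
theorem LocalEquations.singIdeal_le_germ (hp : p ≠ 0) : singIdeal ≤ E.germ := by
  obtain ⟨i, hi⟩ := Function.ne_iff.1 hp
  intro f hf
  have h1 : MvPolynomial.X i * E.h * f ∈ E.germ := by
    refine mem_of_vanishing E.isPrime_germ E.span_le_germ fun q hq => ?_
    rw [map_mul, map_mul, MvPolynomial.eval_X]
    by_cases h : MvPolynomial.eval q E.h = 0
    · rw [h, mul_zero, zero_mul]
    · by_cases hqi : q i = 0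
      · rw [hqi, zero_mul, zero_mul]
      · have hq0 : q ≠ 0 := fun h0 => hqi (by rw [h0]; rfl)
        rw [mem_singIdeal.1 hf q hq0 ((degeneracyIdeal_two_le_iff hq0).1
          ((E.le_pointIdeal_iff h).2 hq)), mul_zero]
  refine (E.isPrime_germ.mem_or_mem h1).resolve_left fun h => ?_
  have h2 := E.germ_le_pointIdeal h
  rw [RingHom.mem_ker, map_mul, MvPolynomial.eval_X] at h2
  exact mul_ne_zero hi E.eval_h h2

theorem LocalEquations.eq_germ (hp : p ≠ 0) {P : Ideal CoordRing} (hP : P ∈ singIdeal.minimalPrimes)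
    (hPp : P ≤ pointIdeal p) : P = E.germ := by
  have h1 : E.germ ≤ P := E.germ_le hP.1.1 (E.span_le_of_le hP.1.1 hP.1.2 hPp) hPp
  exact le_antisymm (hP.2 ⟨E.isPrime_germ, E.singIdeal_le_germ hp⟩ h1) h1

/-- Through each nonzero singular point passes a single component of the singular locus. -/
theorem eq_of_le_pointIdeal (hp : p ≠ 0) {P P' : Ideal CoordRing} (hP : P ∈ singIdeal.minimalPrimes)
    (hP' : P' ∈ singIdeal.minimalPrimes) (hPp : P ≤ pointIdeal p) (hPp' : P' ≤ pointIdeal p) :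
    P = P' := by
  obtain ⟨E⟩ := nonempty_localEquations hp (degeneracyIdeal_two_le (hP.1.2.trans hPp))
  rw [E.eq_germ hp hP hPp, E.eq_germ hp hP' hPp']

/-! ### Homogeneity of the ideal of the singular locus and of its minimal primes. -/

theorem IsSing.smul {p : Fin 6 → ℂ} (h : IsSing p) (z : ℂ) : IsSing (z • p) := by
  obtain ⟨g0, g1, g2, g3, g4, g5⟩ := h
  have e0 : ∀ a b c d e f : ℂ, grad0 (z * a) (z * b) (z * c) (z * d) (z * e) (z * f) =
      z ^ 5 * grad0 a b c d e f := by
    intros; simp only [grad0]; ring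
  have e1 : ∀ a b c d e f : ℂ, grad1 (z * a) (z * b) (z * c) (z * d) (z * e) (z * f) =
      z ^ 5 * grad1 a b c d e f := by
    intros; simp only [grad1]; ring
  constructor <;> simp only [Pi.smul_apply, smul_eq_mul, e0, e1, g0, g1, g2, g3, g4, g5, mul_zero]

theorem eval_smul_of_isHomogeneous (p : Fin 6 → ℂ) (z : ℂ) {f : CoordRing} {n : ℕ}
    (hf : f.IsHomogeneous n) :
    MvPolynomial.eval (z • p) f = z ^ n * MvPolynomial.eval p f := by
  rw [MvPolynomial.eval_eq', MvPolynomial.eval_eq', Finset.mul_sum]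
  refine Finset.sum_congr rfl fun d hd => ?_
  have h1 := hf (MvPolynomial.mem_support_iff.1 hd)
  rw [Finsupp.weight_apply, Finsupp.sum_fintype _ _ (by simp)] at h1
  simp only [Pi.one_apply, smul_eq_mul, mul_one] at h1
  simp only [Pi.smul_apply, smul_eq_mul, mul_pow, Finset.prod_mul_distrib, Finset.prod_pow_eq_pow_sum,
    h1]
  ring

theorem coe_decompose (f : CoordRing) (k : ℕ) :
    (DirectSum.decompose grading f k : CoordRing) = MvPolynomial.homogeneousComponent k f :=
  MvPolynomial.decomposition.decompose'_apply f k

theorem eval_smul_eq_sum (p : Fin 6 → ℂ) (z : ℂ) (f : CoordRing) :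
    MvPolynomial.eval (z • p) f = ∑ k ∈ Finset.range (f.totalDegree + 1),
      z ^ k * MvPolynomial.eval p (MvPolynomial.homogeneousComponent k f) := by
  conv_lhs => rw [← MvPolynomial.sum_homogeneousComponent f]
  rw [map_sum]
  refine Finset.sum_congr rfl fun k _ => ?_
  exact eval_smul_of_isHomogeneous p z (MvPolynomial.homogeneousComponent_isHomogeneous k f)

theorem homogeneousComponent_mem_singIdeal {f : CoordRing} (hf : f ∈ singIdeal) (k : ℕ) :
    MvPolynomial.homogeneousComponent k f ∈ singIdeal := by
  refine mem_singIdeal.2 fun p hp hs => ?_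
  let P : Polynomial ℂ := ∑ k ∈ Finset.range (f.totalDegree + 1),
    Polynomial.monomial k (MvPolynomial.eval p (MvPolynomial.homogeneousComponent k f))
  have hP : P = 0 := by
    -- Only the multiples z • p with z ≠ 0 are available, since the origin is excluded from the
    -- singular set; the factor X covers z = 0.
    have h1 : Polynomial.X * P = 0 := by
      refine Polynomial.funext fun z => ?_
      rw [Polynomial.eval_mul, Polynomial.eval_X, Polynomial.eval_zero]
      by_cases hz : z = 0
      · rw [hz, zero_mul]
      · have h2 := mem_singIdeal.1 hf (z • p) (smul_ne_zero hz hp) (hs.smul z)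
        rw [eval_smul_eq_sum] at h2
        simp only [P, Polynomial.eval_finsetSum, Polynomial.eval_monomial]
        rw [mul_eq_zero]
        right
        rw [← h2]
        exact Finset.sum_congr rfl fun _ _ => mul_comm _ _
    exact (mul_eq_zero.1 h1).resolve_left Polynomial.X_ne_zero
  by_cases hk : k ∈ Finset.range (f.totalDegree + 1)
  · have h3 := congrArg (fun Q => Polynomial.coeff Q k) hP
    simpa [P, Polynomial.finsetSum_coeff, Polynomial.coeff_monomial, hk] using h3
  · rw [MvPolynomial.homogeneousComponent_eq_zero _ _ (by
      rw [Finset.mem_range] at hk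
      omega), map_zero]

theorem isHomogeneous_singIdeal : singIdeal.IsHomogeneous grading := by
  intro k f hf
  rw [coe_decompose]
  exact homogeneousComponent_mem_singIdeal hf k

theorem isHomogeneous_of_mem_minimalPrimes {P : Ideal CoordRing}
    (hP : P ∈ singIdeal.minimalPrimes) : P.IsHomogeneous grading := by
  have h1 : P ≤ (P.homogeneousCore grading).toIdeal := by
    refine hP.2 ⟨hP.1.1.homogeneousCore, ?_⟩ (Ideal.toIdeal_homogeneousCore_le grading P)
    rw [← isHomogeneous_singIdeal.toIdeal_homogeneousCore_eq_self]
    exact Ideal.homogeneousCore_mono grading hP.1.2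
  rw [le_antisymm h1 (Ideal.toIdeal_homogeneousCore_le grading P)]
  exact HomogeneousIdeal.isHomogeneous _

end SingularIdeal

end

end KleinEPW

namespace KleinEPW

noncomputable section

/-! ### Linear sections of the components of the singular locus -/

section Sections

theorem exists_pow_sub_mem {P : Ideal CoordRing} (hP : P.IsHomogeneous grading) {i j k : Fin 6}
    {N : ℕ} (h : (MvPolynomial.X j : CoordRing) ^ (N + 1) ∈
      P ⊔ Ideal.span {MvPolynomial.X k, MvPolynomial.X i}) :
    ∃ u v : CoordRing, u.totalDegree ≤ N ∧ v.totalDegree ≤ N ∧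
      MvPolynomial.X j ^ (N + 1) - (MvPolynomial.X k * u + MvPolynomial.X i * v) ∈ P := by
  obtain ⟨q, hq, r, hr, hqr⟩ := Submodule.mem_sup.1 h
  obtain ⟨u, v, rfl⟩ := Ideal.mem_span_pair.1 hr
  have hmul : ∀ (w : CoordRing) (l : Fin 6), MvPolynomial.homogeneousComponent (N + 1)
      (w * MvPolynomial.X l) = MvPolynomial.homogeneousComponent N w * MvPolynomial.X l := by
    intro w l
    have := DirectSum.coe_decompose_mul_add_of_right_mem grading (i := N) (a := w)
      (X_mem_grading l)
    rwa [coe_decompose, coe_decompose] at this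
  refine ⟨MvPolynomial.homogeneousComponent N u, MvPolynomial.homogeneousComponent N v,
    (MvPolynomial.homogeneousComponent_isHomogeneous N u).totalDegree_le,
    (MvPolynomial.homogeneousComponent_isHomogeneous N v).totalDegree_le, ?_⟩
  have h1 : MvPolynomial.homogeneousComponent (N + 1) q ∈ P := by
    rw [← coe_decompose]
    exact hP (N + 1) hq
  have h2 := congrArg (MvPolynomial.homogeneousComponent (N + 1)) hqr
  rw [map_add, map_add, hmul, hmul, MvPolynomial.homogeneousComponent_of_mem
    (((MvPolynomial.isHomogeneous_X ℂ j).pow (N + 1))), if_pos (by simp)] at h2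
  have h3 : MvPolynomial.X j ^ (N + 1) - (MvPolynomial.X k * MvPolynomial.homogeneousComponent N u +
      MvPolynomial.X i * MvPolynomial.homogeneousComponent N v) =
      MvPolynomial.homogeneousComponent (N + 1) q := by
    rw [← h2]; ring
  rw [h3]
  exact h1

/-- Replacing Xⱼ^(N+1) by a polynomial of degree at most N lowers the total degree, so the monomials
with all exponents at most N span the quotient. -/
theorem finite_quotient {Q : Ideal CoordRing} {N : ℕ} (h : ∀ j : Fin 6, ∃ u : CoordRing,
    u.totalDegree ≤ N ∧ MvPolynomial.X j ^ (N + 1) - u ∈ Q) : Module.Finite ℂ (CoordRing ⧸ Q) := by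
  let S : Set (Fin 6 →₀ ℕ) := {d | ∀ j, d j ≤ N}
  have hS : S.Finite := by
    refine (Set.finite_Iic (Finsupp.equivFunOnFinite.symm fun _ : Fin 6 => N)).subset ?_
    intro d hd j
    simpa using hd j
  let M : Submodule ℂ (CoordRing ⧸ Q) := Submodule.span ℂ
    ((fun d => Ideal.Quotient.mk Q (MvPolynomial.monomial d 1)) '' S)
  have key : ∀ n, ∀ f : CoordRing, f.totalDegree < n → Ideal.Quotient.mk Q f ∈ M := by
    intro n
    induction n with
    | zero => intro f hf; omega
    | succ n ih =>
      intro f hf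
      have hmon : ∀ d : Fin 6 →₀ ℕ, d.degree ≤ n →
          Ideal.Quotient.mk Q (MvPolynomial.monomial d 1) ∈ M := by
        intro d hd
        by_cases hdS : d ∈ S
        · exact Submodule.subset_span ⟨d, hdS, rfl⟩
        · obtain ⟨j, hj⟩ : ∃ j, N + 1 ≤ d j := by
            simp only [S, Set.mem_ofPred_eq, not_forall, not_le] at hdS
            exact hdS
          obtain ⟨u, hu, huQ⟩ := h j
          have h1 : Finsupp.single j (N + 1) + (d - Finsupp.single j (N + 1)) = d :=
            add_tsub_cancel_of_le (by rwa [Finsupp.single_le_iff])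
          have h2 : (MvPolynomial.monomial d 1 : CoordRing) = MvPolynomial.X j ^ (N + 1) *
              MvPolynomial.monomial (d - Finsupp.single j (N + 1)) 1 := by
            rw [MvPolynomial.X_pow_eq_monomial, MvPolynomial.monomial_mul, h1, mul_one]
          have h3 : Ideal.Quotient.mk Q (MvPolynomial.monomial d 1) = Ideal.Quotient.mk Q
              (u * MvPolynomial.monomial (d - Finsupp.single j (N + 1)) 1) := by
            rw [h2, Ideal.Quotient.eq, ← sub_mul]
            exact Ideal.mul_mem_right _ _ huQ
          rw [h3]
          refine ih _ ?_
          have h4 : (N + 1) + (d - Finsupp.single j (N + 1)).degree = d.degree := by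
            conv_rhs => rw [← h1, map_add, Finsupp.degree_single]
          have h5 := MvPolynomial.totalDegree_mul u
            (MvPolynomial.monomial (d - Finsupp.single j (N + 1)) (1 : ℂ))
          rw [MvPolynomial.totalDegree_monomial _ one_ne_zero] at h5
          change _ ≤ _ + (d - Finsupp.single j (N + 1)).degree at h5
          omega
      rw [f.as_sum, map_sum]
      refine sum_mem fun d hd => ?_
      have h6 : (MvPolynomial.monomial d (f.coeff d) : CoordRing) =
          f.coeff d • MvPolynomial.monomial d 1 := by
        rw [MvPolynomial.smul_monomial, smul_eq_mul, mul_one]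
      have h7 : Ideal.Quotient.mk Q (f.coeff d • MvPolynomial.monomial d 1) =
          f.coeff d • Ideal.Quotient.mk Q (MvPolynomial.monomial d 1) := rfl
      rw [h6, h7]
      refine M.smul_mem _ (hmon d ?_)
      have := MvPolynomial.le_totalDegree hd
      change d.degree ≤ _ at this
      omega
  refine ⟨⟨(hS.image fun d => Ideal.Quotient.mk Q (MvPolynomial.monomial d 1)).toFinset, ?_⟩⟩
  rw [Set.Finite.coe_toFinset, eq_top_iff]
  rintro x -
  obtain ⟨f, rfl⟩ := Ideal.Quotient.mk_surjective x
  exact key _ f (Nat.lt_succ_self _)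

/-- A component of the singular locus meets each linear subspace `x₀ = xᵢ = 0`. -/
theorem exists_section {P : Ideal CoordRing} (hP : P ∈ singIdeal.minimalPrimes) {p : Fin 6 → ℂ}
    (hp : p ≠ 0) (hPp : P ≤ pointIdeal p) (i : Fin 6) :
    ∃ q, q ≠ 0 ∧ P ≤ pointIdeal q ∧ q 0 = 0 ∧ q i = 0 := by
  by_contra! hcon
  have h1 : ∀ j : Fin 6, ∃ N, (MvPolynomial.X j : CoordRing) ^ N ∈
      P ⊔ Ideal.span {MvPolynomial.X 0, MvPolynomial.X i} := by
    intro j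
    have : (MvPolynomial.X j : CoordRing) ∈
        (P ⊔ Ideal.span {MvPolynomial.X 0, MvPolynomial.X i}).radical := by
      rw [← MvPolynomial.vanishingIdeal_zeroLocus_eq_radical (K := ℂ),
        MvPolynomial.mem_vanishingIdeal_iff]
      intro q hq
      rw [MvPolynomial.aeval_X]
      have e0 : q 0 = 0 := by
        simpa using hq (MvPolynomial.X 0)
          (Ideal.mem_sup_right (Ideal.subset_span (Set.mem_insert _ _)))
      have e1 : q i = 0 := by
        simpa using hq (MvPolynomial.X i)
          (Ideal.mem_sup_right (Ideal.subset_span (Set.mem_insert_of_mem _ rfl)))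
      by_contra hqj
      exact hcon q (fun h => hqj (by rw [h]; rfl))
        (fun f hf => hq f (Ideal.mem_sup_left hf)) e0 e1
    exact this
  choose Nf hNf using h1
  obtain ⟨N, hN⟩ : ∃ N, ∀ j, Nf j ≤ N + 1 :=
    ⟨Finset.univ.sup Nf, fun j => (Finset.le_sup (Finset.mem_univ j)).trans (Nat.le_succ _)⟩
  have h2 : ∀ j : Fin 6, (MvPolynomial.X j : CoordRing) ^ (N + 1) ∈
      P ⊔ Ideal.span {MvPolynomial.X 0, MvPolynomial.X i} :=
    fun j => Ideal.pow_mem_of_pow_mem _ (hNf j) (hN j)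
  obtain ⟨E⟩ := nonempty_localEquations hp (degeneracyIdeal_two_le (hP.1.2.trans hPp))
  -- Three local equations of the component and two equations of the affine slice through p on which
  -- x₀ and xᵢ are constant. By Krull, a minimal prime over five elements has height at most five,
  -- so it is not the ideal of p.
  let s : Set CoordRing := Set.range E.f ∪ {MvPolynomial.X 0 - MvPolynomial.C (p 0),
    MvPolynomial.X i - MvPolynomial.C (p i)}
  have hs : s.Finite := (Set.finite_range _).union ((Set.finite_singleton _).insert _)
  have hsc : s.ncard ≤ 5 := by
    refine (Set.ncard_union_le _ _).trans ?_
    have e1 : (Set.range E.f).ncard ≤ 3 := by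
      rw [← Set.image_univ]
      exact (Set.ncard_image_le Set.finite_univ).trans (by simp [Set.ncard_univ])
    have e2 := Set.ncard_insert_le (MvPolynomial.X 0 - MvPolynomial.C (p 0) : CoordRing)
      {MvPolynomial.X i - MvPolynomial.C (p i)}
    rw [Set.ncard_singleton] at e2
    omega
  have hsp : Ideal.span s ≤ pointIdeal p := by
    rw [Ideal.span_le, Set.union_subset_iff]
    constructor
    · rintro _ ⟨a, rfl⟩; exact E.eval_f a
    · rintro _ (rfl | rfl) <;> exact X_sub_C_mem p _
  obtain ⟨Q, hQ, hQp⟩ := Ideal.exists_minimalPrimes_le hsp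
  have hQprime : Q.IsPrime := hQ.1.1
  have hne : Q ≠ pointIdeal p := by
    rintro rfl
    have e1 := (height_pointIdeal p).trans (Ideal.height_le_card_of_mem_minimalPrimes_span hs hQ)
    have e2 : 6 ≤ s.ncard := by exact_mod_cast e1
    omega
  have hPQ : P ≤ Q := by
    rw [E.eq_germ hp hP hPp]
    exact E.germ_le hQprime ((Ideal.span_mono Set.subset_union_left).trans hQ.1.2) hQp
  have m0 : (MvPolynomial.X 0 - MvPolynomial.C (p 0) : CoordRing) ∈ Q :=
    hQ.1.2 (Ideal.subset_span (Or.inr (Set.mem_insert _ _)))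
  have m1 : (MvPolynomial.X i - MvPolynomial.C (p i) : CoordRing) ∈ Q :=
    hQ.1.2 (Ideal.subset_span (Or.inr (Set.mem_insert_of_mem _ rfl)))
  -- An empty section gives Xⱼ^(N+1) ≡ x₀u + xᵢv modulo P with u and v of degree at most N. On the
  -- slice x₀ and xᵢ are constants, so the right-hand side has smaller degree and the quotient by Q
  -- is finite over ℂ. Then Q is maximal, a contradiction.
  have hfin : Module.Finite ℂ (CoordRing ⧸ Q) := by
    refine finite_quotient (N := N) fun j => ?_
    obtain ⟨u, v, hu, hv, huv⟩ := exists_pow_sub_mem (isHomogeneous_of_mem_minimalPrimes hP) (h2 j)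
    refine ⟨MvPolynomial.C (p 0) * u + MvPolynomial.C (p i) * v, ?_, ?_⟩
    · refine (MvPolynomial.totalDegree_add _ _).trans (max_le ?_ ?_)
      · exact (MvPolynomial.totalDegree_mul _ _).trans (by simpa using hu)
      · exact (MvPolynomial.totalDegree_mul _ _).trans (by simpa using hv)
    · have : MvPolynomial.X j ^ (N + 1) - (MvPolynomial.C (p 0) * u + MvPolynomial.C (p i) * v) =
          (MvPolynomial.X j ^ (N + 1) - (MvPolynomial.X 0 * u + MvPolynomial.X i * v)) +
          ((MvPolynomial.X 0 - MvPolynomial.C (p 0)) * u +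
            (MvPolynomial.X i - MvPolynomial.C (p i)) * v) := by ring
      rw [this]
      exact add_mem (hPQ huv) (add_mem (Ideal.mul_mem_right _ _ m0) (Ideal.mul_mem_right _ _ m1))
  have hfield : IsField (CoordRing ⧸ Q) :=
    isField_of_isIntegral_of_isField' (R := ℂ) (Field.toIsField ℂ)
  exact hne ((Ideal.Quotient.maximal_of_isField Q hfield).eq_of_le
    (Ideal.IsPrime.ne_top inferInstance) hQp)

end Sections

/-! ### Irreducibility of the singular locus -/

section Irreducibility

/-- The cyclic permutation of the last five coordinates. -/
def cyc : Equiv.Perm (Fin 6) where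
  toFun := ![0, 2, 3, 4, 5, 1]
  invFun := ![0, 5, 1, 2, 3, 4]
  left_inv := by decide
  right_inv := by decide

theorem IsSing.comp_cyc {p : Fin 6 → ℂ} (h : IsSing p) : IsSing (p ∘ cyc) := by
  obtain ⟨g0, g1, g2, g3, g4, g5⟩ := h
  refine ⟨?_, g2, g3, g4, g5, g1⟩
  rw [← g0]
  simp only [grad0, Function.comp_apply, cyc, Equiv.coe_fn_mk, Matrix.cons_val_zero,
    Matrix.cons_val_one, Matrix.cons_val]
  ring

theorem isSing_comp_cyc_iff {p : Fin 6 → ℂ} : IsSing (p ∘ cyc) ↔ IsSing p := by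
  refine ⟨fun h => ?_, IsSing.comp_cyc⟩
  have h1 := h.comp_cyc.comp_cyc.comp_cyc.comp_cyc
  convert h1 using 1
  funext i
  fin_cases i <;> rfl

theorem comap_rename_singIdeal :
    singIdeal.comap (MvPolynomial.rename (R := ℂ) cyc) = singIdeal := by
  ext f
  rw [Ideal.mem_comap, mem_singIdeal, mem_singIdeal]
  simp only [MvPolynomial.eval_rename]
  constructor
  · intro h p hp hs
    have h1 : (p ∘ cyc.symm) ∘ cyc = p := by funext i; simp
    have h2 := h (p ∘ cyc.symm) (fun h0 => hp ?_) (isSing_comp_cyc_iff.1 (by rwa [h1]))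
    · rwa [h1] at h2
    · rw [← h1, h0]; rfl
  · intro h p hp hs
    refine h _ (fun h0 => hp ?_) hs.comp_cyc
    funext i
    simpa using congrFun h0 (cyc.symm i)

theorem comap_rename_le_iff {P : Ideal CoordRing} {q : Fin 6 → ℂ} :
    P.comap (MvPolynomial.rename (R := ℂ) cyc) ≤ pointIdeal (q ∘ cyc) ↔ P ≤ pointIdeal q := by
  constructor
  · intro h f hf
    obtain ⟨g, rfl⟩ := MvPolynomial.rename_surjective cyc cyc.surjective f
    have : MvPolynomial.eval (q ∘ cyc) g = 0 := h (Ideal.mem_comap.2 hf)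
    rw [RingHom.mem_ker, MvPolynomial.eval_rename]
    exact this
  · intro h f hf
    have h1 : MvPolynomial.eval q (MvPolynomial.rename cyc f) = 0 := h (Ideal.mem_comap.1 hf)
    rwa [MvPolynomial.eval_rename] at h1

/-- The coordinate points. -/
abbrev basisPoint (j : Fin 6) : Fin 6 → ℂ := Pi.single j 1

theorem basisPoint_ne_zero (j : Fin 6) : basisPoint j ≠ 0 := by
  intro h
  have := congrFun h j
  simp at this

theorem basisPoint_comp_cyc (j : Fin 6) : basisPoint (cyc j) ∘ cyc = basisPoint j := by
  funext i
  simp [Pi.single_apply]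

/-- Every component of the singular locus through the `j`-th coordinate point passes through the
`k`-th one. -/
def Joined (j k : Fin 6) : Prop :=
  ∀ P ∈ singIdeal.minimalPrimes, P ≤ pointIdeal (basisPoint j) → P ≤ pointIdeal (basisPoint k)

theorem Joined.trans {j k l : Fin 6} (h : Joined j k) (h' : Joined k l) : Joined j l :=
  fun P hP hj => h' P hP (h P hP hj)

theorem exists_minimalPrime_le {p : Fin 6 → ℂ} (hp : p ≠ 0) (hs : IsSing p) :
    ∃ P ∈ singIdeal.minimalPrimes, P ≤ pointIdeal p :=
  Ideal.exists_minimalPrimes_le (singIdeal_le_pointIdeal hp hs)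

/-- The component through the j-th point also passes through the k-th, where it is the only one. The
assumption j ≠ 0 ensures that the j-th point is singular. -/
theorem Joined.symm {j k : Fin 6} (hj : j ≠ 0) (h : Joined j k) : Joined k j := by
  intro P hP hk
  obtain ⟨P', hP', hj'⟩ := exists_minimalPrime_le (basisPoint_ne_zero j) (isSing_single hj 1)
  rwa [eq_of_le_pointIdeal (basisPoint_ne_zero k) hP hP' hk (h P' hP' hj')]

theorem Joined.cyc {j k : Fin 6} (h : Joined j k) : Joined (cyc j) (cyc k) := by
  intro P hP hj
  rw [← comap_rename_le_iff, basisPoint_comp_cyc] at hj ⊢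
  refine h _ ?_ hj
  have := Ideal.minimalPrimes_comap_of_surjective
    (f := (MvPolynomial.rename (R := ℂ) KleinEPW.cyc : CoordRing →+* CoordRing))
    (MvPolynomial.rename_surjective KleinEPW.cyc KleinEPW.cyc.surjective) hP
  have h2 : singIdeal.comap (MvPolynomial.rename (R := ℂ) KleinEPW.cyc :
    CoordRing →+* CoordRing) = singIdeal := comap_rename_singIdeal
  rwa [h2] at this

theorem le_pointIdeal_smul {P : Ideal CoordRing} (hP : P.IsHomogeneous grading) {q : Fin 6 → ℂ}
    (hq : P ≤ pointIdeal q) (z : ℂ) : P ≤ pointIdeal (z • q) := by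
  intro f hf
  rw [RingHom.mem_ker, eval_smul_eq_sum]
  refine Finset.sum_eq_zero fun k _ => ?_
  have h1 : MvPolynomial.homogeneousComponent k f ∈ P := by
    rw [← coe_decompose]; exact hP k hf
  rw [(RingHom.mem_ker).1 (hq h1), mul_zero]

/-- A point of the component on the section x₀ = xᵢ = 0 is a multiple of a coordinate point, and
homogeneity lets it be rescaled. -/
theorem exists_basisPoint {P : Ideal CoordRing} (hP : P ∈ singIdeal.minimalPrimes)
    {p : Fin 6 → ℂ} (hp : p ≠ 0) (hPp : P ≤ pointIdeal p) {i : Fin 6} (hi : i ≠ 0) :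
    ∃ k, k ≠ 0 ∧ k ≠ i ∧ P ≤ pointIdeal (basisPoint k) := by
  obtain ⟨q, hq, hPq, h0, hqi⟩ := exists_section hP hp hPp i
  have hs : IsSing q := (degeneracyIdeal_two_le_iff hq).1 (degeneracyIdeal_two_le (hP.1.2.trans hPq))
  have hmul := hs.mul_eq_zero h0 hi hqi
  obtain ⟨k, hk⟩ := Function.ne_iff.1 hq
  refine ⟨k, fun h => hk (by rw [h]; exact h0), fun h => hk (by rw [h]; exact hqi), ?_⟩
  have h1 : basisPoint k = (q k)⁻¹ • q := by
    funext l
    by_cases hl : l = k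
    · subst hl
      simp [inv_mul_cancel₀ hk]
    · have := (mul_eq_zero.1 (hmul k l (Ne.symm hl))).resolve_left hk
      simp [Pi.single_eq_of_ne hl, this]
  rw [h1]
  exact le_pointIdeal_smul (isHomogeneous_of_mem_minimalPrimes hP) hPq _

/-- The section x₀ = x₁ = 0 gives one link from 1 to some k ≠ 1. Its cyclic rotations reach all five
points because any nonzero step generates ℤ/5. -/
theorem joined_one {j : Fin 6} (hj : j ≠ 0) : Joined 1 j := by
  obtain ⟨P, hP, hP1⟩ := exists_minimalPrime_le (basisPoint_ne_zero 1)
    (isSing_single (j := 1) (by decide) 1)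
  obtain ⟨k, hk0, hk1, hPk⟩ := exists_basisPoint hP (basisPoint_ne_zero 1) hP1
    (i := 1) (by decide)
  have h1 : Joined 1 k := fun P' hP' hP1' => by
    rwa [eq_of_le_pointIdeal (basisPoint_ne_zero 1) hP' hP hP1' hP1]
  have h2 := h1.cyc
  have h3 := h2.cyc
  have h4 := h3.cyc
  have h5 := h4.cyc
  have h0 : Joined 1 1 := fun _ _ h => h
  have key : Joined 1 2 ∧ Joined 1 3 ∧ Joined 1 4 ∧ Joined 1 5 := by
    fin_cases k
    · exact absurd rfl hk0
    · exact absurd rfl hk1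
    · exact ⟨h1, h1.trans h2, (h1.trans h2).trans h3, ((h1.trans h2).trans h3).trans h4⟩
    · exact ⟨(h1.trans h3).trans h5, h1, ((h1.trans h3).trans h5).trans h2, h1.trans h3⟩
    · exact ⟨h1.trans h4, ((h1.trans h4).trans h2).trans h5, h1, (h1.trans h4).trans h2⟩
    · exact ⟨((h1.trans h5).trans h4).trans h3, (h1.trans h5).trans h4, h1.trans h5, h1⟩
  fin_cases j
  exacts [absurd rfl hj, h0, key.1, key.2.1, key.2.2.1, key.2.2.2]

/-- The singular locus of the sextic is irreducible. -/
theorem isPrime_singIdeal : singIdeal.IsPrime := by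
  obtain ⟨P, hP, hP1⟩ := exists_minimalPrime_le (basisPoint_ne_zero 1)
    (isSing_single (j := 1) (by decide) 1)
  have huniq : ∀ P' ∈ singIdeal.minimalPrimes, P' = P := by
    intro P' hP'
    by_cases h : ∃ p, p ≠ 0 ∧ P' ≤ pointIdeal p
    · obtain ⟨p, hp, hPp⟩ := h
      obtain ⟨k, hk, -, hPk⟩ := exists_basisPoint hP' hp hPp (i := 1) (by decide)
      exact eq_of_le_pointIdeal (basisPoint_ne_zero 1) hP' hP
        ((joined_one hk).symm (by decide) P' hP' hPk) hP1
    -- A minimal prime with no zero away from the origin contains the homogeneous ideal P, which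
    -- vanishes at the origin, so minimality makes them equal.
    · have h0 : P ≤ P' := by
        intro f hf
        refine mem_of_vanishing hP'.1.1 le_rfl fun q hq => ?_
        have hq0 : q = 0 := by
          by_contra hq0
          exact h ⟨q, hq0, hq⟩
        have := le_pointIdeal_smul (isHomogeneous_of_mem_minimalPrimes hP) hP1 0 hf
        rw [zero_smul] at this
        rw [hq0]
        exact this
      exact le_antisymm (hP'.2 hP.1 h0) h0
  have hle : P ≤ singIdeal := fun f hf => mem_singIdeal.2 fun p hp hs => by
    obtain ⟨P', hP', hPp'⟩ := exists_minimalPrime_le hp hs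
    rw [huniq P' hP'] at hPp'
    exact hPp' hf
  rw [le_antisymm hP.1.2 hle]
  exact hP.1.1

end Irreducibility

end

end KleinEPW

namespace KleinEPW

noncomputable section

/-! ### Charts of the closed subschemes of projective space -/

section Charts

/-- Stated for an arbitrary W equal to ⊤, so that substituting the equality removes the transport of
sections. -/
theorem exists_SpecMap_app_eq {R S : CommRingCat} (φ : R ⟶ S) {W : (Spec R).Opens} (hW : W = ⊤) :
    ∃ g : S ⟶ Γ(Spec S, Spec.map φ ⁻¹ᵁ W), IsIso g ∧
      ((Scheme.ΓSpecIso R).inv ≫ (Spec R).presheaf.map (eqToHom hW).op) ≫ (Spec.map φ).app W =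
        φ ≫ g := by
  subst hW
  refine ⟨(Scheme.ΓSpecIso S).inv, (Scheme.ΓSpecIso S).isIso_inv, ?_⟩
  rw [eqToHom_refl, op_id, CategoryTheory.Functor.map_id, Category.comp_id]
  exact (Scheme.ΓSpecIso_inv_naturality φ).symm

theorem ker_app_SpecMap_fromSpec {X : Scheme} {U : X.Opens} (hU : IsAffineOpen U) {R : CommRingCat}
    (φ : Γ(X, U) ⟶ R) :
    RingHom.ker ((Spec.map φ ≫ hU.fromSpec).app U).hom = RingHom.ker φ.hom := by
  obtain ⟨g, hg, h⟩ := exists_SpecMap_app_eq φ hU.fromSpec_preimage_self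
  rw [Scheme.Hom.comp_app, hU.fromSpec_app_self]
  ext x
  rw [RingHom.mem_ker, RingHom.mem_ker]
  have h2 := congrArg (fun f => f.hom x) h
  refine (Eq.congr h2 rfl).trans ?_
  have : Function.Injective g.hom := (ConcreteCategory.bijective_of_isIso g).1
  exact map_eq_zero_iff _ this

theorem app_eq_zero_of_restrict {X Y : Scheme} (f : X ⟶ Y) {U W : Y.Opens} (hWU : W ≤ U)
    (h : f ⁻¹ᵁ U ≤ f ⁻¹ᵁ W) (s : Γ(Y, U))
    (hs : f.app W (Y.presheaf.map (homOfLE hWU).op s) = 0) : f.app U s = 0 := by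
  have he : f ⁻¹ᵁ W = f ⁻¹ᵁ U := le_antisymm (f.preimage_mono hWU) h
  have h1 := congrArg (fun g => g s) (f.naturality (homOfLE hWU).op)
  have h2 : X.presheaf.map (homOfLE (f.preimage_mono hWU)).op (f.app U s) = 0 := by
    rw [← hs]
    exact h1.symm
  have h3 : Function.Injective (X.presheaf.map (homOfLE (f.preimage_mono hWU)).op) := by
    have : IsIso (X.presheaf.map (homOfLE (f.preimage_mono hWU)).op) := by
      rw [show homOfLE (f.preimage_mono hWU) = eqToHom he from rfl]
      infer_instance
    exact (ConcreteCategory.bijective_of_isIso _).1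
  exact (map_eq_zero_iff _ h3).1 h2

/-- The standard affine open `xᵢ ≠ 0`. -/
abbrev chartOpen (i : Fin 6) : P5.affineOpens :=
  ⟨Proj.basicOpen grading (MvPolynomial.X i), Proj.isAffineOpen_basicOpen grading _
    (X_mem_grading i) Nat.one_pos⟩

/-- The coordinate ring of the chart `xᵢ ≠ 0`. -/
abbrev ChartRing (i : Fin 6) : Type :=
  HomogeneousLocalization.Away grading (MvPolynomial.X i : CoordRing)

/-- The identification of the coordinate ring of a chart with the ring of sections. -/
def chartIso (i : Fin 6) : CommRingCat.of (ChartRing i) ≅ Γ(P5, (chartOpen i).1) :=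
  Proj.basicOpenIsoAway grading (MvPolynomial.X i) (X_mem_grading i) Nat.one_pos

theorem isAffineOpen_chartOpen (i : Fin 6) : IsAffineOpen (chartOpen i).1 :=
  (chartOpen i).2

theorem SpecMap_chartIso_hom (i : Fin 6) : Spec.map (chartIso i).hom ≫
    Proj.awayι grading (MvPolynomial.X i) (X_mem_grading i) Nat.one_pos =
      (isAffineOpen_chartOpen i).fromSpec := by
  rw [← (isAffineOpen_chartOpen i).isoSpec_inv_ι, Proj.awayι, ← Category.assoc]
  change (Spec.map (chartIso i).hom ≫ (Proj.basicOpenIsoSpec grading _ (X_mem_grading i)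
    Nat.one_pos).inv) ≫ (chartOpen i).1.ι = _
  congr 1
  rw [Iso.comp_inv_eq, Iso.eq_inv_comp, IsAffineOpen.isoSpec_hom]
  rfl

theorem awayι_eq (i : Fin 6) :
    Proj.awayι grading (MvPolynomial.X i) (X_mem_grading i) Nat.one_pos =
      Spec.map (chartIso i).inv ≫ (isAffineOpen_chartOpen i).fromSpec := by
  rw [← SpecMap_chartIso_hom, ← Category.assoc, ← Spec.map_comp, Iso.hom_inv_id, Spec.map_id,
    Category.id_comp]

theorem ker_chartMap_ideal (I : Ideal CoordRing) (i : Fin 6) (a : ChartRing i) :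
    (chartIso i).hom a ∈ (chartMap I i).ker.ideal (chartOpen i) ↔ a ∈ chartIdeal I i := by
  have h1 : chartMap I i = Spec.map ((chartIso i).inv ≫
      CommRingCat.ofHom (Ideal.Quotient.mk (chartIdeal I i))) ≫
        (isAffineOpen_chartOpen i).fromSpec := by
    rw [chartMap, awayι_eq, Spec.map_comp, Category.assoc]
  rw [Scheme.Hom.ker_apply, h1, ker_app_SpecMap_fromSpec, RingHom.mem_ker, CommRingCat.hom_comp,
    RingHom.comp_apply, CommRingCat.hom_ofHom]
  rw [show (CommRingCat.Hom.hom (chartIso i).inv) ((chartIso i).hom a) = a from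
    (chartIso i).hom_inv_id_apply a, Ideal.Quotient.eq_zero_iff_mem]

theorem preimage_chartOpen_eq_top (I : Ideal CoordRing) (j : Fin 6) :
    (chartMap I j) ⁻¹ᵁ (chartOpen j).1 = ⊤ := by
  rw [eq_top_iff]
  rintro x -
  have h1 : (Proj.awayι grading (MvPolynomial.X j) (X_mem_grading j) Nat.one_pos).opensRange =
      (chartOpen j).1 := Proj.opensRange_awayι _ _ _ _
  change chartMap I j x ∈ (chartOpen j).1
  rw [← h1, chartMap]
  simp only [Scheme.Hom.comp_base, TopCat.comp_app]
  exact ⟨_, rfl⟩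

theorem exists_mk_of_mem_chartIdeal {I : Ideal CoordRing} {i : Fin 6} {a : ChartRing i}
    (ha : a ∈ chartIdeal I i) : ∃ (n : ℕ) (b : CoordRing) (hb : b ∈ grading (n • 1)) (_ : b ∈ I),
      a = HomogeneousLocalization.Away.mk grading (X_mem_grading i) n b hb := by
  obtain ⟨m, c, hc, rfl⟩ := HomogeneousLocalization.Away.mk_surjective grading
    (X_mem_grading i) a
  rw [chartIdeal, Ideal.mem_comap, HomogeneousLocalization.algebraMap_apply,
    HomogeneousLocalization.Away.val_mk, Localization.mk_eq_mk',
    IsLocalization.mk'_mem_map_algebraMap_iff] at ha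
  obtain ⟨_, ⟨k, rfl⟩, hk⟩ := ha
  refine ⟨k + m, MvPolynomial.X i ^ k * c, ?_, hk, ?_⟩
  · rw [add_smul]
    exact SetLike.mul_mem_graded (SetLike.pow_mem_graded k (X_mem_grading i)) hc
  · rw [HomogeneousLocalization.ext_iff_val, HomogeneousLocalization.Away.val_mk,
      HomogeneousLocalization.Away.val_mk, Localization.mk_eq_mk_iff, Localization.r_iff_exists]
    exact ⟨1, by simp; ring⟩

theorem mk_mem_chartIdeal {I : Ideal CoordRing} (i : Fin 6) {n : ℕ} {b : CoordRing}
    (hb : b ∈ grading (n • 1)) (hI : b ∈ I) :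
    HomogeneousLocalization.Away.mk grading (X_mem_grading i) n b hb ∈ chartIdeal I i := by
  rw [chartIdeal, Ideal.mem_comap, HomogeneousLocalization.algebraMap_apply,
    HomogeneousLocalization.Away.val_mk, Localization.mk_eq_mk',
    IsLocalization.mk'_mem_map_algebraMap_iff]
  exact ⟨1, one_mem _, by simpa using hI⟩

/-- The affine open `xᵢxⱼ ≠ 0`. -/
abbrev overlap (i j : Fin 6) : P5.affineOpens :=
  ⟨Proj.basicOpen grading (MvPolynomial.X i * MvPolynomial.X j), Proj.isAffineOpen_basicOpen
    grading _ (SetLike.mul_mem_graded (X_mem_grading i) (X_mem_grading j)) Nat.two_pos⟩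

theorem overlap_le_left (i j : Fin 6) : (overlap i j).1 ≤ (chartOpen i).1 :=
  Proj.basicOpen_mono _ _ _ ⟨_, rfl⟩

theorem overlap_le_right (i j : Fin 6) : (overlap i j).1 ≤ (chartOpen j).1 :=
  Proj.basicOpen_mono _ _ _ ⟨_, mul_comm _ _⟩

theorem map_chartIso_left (i j : Fin 6) (a : ChartRing i) :
    P5.presheaf.map (homOfLE (overlap_le_left i j)).op ((chartIso i).hom a) =
      Proj.awayToSection grading (MvPolynomial.X i * MvPolynomial.X j)
        (HomogeneousLocalization.awayMap grading (X_mem_grading j) rfl a) :=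
  (congrArg (fun f => f.hom a) (Proj.awayMap_awayToSection grading (X_mem_grading j)
    (rfl : (MvPolynomial.X i * MvPolynomial.X j : CoordRing) = _))).symm

theorem map_chartIso_right (i j : Fin 6) (a : ChartRing j) :
    P5.presheaf.map (homOfLE (overlap_le_right i j)).op ((chartIso j).hom a) =
      Proj.awayToSection grading (MvPolynomial.X i * MvPolynomial.X j)
        (HomogeneousLocalization.awayMap grading (X_mem_grading i) (mul_comm _ _) a) :=
  (congrArg (fun f => f.hom a) (Proj.awayMap_awayToSection grading (X_mem_grading i)
    (mul_comm _ _ : (MvPolynomial.X i * MvPolynomial.X j : CoordRing) = _))).symm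

/-- An element b / xᵢⁿ with b ∈ I equals (xⱼ/xᵢ)ⁿ · b/xⱼⁿ on the overlap, and the last factor
vanishes on the closed subscheme of the chart j. Restricting to the overlap loses nothing, as that
subscheme lies over the chart j. -/
theorem chartIdeal_le_ker (I : Ideal CoordRing) (i j : Fin 6) {a : ChartRing i}
    (ha : a ∈ chartIdeal I i) :
    (chartIso i).hom a ∈ (chartMap I j).ker.ideal (chartOpen i) := by
  obtain ⟨n, b, hb, hbI, rfl⟩ := exists_mk_of_mem_chartIdeal ha
  rw [Scheme.Hom.ker_apply, RingHom.mem_ker]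
  refine app_eq_zero_of_restrict (chartMap I j) (overlap_le_left i j) ?_ _ ?_
  · intro x hx
    have h1 : x ∈ (chartMap I j) ⁻¹ᵁ (chartOpen j).1 := by
      rw [preimage_chartOpen_eq_top]; trivial
    change chartMap I j x ∈ Proj.basicOpen grading _
    rw [Proj.basicOpen_mul]
    exact ⟨hx, h1⟩
  · rw [map_chartIso_left]
    have h2 := Scheme.IdealSheafData.ideal_le_comap_ideal (chartMap I j).ker
      (U := overlap i j) (V := chartOpen j) (overlap_le_right i j)
      ((ker_chartMap_ideal I j _).2 (mk_mem_chartIdeal j hb hbI))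
    rw [Ideal.mem_comap, Scheme.Hom.ker_apply, RingHom.mem_ker] at h2
    have h3 := (congrArg _ (map_chartIso_right i j _)).symm.trans h2
    -- With denominator a power of xᵢxⱼ, the factor (xⱼ/xᵢ)ⁿ is written xⱼ²ⁿ/(xᵢxⱼ)ⁿ.
    have hu : MvPolynomial.X j ^ (2 * n) ∈ grading (n • (1 + 1)) := by
      have := SetLike.pow_mem_graded (2 * n) (X_mem_grading j)
      rwa [show n • (1 + 1) = (2 * n) • 1 by simp; ring]
    have h4 : HomogeneousLocalization.awayMap grading (X_mem_grading j) rfl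
        (HomogeneousLocalization.Away.mk grading (X_mem_grading i) n b hb) =
        HomogeneousLocalization.Away.mk grading
          (SetLike.mul_mem_graded (X_mem_grading i) (X_mem_grading j)) n _ hu *
        HomogeneousLocalization.awayMap grading (X_mem_grading i) (mul_comm _ _)
          (HomogeneousLocalization.Away.mk grading (X_mem_grading j) n b hb) := by
      rw [HomogeneousLocalization.ext_iff_val, HomogeneousLocalization.val_mul,
        HomogeneousLocalization.awayMap_mk, HomogeneousLocalization.awayMap_mk,
        HomogeneousLocalization.Away.val_mk, HomogeneousLocalization.Away.val_mk,
        HomogeneousLocalization.Away.val_mk, Localization.mk_mul, Localization.mk_eq_mk_iff,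
        Localization.r_iff_exists]
      exact ⟨1, by simp; ring⟩
    have h5 := congrArg (fun z => (chartMap I j).app (overlap i j).1 (Proj.awayToSection grading
      (MvPolynomial.X i * MvPolynomial.X j) z)) h4
    refine h5.trans ?_
    simp only [map_mul]
    exact mul_eq_zero_of_right _ h3

/-- The kernel of the i-th chart map gives one inclusion, and `chartIdeal_le_ker` shows that the
other five kernels impose nothing new on this chart. -/
theorem chartIso_mem_ideal (I : Ideal CoordRing) (i : Fin 6) (a : ChartRing i) :
    (chartIso i).hom a ∈ (idealSheaf I).ideal (chartOpen i) ↔ a ∈ chartIdeal I i := by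
  rw [idealSheaf, Scheme.IdealSheafData.ideal_iInf, iInf_apply, Ideal.mem_iInf]
  exact ⟨fun h => (ker_chartMap_ideal I i a).1 (h i), fun h j => chartIdeal_le_ker I i j h⟩

/-- The isomorphism of quotients induced by an isomorphism of rings. -/
def quotientIso {A B : CommRingCat.{0}} (f : A ≅ B) (I : Ideal A) (J : Ideal B)
    (h : ∀ a, f.hom a ∈ J ↔ a ∈ I) : CommRingCat.of (A ⧸ I) ≅ CommRingCat.of (B ⧸ J) where
  hom := CommRingCat.ofHom (Ideal.quotientMap J f.hom.hom fun a ha => (h a).2 ha)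
  inv := CommRingCat.ofHom (Ideal.quotientMap I f.inv.hom fun b hb => by
    rw [Ideal.mem_comap, ← h]
    rwa [show f.hom (f.inv.hom b) = b from f.inv_hom_id_apply b])
  hom_inv_id := by
    ext a
    exact congrArg (Ideal.Quotient.mk I) (f.hom_inv_id_apply a)
  inv_hom_id := by
    ext b
    exact congrArg (Ideal.Quotient.mk J) (f.inv_hom_id_apply b)

theorem mk_quotientIso_inv {A B : CommRingCat.{0}} (f : A ≅ B) (I : Ideal A) (J : Ideal B)
    (h : ∀ a, f.hom a ∈ J ↔ a ∈ I) :
    CommRingCat.ofHom (Ideal.Quotient.mk J) ≫ (quotientIso f I J h).inv =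
      f.inv ≫ CommRingCat.ofHom (Ideal.Quotient.mk I) := rfl

/-- The open subscheme of a closed subscheme lying over an affine open. -/
def affineChart {X : Scheme} (I : X.IdealSheafData) (U : X.affineOpens) :
    Spec (CommRingCat.of (Γ(X, U.1) ⧸ I.ideal U)) ⟶ I.subscheme :=
  I.subschemeCover.f U

instance isOpenImmersion_affineChart {X : Scheme} (I : X.IdealSheafData) (U : X.affineOpens) :
    IsOpenImmersion (affineChart I U) :=
  I.subschemeCover.map_prop U

theorem affineChart_subschemeι {X : Scheme} (I : X.IdealSheafData) (U : X.affineOpens) :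
    affineChart I U ≫ I.subschemeι =
      Spec.map (CommRingCat.ofHom (Ideal.Quotient.mk (I.ideal U))) ≫ U.2.fromSpec :=
  (I.subschemeCover_map_subschemeι U).trans (I.glueDataObjι_ι U)

theorem opensRange_affineChart {X : Scheme} (I : X.IdealSheafData) (U : X.affineOpens) :
    (affineChart I U).opensRange = I.subschemeι ⁻¹ᵁ U.1 :=
  I.opensRange_subschemeCover_map U

/-- The chart `xᵢ ≠ 0` of the closed subscheme defined by `I`. -/
def subschemeChart (I : Ideal CoordRing) (i : Fin 6) :
    Spec (CommRingCat.of (ChartRing i ⧸ chartIdeal I i)) ⟶ (idealSheaf I).subscheme :=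
  Spec.map (quotientIso (chartIso i) (chartIdeal I i) ((idealSheaf I).ideal (chartOpen i))
    (chartIso_mem_ideal I i)).inv ≫ affineChart (idealSheaf I) (chartOpen i)

instance isOpenImmersion_subschemeChart (I : Ideal CoordRing) (i : Fin 6) :
    IsOpenImmersion (subschemeChart I i) :=
  IsOpenImmersion.comp _ _

theorem subschemeChart_subschemeι (I : Ideal CoordRing) (i : Fin 6) :
    subschemeChart I i ≫ (idealSheaf I).subschemeι = chartMap I i := by
  rw [subschemeChart, Category.assoc, affineChart_subschemeι, chartMap, awayι_eq,
    ← Category.assoc, ← Category.assoc, ← Spec.map_comp, ← Spec.map_comp]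
  exact congrArg (fun f => Spec.map f ≫ (isAffineOpen_chartOpen i).fromSpec)
    (mk_quotientIso_inv _ _ _ _)

theorem opensRange_subschemeChart (I : Ideal CoordRing) (i : Fin 6) :
    (subschemeChart I i).opensRange = (idealSheaf I).subschemeι ⁻¹ᵁ (chartOpen i).1 :=
  (Scheme.Hom.opensRange_comp_of_isIso _ _).trans (opensRange_affineChart _ _)

theorem exists_mem_chartOpen (x : P5) : ∃ i, x ∈ (chartOpen i).1 := by
  have h := Proj.iSup_basicOpen_eq_top' grading (fun i : Fin 6 => (MvPolynomial.X i : CoordRing))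
    (fun i => ⟨1, X_mem_grading i⟩) ?_
  · have hx : x ∈ (⊤ : P5.Opens) := trivial
    rw [← h] at hx
    exact TopologicalSpace.Opens.mem_iSup.1 hx
  · rw [eq_top_iff]
    rintro f -
    induction f using MvPolynomial.induction_on with
    | C a =>
      exact (Algebra.adjoin (grading 0) (Set.range fun i : Fin 6 =>
        (MvPolynomial.X i : CoordRing))).algebraMap_mem
        (⟨MvPolynomial.C a, MvPolynomial.isHomogeneous_C _ _⟩ : grading 0)
    | add p q hp hq => exact add_mem hp hq
    | mul_X p i hp => exact mul_mem hp (Algebra.subset_adjoin ⟨i, rfl⟩)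

theorem exists_subschemeChart (I : Ideal CoordRing) (x : (idealSheaf I).subscheme) :
    ∃ i y, subschemeChart I i y = x := by
  obtain ⟨i, hi⟩ := exists_mem_chartOpen ((idealSheaf I).subschemeι x)
  have hx : x ∈ (subschemeChart I i).opensRange := by
    rw [opensRange_subschemeChart]
    exact hi
  exact ⟨i, hx⟩

theorem subschemeChart_toSpec (I : Ideal CoordRing) (i : Fin 6) :
    subschemeChart I i ≫ (idealSheaf I).subschemeι ≫ P5.toSpec =
      Spec.map (CommRingCat.ofHom (algebraMap ℂ (grading 0)) ≫
        CommRingCat.ofHom (HomogeneousLocalization.fromZeroRingHom grading _) ≫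
        CommRingCat.ofHom (Ideal.Quotient.mk (chartIdeal I i))) := by
  rw [← Category.assoc, subschemeChart_subschemeι, chartMap, P5.toSpec, Category.assoc,
    Proj.awayι_toSpecZero_assoc, Spec.map_comp, Spec.map_comp, Category.assoc]

end Charts

end

end KleinEPW

namespace KleinEPW

noncomputable section

/-! ### Dehomogenization -/

section Dehomogenization

theorem eval₂_mul_of_isHomogeneous {R : Type*} [CommRing R] (φ : ℂ →+* R) (u : R) (x : Fin 6 → R)
    {f : CoordRing} {n : ℕ} (hf : f.IsHomogeneous n) :
    MvPolynomial.eval₂ φ (fun j => u * x j) f = u ^ n * MvPolynomial.eval₂ φ x f := by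
  rw [MvPolynomial.eval₂_eq', MvPolynomial.eval₂_eq', Finset.mul_sum]
  refine Finset.sum_congr rfl fun d hd => ?_
  have hd' : d.degree = n := by
    have := hf (MvPolynomial.mem_support_iff.1 hd)
    rwa [show (Finsupp.weight 1) d = d.degree from congrArg (fun f => f d) Finsupp.degree_eq_weight_one.symm] at this
  have : ∏ j, (u * x j) ^ d j = u ^ n * ∏ j, x j ^ d j := by
    simp only [mul_pow, Finset.prod_mul_distrib]
    rw [Finset.prod_pow_eq_pow_sum, ← hd', Finsupp.degree_eq_sum]
  rw [this]
  ring

/-- Dehomogenization: the map `ℂ[x₀, …, x₅] → ℂ[x₀, …, x₅]_(xᵢ)` with `xⱼ ↦ xⱼ / xᵢ`. -/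
def dehom (i : Fin 6) : CoordRing →+* ChartRing i :=
  MvPolynomial.eval₂Hom ((HomogeneousLocalization.fromZeroRingHom grading _).comp
    (algebraMap ℂ (grading 0))) fun j => HomogeneousLocalization.Away.mk grading
      (X_mem_grading i) 1 (MvPolynomial.X j) (by simpa using X_mem_grading j)

theorem dehom_C (i : Fin 6) (a : ℂ) : dehom i (MvPolynomial.C a) =
    HomogeneousLocalization.fromZeroRingHom grading _ (algebraMap ℂ (grading 0) a) :=
  MvPolynomial.eval₂Hom_C _ _ _

theorem val_dehom_C (i : Fin 6) (a : ℂ) : (dehom i (MvPolynomial.C a)).val =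
    algebraMap CoordRing (Localization.Away (MvPolynomial.X i : CoordRing)) (MvPolynomial.C a) := by
  rw [dehom_C, ← Localization.mk_one_eq_algebraMap]
  rfl

theorem val_dehom_X (i j : Fin 6) :
    algebraMap CoordRing (Localization.Away (MvPolynomial.X i : CoordRing)) (MvPolynomial.X i) *
      (dehom i (MvPolynomial.X j)).val =
    algebraMap CoordRing (Localization.Away (MvPolynomial.X i : CoordRing)) (MvPolynomial.X j) := by
  rw [dehom, MvPolynomial.eval₂Hom_X', HomogeneousLocalization.Away.val_mk,
    ← Localization.mk_one_eq_algebraMap, ← Localization.mk_one_eq_algebraMap, Localization.mk_mul,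
    Localization.mk_eq_mk_iff, Localization.r_iff_exists]
  exact ⟨1, by simp⟩

theorem val_dehom (i : Fin 6) {f : CoordRing} {n : ℕ} (hf : f ∈ grading n) :
    algebraMap CoordRing (Localization.Away (MvPolynomial.X i : CoordRing)) (MvPolynomial.X i) ^ n *
      (dehom i f).val =
    algebraMap CoordRing (Localization.Away (MvPolynomial.X i : CoordRing)) f := by
  have h1 : (dehom i f).val = MvPolynomial.eval₂ ((algebraMap CoordRing
      (Localization.Away (MvPolynomial.X i : CoordRing))).comp MvPolynomial.C)
      (fun j => (dehom i (MvPolynomial.X j)).val) f := by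
    have : (algebraMap (ChartRing i)
        (Localization.Away (MvPolynomial.X i : CoordRing))).comp (dehom i) =
        MvPolynomial.eval₂Hom ((algebraMap CoordRing
      (Localization.Away (MvPolynomial.X i : CoordRing))).comp MvPolynomial.C)
      (fun j => (dehom i (MvPolynomial.X j)).val) := by
      refine MvPolynomial.ringHom_ext (fun a => ?_) fun j => ?_
      · rw [MvPolynomial.eval₂Hom_C]
        exact val_dehom_C i a
      · rw [MvPolynomial.eval₂Hom_X']
        rfl
    exact congrArg (fun φ => φ f) this
  rw [h1, ← eval₂_mul_of_isHomogeneous _ _ _ ((MvPolynomial.mem_homogeneousSubmodule _ _).1 hf)]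
  simp only [val_dehom_X]
  have : MvPolynomial.eval₂Hom ((algebraMap CoordRing
      (Localization.Away (MvPolynomial.X i : CoordRing))).comp MvPolynomial.C)
      (fun j => algebraMap CoordRing _ (MvPolynomial.X j)) = algebraMap CoordRing
      (Localization.Away (MvPolynomial.X i : CoordRing)) :=
    MvPolynomial.ringHom_ext (fun a => by simp) fun j => by simp
  exact congrArg (fun φ => φ f) this

theorem dehom_eq_mk (i : Fin 6) {f : CoordRing} {n : ℕ} (hf : f ∈ grading (n • 1)) :
    dehom i f = HomogeneousLocalization.Away.mk grading (X_mem_grading i) n f hf := by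
  have h := val_dehom i hf
  rw [smul_eq_mul, mul_one] at h
  rw [HomogeneousLocalization.ext_iff_val, HomogeneousLocalization.Away.val_mk,
    Localization.mk_eq_mk', IsLocalization.eq_mk'_iff_mul_eq, ← h, map_pow, mul_comm]

theorem dehom_surjective (i : Fin 6) : Function.Surjective (dehom i) := fun a => by
  obtain ⟨n, f, hf, rfl⟩ := HomogeneousLocalization.Away.mk_surjective grading (X_mem_grading i) a
  exact ⟨f, dehom_eq_mk i hf⟩

theorem dehom_X_self (i : Fin 6) : dehom i (MvPolynomial.X i) = 1 := by
  have h := val_dehom_X i i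
  rw [HomogeneousLocalization.ext_iff_val, HomogeneousLocalization.val_one]
  exact (IsLocalization.Away.algebraMap_isUnit (S := Localization.Away
    (MvPolynomial.X i : CoordRing)) (MvPolynomial.X i : CoordRing)).mul_left_cancel
    (h.trans (mul_one _).symm)

theorem dehom_mem_chartIdeal_of_mem {I : Ideal CoordRing} (hI : I.IsHomogeneous grading) (i : Fin 6)
    {f : CoordRing} (hf : f ∈ I) : dehom i f ∈ chartIdeal I i := by
  classical
  rw [← DirectSum.sum_support_decompose grading f, map_sum]
  refine sum_mem fun n _ => ?_
  have h : (DirectSum.decompose grading f n : CoordRing) ∈ grading (n • 1) := by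
    rw [smul_eq_mul, mul_one]
    exact SetLike.coe_mem _
  rw [dehom_eq_mk i h]
  exact mk_mem_chartIdeal i h (hI n hf)

/-- The ideal of a chart of the subscheme defined by a homogeneous ideal, in terms of the
homogeneous coordinates. -/
def affineIdeal (I : Ideal CoordRing) (i : Fin 6) : Ideal CoordRing :=
  I ⊔ Ideal.span {MvPolynomial.X i - 1}

theorem X_sub_one_mem (I : Ideal CoordRing) (i : Fin 6) :
    MvPolynomial.X i - 1 ∈ affineIdeal I i :=
  Ideal.mem_sup_right (Ideal.mem_span_singleton_self _)

/-- Reduction modulo I + (xᵢ - 1) sends xᵢ to 1, so it extends to the localization at xᵢ and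
recovers the class of f from its dehomogenization. -/
theorem dehom_mem_chartIdeal {I : Ideal CoordRing} (hI : I.IsHomogeneous grading) (i : Fin 6)
    {f : CoordRing} : dehom i f ∈ chartIdeal I i ↔ f ∈ affineIdeal I i := by
  constructor
  · intro h
    let m : CoordRing →+* CoordRing ⧸ affineIdeal I i := Ideal.Quotient.mk _
    have hX : m (MvPolynomial.X i) = 1 := by
      rw [← map_one m]
      exact Ideal.Quotient.eq.2 (X_sub_one_mem I i)
    let s : Localization.Away (MvPolynomial.X i : CoordRing) →+* CoordRing ⧸ affineIdeal I i :=
      IsLocalization.Away.lift (g := m) (MvPolynomial.X i) (by rw [hX]; exact isUnit_one)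
    have hs : ∀ g, s (algebraMap _ _ g) = m g := fun g => IsLocalization.Away.lift_eq _ _ _
    have h1 : (s.comp (algebraMap (ChartRing i) _)).comp (dehom i) = m := by
      refine MvPolynomial.ringHom_ext (fun a => ?_) fun j => ?_
      · change s (dehom i (MvPolynomial.C a)).val = _
        rw [val_dehom_C, hs]
      · change s (dehom i (MvPolynomial.X j)).val = _
        rw [← hs (MvPolynomial.X j), ← val_dehom_X i j, map_mul, hs, hX, one_mul]
    have h2 : m f = 0 := by
      rw [← h1]
      have h3 : I.map (algebraMap CoordRing (Localization.Away (MvPolynomial.X i : CoordRing))) ≤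
          RingHom.ker s := by
        rw [Ideal.map_le_iff_le_comap]
        intro g hg
        rw [Ideal.mem_comap, RingHom.mem_ker, hs]
        exact Ideal.Quotient.eq_zero_iff_mem.2 (Ideal.mem_sup_left hg)
      exact h3 (Ideal.mem_comap.1 h)
    exact Ideal.Quotient.eq_zero_iff_mem.1 h2
  · intro h
    have : affineIdeal I i ≤ (chartIdeal I i).comap (dehom i) := by
      refine sup_le (fun g hg => dehom_mem_chartIdeal_of_mem hI i hg) ?_
      rw [Ideal.span_le, Set.singleton_subset_iff, SetLike.mem_coe, Ideal.mem_comap, map_sub,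
        dehom_X_self, map_one, sub_self]
      exact zero_mem _
    exact this h

/-- Homogeneous coordinates on a chart of a closed subscheme. -/
def chartHom (I : Ideal CoordRing) (i : Fin 6) : CoordRing →+* ChartRing i ⧸ chartIdeal I i :=
  (Ideal.Quotient.mk _).comp (dehom i)

theorem chartHom_surjective (I : Ideal CoordRing) (i : Fin 6) :
    Function.Surjective (chartHom I i) :=
  Ideal.Quotient.mk_surjective.comp (dehom_surjective i)

theorem chartHom_eq_zero_iff {I : Ideal CoordRing} (hI : I.IsHomogeneous grading) (i : Fin 6)
    {f : CoordRing} : chartHom I i f = 0 ↔ f ∈ affineIdeal I i :=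
  Ideal.Quotient.eq_zero_iff_mem.trans (dehom_mem_chartIdeal hI i)

theorem subschemeChart_toSpec_eq (I : Ideal CoordRing) (i : Fin 6) :
    subschemeChart I i ≫ (idealSheaf I).subschemeι ≫ P5.toSpec =
      Spec.map (CommRingCat.ofHom ((chartHom I i).comp MvPolynomial.C)) := by
  rw [subschemeChart_toSpec]
  congr 1
  ext a
  exact congrArg (Ideal.Quotient.mk _) (dehom_C i a).symm

/-- The homogeneous ideal of a point of a chart of projective space. -/
theorem mem_awayι_iff (i : Fin 6) (y : Spec (CommRingCat.of (ChartRing i))) {f : CoordRing} {n : ℕ}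
    (hf : f ∈ grading n) :
    f ∈ (Proj.awayι grading (MvPolynomial.X i) (X_mem_grading i) Nat.one_pos y).asHomogeneousIdeal ↔
      dehom i f ∈ y.asIdeal := by
  have key : ∀ {g : CoordRing} {m : ℕ} (_ : g ∈ grading m) (_ : 0 < m),
      g ∈ (Proj.awayι grading (MvPolynomial.X i) (X_mem_grading i)
        Nat.one_pos y).asHomogeneousIdeal ↔ dehom i g ∈ y.asIdeal := by
    intro g m hg hm
    have h := congrArg (fun U => y ∈ U) (Proj.awayι_preimage_basicOpen grading (X_mem_grading i)
      Nat.one_pos hg hm)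
    have h2 : HomogeneousLocalization.Away.isLocalizationElem (X_mem_grading i) hg = dehom i g := by
      rw [dehom_eq_mk i (n := m) (by simpa using hg), HomogeneousLocalization.ext_iff_val,
        HomogeneousLocalization.Away.val_mk, HomogeneousLocalization.Away.val_mk]
      simp only [pow_one]
    rw [h2] at h
    exact not_iff_not.1 (iff_of_eq h)
  have hX : (MvPolynomial.X i : CoordRing) ∉ (Proj.awayι grading (MvPolynomial.X i)
      (X_mem_grading i) Nat.one_pos y).asHomogeneousIdeal := by
    rw [key (X_mem_grading i) Nat.one_pos, dehom_X_self]
    exact fun h => y.isPrime.ne_top ((Ideal.eq_top_iff_one _).2 h)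
  -- Basic opens describe membership only in positive degree; multiplying by xᵢ, which is outside
  -- the prime, covers degree zero.
  have h1 := key (SetLike.mul_mem_graded (X_mem_grading i) hf) (by omega)
  rw [map_mul, dehom_X_self, one_mul] at h1
  rw [← h1]
  refine ⟨fun h => Ideal.mul_mem_left _ _ h, fun h => ?_⟩
  exact ((Proj.awayι grading (MvPolynomial.X i) (X_mem_grading i)
    Nat.one_pos y).isPrime.mem_or_mem h).resolve_left hX

theorem le_awayι_iff (i : Fin 6) (y : Spec (CommRingCat.of (ChartRing i))) {I : Ideal CoordRing}
    (hI : I.IsHomogeneous grading) :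
    I ≤ (Proj.awayι grading (MvPolynomial.X i) (X_mem_grading i)
      Nat.one_pos y).asHomogeneousIdeal.toIdeal ↔ I ≤ y.asIdeal.comap (dehom i) := by
  classical
  constructor
  · intro h f hf
    rw [← DirectSum.sum_support_decompose grading f]
    exact sum_mem fun n _ => (mem_awayι_iff i y (SetLike.coe_mem _)).1 (h (hI n hf))
  · intro h f hf
    rw [← DirectSum.sum_support_decompose grading f]
    exact sum_mem fun n _ => (mem_awayι_iff i y (SetLike.coe_mem _)).2 (h (hI n hf))

theorem exists_awayι_eq (x : P5) : ∃ i, ∃ y,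
    Proj.awayι grading (MvPolynomial.X i) (X_mem_grading i) Nat.one_pos y = x := by
  obtain ⟨i, hi⟩ := exists_mem_chartOpen x
  have h1 : (Proj.awayι grading (MvPolynomial.X i) (X_mem_grading i) Nat.one_pos).opensRange =
      (chartOpen i).1 := Proj.opensRange_awayι _ _ _ _
  rw [← h1] at hi
  exact ⟨i, hi⟩

theorem subschemeι_subschemeChart (I : Ideal CoordRing) (i : Fin 6)
    (w : Spec (CommRingCat.of (ChartRing i ⧸ chartIdeal I i))) :
    (idealSheaf I).subschemeι (subschemeChart I i w) =
      Proj.awayι grading (MvPolynomial.X i) (X_mem_grading i) Nat.one_pos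
        (Spec.map (CommRingCat.ofHom (Ideal.Quotient.mk (chartIdeal I i))) w) := by
  rw [← Scheme.Hom.comp_apply, subschemeChart_subschemeι, chartMap, Scheme.Hom.comp_apply]

/-- The points of the closed subscheme defined by a homogeneous ideal. -/
theorem mem_range_subschemeι_iff {I : Ideal CoordRing} (hI : I.IsHomogeneous grading) (x : P5) :
    x ∈ Set.range (idealSheaf I).subschemeι ↔ I ≤ x.asHomogeneousIdeal.toIdeal := by
  constructor
  · rintro ⟨z, rfl⟩
    obtain ⟨i, w, rfl⟩ := exists_subschemeChart I z
    rw [subschemeι_subschemeChart, le_awayι_iff _ _ hI]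
    intro f hf
    change Ideal.Quotient.mk _ (dehom i f) ∈ w.asIdeal
    rw [Ideal.Quotient.eq_zero_iff_mem.2 (dehom_mem_chartIdeal_of_mem hI i hf)]
    exact zero_mem _
  · intro h
    obtain ⟨i, y, rfl⟩ := exists_awayι_eq x
    rw [le_awayι_iff _ _ hI] at h
    have h1 : chartIdeal I i ≤ y.asIdeal := by
      intro a ha
      obtain ⟨n, b, hb, hbI, rfl⟩ := exists_mk_of_mem_chartIdeal ha
      rw [← dehom_eq_mk i hb]
      exact h hbI
    have h2 : y ∈ Set.range (PrimeSpectrum.comap (Ideal.Quotient.mk (chartIdeal I i))) := by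
      rw [range_comap_of_surjective _ _ Ideal.Quotient.mk_surjective, Ideal.mk_ker]
      exact h1
    obtain ⟨w, hw⟩ := h2
    exact ⟨subschemeChart I i w, (subschemeι_subschemeChart I i w).trans (congrArg _ hw)⟩

end Dehomogenization

end

end KleinEPW

namespace KleinEPW

noncomputable section

/-! ### Local structure of the charts -/

section LocalStructure

open MvPolynomial in
/-- The Jacobian criterion for a localization of a quotient of the coordinate ring. -/
theorem isStandardSmoothOfRelativeDimension_of_isUnit_jacobian {c : ℕ} (v : Fin c → CoordRing)
    (a : Fin c → Fin 6) (ha : Function.Injective a) {J : Ideal CoordRing} {g : CoordRing}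
    (hv : ∀ t, ∃ n, g ^ n * v t ∈ J) (hJ : ∀ f ∈ J, ∃ n, g ^ n * f ∈ Ideal.span (Set.range v))
    (hdet : (Matrix.of fun s t => pderiv (a s) (v t)).det ∣ g)
    {R T : Type} [CommRing R] [CommRing T] [Algebra R T] (π : CoordRing →+* R)
    (hπ : Function.Surjective π) (hker : ∀ f, π f = 0 ↔ f ∈ J) [IsLocalization.Away (π g) T] :
    ((algebraMap R T).comp (π.comp C)).IsStandardSmoothOfRelativeDimension (6 - c) := by
  let τ : CoordRing →+* T := (algebraMap R T).comp π
  have hg : IsUnit (τ g) := IsLocalization.Away.algebraMap_isUnit (π g)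
  have hzero : ∀ f, τ f = 0 ↔ ∃ n, g ^ n * f ∈ Ideal.span (Set.range v) := by
    intro f
    constructor
    · intro h
      obtain ⟨⟨_, n, rfl⟩, hn⟩ := (IsLocalization.map_eq_zero_iff (Submonoid.powers (π g)) T _).1 h
      have h1 : g ^ n * f ∈ J := by
        rw [← hker, map_mul, map_pow]
        exact hn
      obtain ⟨m, hm⟩ := hJ _ h1
      exact ⟨m + n, by rwa [pow_add, mul_assoc]⟩
    · rintro ⟨n, hn⟩
      have h1 : Ideal.span (Set.range v) ≤ RingHom.ker τ := by
        rw [Ideal.span_le]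
        rintro _ ⟨t, rfl⟩
        obtain ⟨m, hm⟩ := hv t
        have h2 : τ g ^ m * τ (v t) = 0 := by
          rw [← map_pow, ← map_mul]
          exact (congrArg (algebraMap R T) ((hker _).2 hm)).trans (map_zero _)
        exact (hg.pow m).mul_right_eq_zero.1 h2
      have h2 : τ g ^ n * τ f = 0 := by
        rw [← map_pow, ← map_mul]
        exact h1 hn
      exact (hg.pow n).mul_right_eq_zero.1 h2
  -- After inverting g, J and the ideal of the v agree, so T is also a localization of S. The naive
  -- presentation of S has the chosen Jacobian minor as its Jacobian, and this divides g, a unit in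
  -- T.
  let S := CoordRing ⧸ Ideal.span (Set.range v)
  let β : S →+* T := Ideal.Quotient.lift _ τ fun f hf => (hzero f).2 ⟨0, by simpa using hf⟩
  algebraize [(algebraMap R T).comp (π.comp C), β]
  have : IsScalarTower ℂ S T := IsScalarTower.of_algebraMap_eq (R := ℂ) (S := S) (A := T) fun z => rfl
  have hβ : ∀ f : CoordRing, algebraMap S T (Ideal.Quotient.mk _ f) = τ f := fun f => rfl
  have hloc : IsLocalization.Away (Ideal.Quotient.mk (Ideal.span (Set.range v)) g : S) T := by
    constructor; constructor
    · rintro ⟨_, n, rfl⟩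
      simp only [map_pow]
      exact hg.pow n
    · intro z
      obtain ⟨⟨r, ⟨_, n, rfl⟩⟩, hz⟩ := IsLocalization.surj (Submonoid.powers (π g)) z
      obtain ⟨f, rfl⟩ := hπ r
      refine ⟨⟨Ideal.Quotient.mk _ f, ⟨_, n, rfl⟩⟩, ?_⟩
      simp only [map_pow] at hz ⊢
      exact hz
    · intro x y hxy
      obtain ⟨x, rfl⟩ := Ideal.Quotient.mk_surjective x
      obtain ⟨y, rfl⟩ := Ideal.Quotient.mk_surjective y
      rw [hβ, hβ, ← sub_eq_zero, ← map_sub, hzero] at hxy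
      obtain ⟨n, hn⟩ := hxy
      refine ⟨⟨_, n, rfl⟩, ?_⟩
      simp only [← map_pow, ← map_mul]
      rw [Ideal.Quotient.eq, ← mul_sub]
      exact hn
  let P0 : Algebra.PreSubmersivePresentation ℂ S (Fin 6) (Fin c) :=
    Algebra.PreSubmersivePresentation.naive a ha
  let Q := Algebra.PreSubmersivePresentation.localizationAway T
    (Ideal.Quotient.mk (Ideal.span (Set.range v)) g : S)
  have hjac : IsUnit (Q.comp P0).jacobian := by
    rw [Algebra.PreSubmersivePresentation.comp_jacobian_eq_jacobian_smul_jacobian,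
      Algebra.smul_def, IsUnit.mul_iff]
    constructor
    · have h1 : P0.jacobian = Ideal.Quotient.mk _ (Matrix.of fun s t => pderiv (a s) (v t)).det := by
        rw [Algebra.PreSubmersivePresentation.jacobian_eq_jacobiMatrix_det]
        have : P0.jacobiMatrix = Matrix.of fun s t => pderiv (a s) (v t) := by
          ext s t
          rw [Algebra.PreSubmersivePresentation.jacobiMatrix_naive]
          rfl
        rw [this]
        rfl
      rw [h1, hβ]
      exact isUnit_of_dvd_unit (map_dvd τ hdet) hg
    · exact (Algebra.SubmersivePresentation.localizationAway T
        (Ideal.Quotient.mk (Ideal.span (Set.range v)) g : S)).jacobian_isUnit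
  let P : Algebra.SubmersivePresentation ℂ T _ _ := ⟨Q.comp P0, hjac⟩
  refine P.isStandardSmoothOfRelativeDimension (n := 6 - c) ?_
  change (Q.comp P0).dimension = _
  rw [Algebra.PreSubmersivePresentation.dimension_comp_eq_dimension_add_dimension]
  simp [Algebra.Presentation.dimension]

/-- The part of a chart of a subscheme where `g` does not vanish. -/
def subschemeBasic (I : Ideal CoordRing) (i : Fin 6) (g : CoordRing) :
    Spec (CommRingCat.of (Localization.Away (chartHom I i g))) ⟶ (idealSheaf I).subscheme :=
  Spec.map (CommRingCat.ofHom (algebraMap _ _)) ≫ subschemeChart I i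

instance isOpenImmersion_subschemeBasic (I : Ideal CoordRing) (i : Fin 6) (g : CoordRing) :
    IsOpenImmersion (subschemeBasic I i g) := by
  have : IsOpenImmersion (Spec.map (CommRingCat.ofHom (algebraMap (ChartRing i ⧸ chartIdeal I i)
      (Localization.Away (chartHom I i g))))) :=
    IsOpenImmersion.of_isLocalization (chartHom I i g)
  exact IsOpenImmersion.comp _ _

theorem range_subschemeBasic (I : Ideal CoordRing) (i : Fin 6) (g : CoordRing) :
    Set.range (subschemeBasic I i g) =
      subschemeChart I i '' {w | chartHom I i g ∉ w.asIdeal} := by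
  have h := PrimeSpectrum.localization_away_comap_range (Localization.Away (chartHom I i g))
    (chartHom I i g)
  ext x
  constructor
  · rintro ⟨u, rfl⟩
    have hu : PrimeSpectrum.comap (algebraMap _ _) u ∈ PrimeSpectrum.basicOpen (chartHom I i g) := by
      rw [← SetLike.mem_coe, ← h]
      exact ⟨u, rfl⟩
    exact ⟨_, hu, rfl⟩
  · rintro ⟨w, hw, rfl⟩
    have hw' : w ∈ Set.range (PrimeSpectrum.comap (algebraMap (ChartRing i ⧸ chartIdeal I i)
        (Localization.Away (chartHom I i g)))) := by
      rw [h]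
      exact hw
    obtain ⟨u, hu⟩ := hw'
    exact ⟨u, congrArg (subschemeChart I i) hu⟩

theorem subschemeBasic_toSpec (I : Ideal CoordRing) (i : Fin 6) (g : CoordRing) :
    subschemeBasic I i g ≫ (idealSheaf I).subschemeι ≫ P5.toSpec =
      Spec.map (CommRingCat.ofHom ((algebraMap _ (Localization.Away (chartHom I i g))).comp
        ((chartHom I i).comp MvPolynomial.C))) := by
  rw [subschemeBasic, Category.assoc, subschemeChart_toSpec_eq, ← Spec.map_comp]
  rfl

theorem exists_opens_of_subschemeBasic (P : MorphismProperty Scheme) [P.RespectsIso]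
    (I : Ideal CoordRing) (i : Fin 6) (g : CoordRing)
    (h : P (Spec.map (CommRingCat.ofHom ((algebraMap _ (Localization.Away (chartHom I i g))).comp
        ((chartHom I i).comp MvPolynomial.C)))))
    (w : Spec (CommRingCat.of (ChartRing i ⧸ chartIdeal I i))) (hw : chartHom I i g ∉ w.asIdeal) :
    ∃ U : (idealSheaf I).subscheme.Opens, subschemeChart I i w ∈ U ∧
      P (U.ι ≫ (idealSheaf I).subschemeι ≫ P5.toSpec) := by
  refine ⟨(subschemeBasic I i g).opensRange, ?_, ?_⟩
  · change _ ∈ Set.range _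
    rw [range_subschemeBasic]
    exact ⟨w, hw, rfl⟩
  · rw [← Scheme.Hom.isoOpensRange_inv_comp, Category.assoc, P.cancel_left_of_respectsIso,
      subschemeBasic_toSpec]
    exact h

theorem exists_smooth_subschemeBasic (I : Ideal CoordRing) (i : Fin 6)
    (w : Spec (CommRingCat.of (ChartRing i ⧸ chartIdeal I i)))
    (U : (idealSheaf I).subscheme.Opens) (hw : subschemeChart I i w ∈ U)
    (hU : Smooth (U.ι ≫ (idealSheaf I).subschemeι ≫ P5.toSpec)) :
    ∃ g : CoordRing, chartHom I i g ∉ w.asIdeal ∧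
      ((algebraMap _ (Localization.Away (chartHom I i g))).comp
        ((chartHom I i).comp MvPolynomial.C)).Smooth := by
  have hw' : w ∈ (subschemeChart I i) ⁻¹ᵁ U := hw
  obtain ⟨_, ⟨r, rfl⟩, hr, hrU⟩ :=
    PrimeSpectrum.isTopologicalBasis_basic_opens.exists_subset_of_mem_open
      (show w ∈ ((subschemeChart I i) ⁻¹ᵁ U).1 from hw') ((subschemeChart I i) ⁻¹ᵁ U).isOpen
  obtain ⟨g, rfl⟩ := chartHom_surjective I i r
  refine ⟨g, hr, ?_⟩
  have h1 : Set.range (subschemeBasic I i g) ⊆ Set.range U.ι := by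
    rw [range_subschemeBasic, Scheme.Opens.range_ι]
    rintro _ ⟨w', hw', rfl⟩
    exact hrU hw'
  have h2 := IsOpenImmersion.lift_fac U.ι (subschemeBasic I i g) h1
  have h3 : IsOpenImmersion (IsOpenImmersion.lift U.ι (subschemeBasic I i g) h1) := by
    have : IsOpenImmersion (IsOpenImmersion.lift U.ι (subschemeBasic I i g) h1 ≫ U.ι) := by
      rw [h2]
      infer_instance
    exact IsOpenImmersion.of_comp _ U.ι
  have h4 : Smooth (Spec.map (CommRingCat.ofHom ((algebraMap _
      (Localization.Away (chartHom I i g))).comp ((chartHom I i).comp MvPolynomial.C)))) := by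
    rw [← subschemeBasic_toSpec, ← h2, Category.assoc]
    infer_instance
  exact HasRingHomProperty.Spec_iff.1 h4

end LocalStructure

end

end KleinEPW

namespace KleinEPW

noncomputable section

/-! ### The affine charts of the degeneracy loci -/

section AffineCharts

theorem isHomogeneous_degeneracyIdeal (A : Submodule ℂ (⋀[ℂ]^3 V6)) (l : ℕ) :
    (degeneracyIdeal A l).IsHomogeneous grading := by
  refine Ideal.homogeneous_span _ _ ?_
  rintro _ ⟨φ, w, rfl⟩
  refine ⟨11 - l, ?_⟩
  rw [Matrix.det_apply]
  refine sum_mem fun σ _ => ?_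
  rw [Units.smul_def]
  refine zsmul_mem ?_ _
  have h := MvPolynomial.IsHomogeneous.prod Finset.univ
    (fun b => Matrix.of (fun a b => pairing A (φ a) (w b)) (σ b) b) (fun _ => 1) fun b _ => ?_
  · simpa using h
  · change (∑ n : Fin 6, MvPolynomial.C (φ (σ b) (A.mkQ (wedge (e n) (w b)))) *
      MvPolynomial.X n : CoordRing).IsHomogeneous 1
    refine MvPolynomial.IsHomogeneous.sum _ _ _ fun n _ => ?_
    have := (MvPolynomial.isHomogeneous_C (Fin 6)
      (φ (σ b) (A.mkQ (wedge (e n) (w b))))).mul (MvPolynomial.isHomogeneous_X ℂ n)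
    simpa using this

theorem affineIdeal_le_pointIdeal_iff {I : Ideal CoordRing} {i : Fin 6} {p : Fin 6 → ℂ} :
    affineIdeal I i ≤ pointIdeal p ↔ I ≤ pointIdeal p ∧ p i = 1 := by
  rw [affineIdeal, sup_le_iff, Ideal.span_le, Set.singleton_subset_iff, SetLike.mem_coe,
    RingHom.mem_ker, map_sub, MvPolynomial.eval_X, map_one, sub_eq_zero]

theorem ne_zero_of_apply_eq_one {p : Fin 6 → ℂ} {i : Fin 6} (h : p i = 1) : p ≠ 0 := by
  rintro rfl
  exact zero_ne_one h

/-- Modulo xᵢ - 1 the coordinate xᵢ is a unit, so `map_degeneracyIdeal_one` applies to the quotient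
map. -/
theorem affineIdeal_degeneracyIdeal_one (i : Fin 6) :
    affineIdeal (degeneracyIdeal kleinLagrangian 1) i = affineIdeal (Ideal.span {kleinSextic}) i := by
  let m := Ideal.Quotient.mk (Ideal.span {(MvPolynomial.X i - 1 : CoordRing)})
  have h : ∀ I : Ideal CoordRing, affineIdeal I i = (I.map m).comap m := by
    intro I
    rw [Ideal.comap_map_of_surjective m Ideal.Quotient.mk_surjective]
    change _ = I ⊔ RingHom.ker m
    rw [Ideal.mk_ker]
    rfl
  rw [h, h, map_degeneracyIdeal_one m i]
  have : m (MvPolynomial.X i) = 1 := by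
    rw [← map_one m]
    exact Ideal.Quotient.eq.2 (Ideal.mem_span_singleton_self _)
  rw [this]
  exact isUnit_one

theorem affineIdeal_degeneracyIdeal_three (i : Fin 6) :
    affineIdeal (degeneracyIdeal kleinLagrangian 3) i = ⊤ := by
  by_contra h
  obtain ⟨M, hM, hle⟩ := Ideal.exists_le_maximal _ h
  obtain ⟨p, rfl⟩ := exists_pointIdeal_eq hM
  rw [affineIdeal_le_pointIdeal_iff] at hle
  exact ne_zero_of_apply_eq_one hle.2 (degeneracyIdeal_three_le hle.1)

theorem singIdeal_le_of_affineIdeal_le {P : Ideal CoordRing} (hP : P.IsPrime) {i : Fin 6}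
    (h : affineIdeal (degeneracyIdeal kleinLagrangian 2) i ≤ P) : singIdeal ≤ P := by
  intro f hf
  refine mem_of_vanishing hP h fun p hp => ?_
  rw [affineIdeal_le_pointIdeal_iff] at hp
  have h0 := ne_zero_of_apply_eq_one hp.2
  exact mem_singIdeal.1 hf p h0 ((degeneracyIdeal_two_le_iff h0).1 hp.1)

theorem dd_single (j : Fin 6) (f : CoordRing) :
    dd (Pi.single j 1) f = MvPolynomial.pderiv j f := by
  have : dd (Pi.single j 1) = MvPolynomial.pderiv j := by
    refine MvPolynomial.derivation_ext fun n => ?_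
    rw [dd_X, MvPolynomial.pderiv_X]
    by_cases h : n = j
    · subst h; simp
    · simp [h]
  rw [this]

theorem derivation_eq_sum {M : Type*} [AddCommGroup M] [Module ℂ M] [Module CoordRing M]
    [IsScalarTower ℂ CoordRing M]
    (D : Derivation ℂ CoordRing M) (f : CoordRing) :
    D f = ∑ j, MvPolynomial.pderiv j f • D (MvPolynomial.X j) := by
  have hsum : ∀ (E : Fin 6 → Derivation ℂ CoordRing M) (g : CoordRing),
      (∑ j, E j) g = ∑ j, E j g := fun E g => by
    have := congrFun (map_sum (Derivation.coeFnAddMonoidHom (R := ℂ)) E Finset.univ) g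
    rw [Finset.sum_apply] at this
    exact this
  have : D = ∑ j, (LinearMap.toSpanSingleton CoordRing M (D (MvPolynomial.X j))).compDer
      (MvPolynomial.pderiv j : Derivation ℂ CoordRing CoordRing) := by
    refine MvPolynomial.derivation_ext fun n => ?_
    rw [hsum]
    simp [MvPolynomial.pderiv_X, Pi.single_apply]
  conv_lhs => rw [this]
  rw [hsum]
  simp

theorem eval_dd_eq_sum (p t : Fin 6 → ℂ) (f : CoordRing) : MvPolynomial.eval p (dd t f) =
    ∑ j, t j * MvPolynomial.eval p (MvPolynomial.pderiv j f) := by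
  rw [derivation_eq_sum (dd t) f, map_sum]
  refine Finset.sum_congr rfl fun j _ => ?_
  rw [dd_X, smul_eq_mul, map_mul, MvPolynomial.eval_C, mul_comm]

theorem euler_kleinSextic (p : Fin 6 → ℂ) :
    ∑ j, p j * MvPolynomial.eval p (MvPolynomial.pderiv j kleinSextic) =
      6 * MvPolynomial.eval p kleinSextic := by
  rw [← eval_dd_eq_sum, eval_dd_kleinSextic, eval_kleinSextic]
  simp only [sexticForm, grad0, grad1]
  ring

/-- Where pᵢ = 1 and F = 0, Euler's relation recovers the i-th partial from the others. -/
theorem isSing_of_forall_ne {p : Fin 6 → ℂ} {i : Fin 6} (hp : p i = 1)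
    (h0 : MvPolynomial.eval p kleinSextic = 0)
    (h : ∀ j, j ≠ i → MvPolynomial.eval p (MvPolynomial.pderiv j kleinSextic) = 0) : IsSing p := by
  have hall : ∀ j, MvPolynomial.eval p (MvPolynomial.pderiv j kleinSextic) = 0 := by
    intro j
    by_cases hj : j = i
    · have := euler_kleinSextic p
      rw [Finset.sum_eq_single i (fun k _ hk => by rw [h k hk, mul_zero]) (by simp), hp, h0,
        one_mul, mul_zero] at this
      rw [hj, this]
    · exact h j hj
  rw [isSing_iff]
  intro t
  rw [eval_dd_eq_sum]
  exact Finset.sum_eq_zero fun j _ => by rw [hall, mul_zero]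

theorem exists_pderiv_notMem {P : Ideal CoordRing} (hP : P.IsPrime) {i : Fin 6}
    (h : affineIdeal (Ideal.span {kleinSextic}) i ≤ P) (hs : ¬ singIdeal ≤ P) :
    ∃ j, j ≠ i ∧ MvPolynomial.pderiv j kleinSextic ∉ P := by
  by_contra! hall
  refine hs fun f hf => ?_
  let J := affineIdeal (Ideal.span {kleinSextic}) i ⊔
    Ideal.span {f | ∃ j, j ≠ i ∧ f = MvPolynomial.pderiv j kleinSextic}
  have hJ : J ≤ P := by
    refine sup_le h (Ideal.span_le.2 ?_)
    rintro _ ⟨j, hj, rfl⟩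
    exact hall j hj
  refine mem_of_vanishing hP hJ fun p hp => ?_
  obtain ⟨h1, h2⟩ := sup_le_iff.1 hp
  rw [affineIdeal_le_pointIdeal_iff] at h1
  refine mem_singIdeal.1 hf p (ne_zero_of_apply_eq_one h1.2) (isSing_of_forall_ne h1.2 ?_ ?_)
  · exact h1.1 (Ideal.mem_span_singleton_self _)
  · exact fun j hj => h2 (Ideal.subset_span ⟨j, hj, rfl⟩)

theorem exists_isSing_eval_ne_zero {P : Ideal CoordRing} (hP : P.IsPrime) {i : Fin 6}
    (h : affineIdeal (degeneracyIdeal kleinLagrangian 2) i ≤ P) {g : CoordRing} (hg : g ∉ P) :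
    ∃ p : Fin 6 → ℂ, p i = 1 ∧ IsSing p ∧ MvPolynomial.eval p g ≠ 0 := by
  by_contra! hall
  refine hg (mem_of_vanishing hP h fun p hp => ?_)
  rw [affineIdeal_le_pointIdeal_iff] at hp
  exact hall p hp.2 ((degeneracyIdeal_two_le_iff (ne_zero_of_apply_eq_one hp.2)).1 hp.1)

/-- The Jacobian of (xᵢ - 1, F) with respect to (xᵢ, xⱼ) is triangular with determinant ∂ⱼF. -/
theorem isStandardSmooth_sextic {i j : Fin 6} (hj : j ≠ i) {R T : Type} [CommRing R] [CommRing T]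
    [Algebra R T] (π : CoordRing →+* R) (hπ : Function.Surjective π)
    (hker : ∀ f, π f = 0 ↔ f ∈ affineIdeal (Ideal.span {kleinSextic}) i)
    [IsLocalization.Away (π (MvPolynomial.pderiv j kleinSextic)) T] :
    ((algebraMap R T).comp
      (π.comp MvPolynomial.C)).IsStandardSmoothOfRelativeDimension 4 := by
  have hspan : affineIdeal (Ideal.span {kleinSextic}) i =
      Ideal.span (Set.range ![MvPolynomial.X i - 1, kleinSextic]) := by
    rw [affineIdeal, sup_comm, ← Ideal.span_union]
    congr 1
    ext f
    simp
  refine isStandardSmoothOfRelativeDimension_of_isUnit_jacobian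
    ![MvPolynomial.X i - 1, kleinSextic] ![i, j] ?_ (J := affineIdeal (Ideal.span {kleinSextic}) i)
    (g := MvPolynomial.pderiv j kleinSextic) ?_ ?_ ?_ π hπ hker
  · intro a b hab
    fin_cases a <;> fin_cases b <;> simp_all
  · exact fun t => ⟨0, by rw [hspan]; exact Ideal.mul_mem_left _ _ (Ideal.subset_span ⟨t, rfl⟩)⟩
  · exact fun f hf => ⟨0, by rw [← hspan]; exact Ideal.mul_mem_left _ _ hf⟩
  · rw [Matrix.det_fin_two]
    simp [MvPolynomial.pderiv_X, hj.symm]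

/-- A closed point p in the closure of P supplies the local equations; a function nonzero at p is
not in P, so the open set found at p also contains P. -/
theorem exists_isStandardSmooth {P : Ideal CoordRing} (hP : P.IsPrime) {i : Fin 6}
    (h : affineIdeal (degeneracyIdeal kleinLagrangian 2) i ≤ P) :
    ∃ g ∉ P, ∀ {R T : Type} [CommRing R] [CommRing T]
      [Algebra R T] (π : CoordRing →+* R) (_ : Function.Surjective π)
      (_ : ∀ f, π f = 0 ↔ f ∈ affineIdeal (degeneracyIdeal kleinLagrangian 2) i)
      [IsLocalization.Away (π g) T], ((algebraMap R T).comp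
        (π.comp MvPolynomial.C)).IsStandardSmoothOfRelativeDimension 2 := by
  obtain ⟨M, hM, hle⟩ := Ideal.exists_le_maximal _ hP.ne_top
  obtain ⟨p, rfl⟩ := exists_pointIdeal_eq hM
  obtain ⟨hI, hp⟩ := affineIdeal_le_pointIdeal_iff.1 (h.trans hle)
  obtain ⟨E⟩ := nonempty_localEquations (ne_zero_of_apply_eq_one hp) hI
  let v : Fin 4 → CoordRing := Fin.cons (MvPolynomial.X i - 1) E.f
  let Θ : Fin 4 → Fin 6 → ℂ := Fin.cons (Pi.single i 1) E.θ
  -- By Euler's relation the three differentials vanish on the vector p, whereas dxᵢ takes the value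
  -- pᵢ = 1 there.
  have hΘ : LinearIndependent ℂ Θ := by
    refine linearIndependent_finCons.2 ⟨E.indep, fun hmem => ?_⟩
    have h1 : Submodule.span ℂ (Set.range E.θ) ≤ LinearMap.ker (Fintype.linearCombination ℂ p) := by
      rw [Submodule.span_le]
      rintro _ ⟨a, rfl⟩
      rw [SetLike.mem_coe, LinearMap.mem_ker, Fintype.linearCombination_apply, ← E.euler a]
      exact Finset.sum_congr rfl fun n _ => by rw [smul_eq_mul, mul_comm]
    have h2 := h1 hmem
    rw [LinearMap.mem_ker, Fintype.linearCombination_apply,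
      Finset.sum_eq_single i (fun n _ hn => by simp [hn]) (by simp)] at h2
    simp [hp] at h2
  obtain ⟨σ, hσ⟩ := exists_det_submatrix_ne_zero Θ hΘ
  have hinj : Function.Injective σ := by
    intro a b hab
    by_contra hne
    exact hσ (Matrix.det_zero_of_column_eq hne fun k => by simp [hab])
  have hv : ∀ s t, MvPolynomial.eval p (MvPolynomial.pderiv s (v t)) = Θ t s := by
    intro s t
    refine Fin.cases ?_ (fun a => ?_) t
    · simp only [v, Θ, Fin.cons_zero, map_sub, MvPolynomial.pderiv_X, Derivation.map_one_eq_zero,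
        sub_zero]
      by_cases hs : s = i
      · subst hs; simp
      · simp [hs, Ne.symm hs]
    · simp only [v, Θ, Fin.cons_succ]
      rw [← dd_single, E.eval_dd_f, Finset.sum_eq_single s
        (fun n _ hn => by simp [hn]) (by simp)]
      simp
  set d := (Matrix.of fun s t => MvPolynomial.pderiv (σ s) (v t)).det with hd
  have hd0 : MvPolynomial.eval p d ≠ 0 := by
    rw [hd, RingHom.map_det, ← Matrix.det_transpose]
    convert hσ using 2
    ext s t
    exact hv _ _
  have hmap : ∀ f : CoordRing, algebraMap CoordRing (Localization.Away (E.h * d)) f ∈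
      (degeneracyIdeal kleinLagrangian 2).map (algebraMap _ _) ↔
      algebraMap CoordRing (Localization.Away (E.h * d)) f ∈
      (Ideal.span (Set.range E.f)).map (algebraMap _ _) := by
    intro f
    rw [E.map_eq _ (isUnit_of_dvd_unit (map_dvd _ (dvd_mul_right E.h d))
      (IsLocalization.Away.algebraMap_isUnit (E.h * d))), Ideal.map_span, Set.range_comp]
  refine ⟨E.h * d, fun hmem => ?_, ?_⟩
  · have := hle hmem
    rw [RingHom.mem_ker, map_mul] at this
    exact mul_ne_zero E.eval_h hd0 this
  · intro R T _ _ _ π hπ hker _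
    refine isStandardSmoothOfRelativeDimension_of_isUnit_jacobian v σ hinj
      (J := affineIdeal (degeneracyIdeal kleinLagrangian 2) i) (g := E.h * d) ?_ ?_ ?_ π hπ hker
    · intro t
      refine Fin.cases ⟨0, ?_⟩ (fun a => ?_) t
      · rw [pow_zero, one_mul]
        exact X_sub_one_mem _ i
      · have h1 := (hmap (E.f a)).2 (Ideal.mem_map_of_mem _ (Ideal.subset_span ⟨a, rfl⟩))
        obtain ⟨_, ⟨n, rfl⟩, hn⟩ := (IsLocalization.algebraMap_mem_map_algebraMap_iff
          (Submonoid.powers (E.h * d)) _ _ _).1 h1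
        exact ⟨n, Ideal.mem_sup_left hn⟩
    · intro f hf
      obtain ⟨f1, hf1, f2, hf2, rfl⟩ := Submodule.mem_sup.1 hf
      obtain ⟨_, ⟨n, rfl⟩, hn⟩ := (IsLocalization.algebraMap_mem_map_algebraMap_iff
        (Submonoid.powers (E.h * d)) _ _ _).1 ((hmap f1).1 (Ideal.mem_map_of_mem _ hf1))
      refine ⟨n, ?_⟩
      rw [mul_add]
      refine add_mem (Ideal.span_mono ?_ hn) (Ideal.mul_mem_left _ _ (Ideal.span_mono ?_ hf2))
      · rintro _ ⟨a, rfl⟩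
        exact ⟨a.succ, rfl⟩
      · rintro _ rfl
        exact ⟨0, rfl⟩
    · exact dvd_mul_left _ _

end AffineCharts

end

end KleinEPW

namespace KleinEPW

noncomputable section

/-! ### The singular points of the sextic -/

section Singular

/-- The sextic does not vanish on the hyperplane `xᵢ = 1`, even locally. -/
theorem mul_notMem_span_X_sub_one {i : Fin 6} {p : Fin 6 → ℂ} (hp : p i = 1) {s : CoordRing}
    (hs : MvPolynomial.eval p s ≠ 0) :
    s * kleinSextic ∉ Ideal.span {(MvPolynomial.X i - 1 : CoordRing)} := by
  intro hmem
  let ε : CoordRing →+* CoordRing := (MvPolynomial.aeval fun j =>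
    if j = i then 1 else MvPolynomial.X j : CoordRing →ₐ[ℂ] CoordRing).toRingHom
  have hε : ∀ q : Fin 6 → ℂ, q i = 1 → ∀ f, MvPolynomial.eval q (ε f) = MvPolynomial.eval q f := by
    intro q hq f
    have : (MvPolynomial.eval q).comp ε = MvPolynomial.eval q := by
      refine MvPolynomial.ringHom_ext (fun a => ?_) fun j => ?_
      · simp [ε]
      · by_cases hj : j = i
        · subst hj; simp [ε, hq]
        · simp [ε, hj]
    exact congrArg (fun φ => φ f) this
  have h1 : ε s * ε kleinSextic = 0 := by
    rw [← map_mul]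
    obtain ⟨c, hc⟩ := Ideal.mem_span_singleton.1 hmem
    rw [hc, map_mul, map_sub, map_one]
    simp [ε]
  rcases mul_eq_zero.1 h1 with h | h
  · exact hs (by rw [← hε p hp, h, map_zero])
  -- At the point with x₀ = xᵢ = 1 and other coordinates zero only x₀⁶ survives, so F is not zero on
  -- the hyperplane.
  · have h2 := hε (fun n => if n = i ∨ n = 0 then 1 else 0) (by simp) kleinSextic
    rw [h, map_zero, eval_kleinSextic] at h2
    fin_cases i <;> simp [sexticForm] at h2

theorem mem_span_of_mem_maximalIdeal_mul {L : Type*} [CommRing L] [IsLocalRing L] {a b : L}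
    (h : a ∈ IsLocalRing.maximalIdeal L * Ideal.span {a, b}) : a ∈ Ideal.span {b} := by
  rw [Ideal.span_insert, Ideal.mul_sup, Submodule.mem_sup] at h
  obtain ⟨_, h1, _, h2, h3⟩ := h
  obtain ⟨z, hz, rfl⟩ := Ideal.mem_mul_span_singleton.1 h1
  obtain ⟨w, -, rfl⟩ := Ideal.mem_mul_span_singleton.1 h2
  have hu : IsUnit (1 - z) := by
    by_contra hn
    have := (IsLocalRing.mem_maximalIdeal _).2 hn
    exact (Ideal.ne_top_iff_one _).1 (IsLocalRing.maximalIdeal.isMaximal L).ne_top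
      (by simpa using add_mem this hz)
  rw [← Ideal.unit_mul_mem_iff_mem _ hu]
  have : (1 - z) * a = w * b := by linear_combination -h3
  rw [this]
  exact Ideal.mul_mem_left _ _ (Ideal.mem_span_singleton_self _)

/-- A consequence of the lifting property of formally smooth algebras. -/
theorem mem_mul_of_smooth {J : Ideal CoordRing} {g : CoordRing} {R T B : Type} [CommRing R]
    [CommRing T] [Algebra R T] [CommRing B] (π : CoordRing →+* R) (hπ : Function.Surjective π)
    (hker : ∀ f, π f = 0 ↔ f ∈ J) [IsLocalization.Away (π g) T]
    (hsm : ((algebraMap R T).comp (π.comp MvPolynomial.C)).Smooth) (N : Ideal B) (hN : N ^ 2 = ⊥)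
    (can : CoordRing →+* B) (hJ : ∀ f ∈ J, can f ∈ N) (hg : IsUnit (can g)) {f : CoordRing}
    (hf : f ∈ J) (m : Ideal B) (hm : ∀ j, can (MvPolynomial.pderiv j f) ∈ m) : can f ∈ m * N := by
  algebraize [(algebraMap R T).comp (π.comp MvPolynomial.C), can, can.comp MvPolynomial.C]
  have hfs : Algebra.FormallySmooth ℂ T := hsm.formallySmooth
  have hker' : RingHom.ker π ≤ RingHom.ker ((Ideal.Quotient.mk N).comp can) := by
    intro f hf
    exact Ideal.Quotient.eq_zero_iff_mem.2 (hJ f ((hker f).1 hf))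
  let ρ0 : R →+* B ⧸ N := RingHom.liftOfSurjective π hπ ⟨_, hker'⟩
  have hρ0 : ∀ f, ρ0 (π f) = Ideal.Quotient.mk N (can f) := fun f =>
    RingHom.liftOfRightInverse_comp_apply _ _ _ ⟨(Ideal.Quotient.mk N).comp can, hker'⟩ f
  have hgu : IsUnit (ρ0 (π g)) := by
    rw [hρ0]
    exact hg.map (Ideal.Quotient.mk N)
  let ρ : T →+* B ⧸ N := IsLocalization.Away.lift (π g) hgu
  have hρ : ∀ f, ρ (algebraMap R T (π f)) = Ideal.Quotient.mk N (can f) := fun f =>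
    (IsLocalization.Away.lift_eq _ _ _).trans (hρ0 f)
  let ρA : T →ₐ[ℂ] B ⧸ N := ⟨ρ, fun z => hρ (MvPolynomial.C z)⟩
  have hNil : IsNilpotent N := ⟨2, hN⟩
  -- The lift, composed with the map from the polynomial ring, agrees with `can` modulo N. As N² =
  -- 0, the difference of the two ring homomorphisms is a derivation with values in N.
  let σ : T →ₐ[ℂ] B := Algebra.FormallySmooth.lift N hNil ρA
  have hσ : ∀ t, Ideal.Quotient.mk N (σ t) = ρ t := Algebra.FormallySmooth.mk_lift N hNil ρA
  let τ : CoordRing → B := fun f => σ (algebraMap R T (π f))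
  have hτN : ∀ f, τ f - can f ∈ N := fun f => by
    rw [← Ideal.Quotient.eq, hσ, hρ]
  have hτmul : ∀ f f', τ (f * f') = τ f * τ f' := fun f f' => by simp [τ]
  have hNN : ∀ {a b : B}, a ∈ N → b ∈ N → a * b = 0 := fun ha hb => by
    have := Ideal.mul_mem_mul ha hb
    rw [← pow_two, hN] at this
    exact this
  have hτC : ∀ z, τ (MvPolynomial.C z) = algebraMap ℂ B z := fun z => σ.commutes z
  let δ : CoordRing →ₗ[ℂ] B :=
    { toFun := fun f => τ f - can f
      map_add' := fun f f' => by
        simp only [τ, map_add]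
        ring
      map_smul' := fun z f => by
        rw [MvPolynomial.smul_eq_C_mul, hτmul, map_mul, hτC, RingHom.id_apply, Algebra.smul_def]
        have : can (MvPolynomial.C z) = algebraMap ℂ B z := rfl
        rw [this]
        ring }
  have hsmul : ∀ (u : CoordRing) (b : B), u • b = can u * b := fun u b => Algebra.smul_def u b
  let D : Derivation ℂ CoordRing B := Derivation.mk' δ fun f f' => by
    have h2 := hNN (hτN f) (hτN f')
    rw [hsmul, hsmul]
    change τ (f * f') - can (f * f') = can f * (τ f' - can f') + can f' * (τ f - can f)
    rw [hτmul, map_mul]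
    linear_combination h2
  -- D f is the sum of the ∂ⱼf · D xⱼ, with first factors in m and second factors in N. The lift
  -- kills f, so D f is also -can f.
  have hD : D f ∈ m * N := by
    rw [derivation_eq_sum D]
    refine sum_mem fun j _ => ?_
    rw [hsmul]
    exact Ideal.mul_mem_mul (hm j) (hτN _)
  have h3 : D f = - can f := by
    have h4 : τ f = 0 := by simp [τ, (hker f).2 hf]
    change τ f - can f = _
    rw [h4, zero_sub]
  rw [h3] at hD
  exact neg_mem_iff.1 hD

theorem map_mk_pow_two {L : Type*} [CommRing L] (K : Ideal L) :
    K.map (Ideal.Quotient.mk (K ^ 2)) ^ 2 = ⊥ := by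
  rw [← Ideal.map_pow, Ideal.map_quotient_self]

theorem mem_of_mk_mem_map {L : Type*} [CommRing L] {K m : Ideal L} (hK : K ≤ m) {a : L}
    (h : Ideal.Quotient.mk (K ^ 2) a ∈ m.map (Ideal.Quotient.mk (K ^ 2)) *
      K.map (Ideal.Quotient.mk (K ^ 2))) : a ∈ m * K := by
  rw [← Ideal.map_mul, Ideal.mem_map_iff_of_surjective _ Ideal.Quotient.mk_surjective] at h
  obtain ⟨b, hb, heq⟩ := h
  have h1 : b - a ∈ K ^ 2 := Ideal.Quotient.eq.1 heq
  rw [pow_two] at h1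
  have := sub_mem hb (Ideal.mul_mono_left hK h1)
  rwa [sub_sub_cancel] at this

/-- With L the local ring at p, 𝔪 its maximal ideal and K = (F, xᵢ - 1), the lifting property
applied to L/K² gives F ∈ 𝔪K, since the partials of F vanish at p. Then F is locally a multiple of
xᵢ - 1, although it is not zero on that hyperplane. -/
theorem not_smooth_of_isSing {i : Fin 6} {p : Fin 6 → ℂ} (hp : p i = 1) (hs : IsSing p)
    {g : CoordRing} (hg : MvPolynomial.eval p g ≠ 0) {R T : Type} [CommRing R] [CommRing T]
    [Algebra R T] (π : CoordRing →+* R) (hπ : Function.Surjective π)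
    (hker : ∀ f, π f = 0 ↔ f ∈ affineIdeal (Ideal.span {kleinSextic}) i)
    [IsLocalization.Away (π g) T] :
    ¬ ((algebraMap R T).comp (π.comp MvPolynomial.C)).Smooth := by
  intro hsm
  let ℓ := algebraMap CoordRing (Localization.AtPrime (pointIdeal p))
  let m := IsLocalRing.maximalIdeal (Localization.AtPrime (pointIdeal p))
  let K : Ideal (Localization.AtPrime (pointIdeal p)) :=
    Ideal.span {ℓ kleinSextic, ℓ (MvPolynomial.X i - 1)}
  have hm : ∀ f : CoordRing, MvPolynomial.eval p f = 0 → ℓ f ∈ m :=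
    fun f hf => (IsLocalization.AtPrime.to_map_mem_maximal_iff _ (pointIdeal p) f).2 hf
  have hKm : K ≤ m := by
    refine Ideal.span_le.2 ?_
    rintro _ (rfl | rfl)
    · exact hm _ hs.eval_eq_zero
    · exact hm _ (by simp [hp])
  have hJ : affineIdeal (Ideal.span {kleinSextic}) i ≤ K.comap ℓ := by
    rw [affineIdeal, ← Ideal.span_union, Ideal.span_le]
    rintro _ (rfl | rfl) <;> exact Ideal.subset_span (by simp)
  have hgu : IsUnit (ℓ g) :=
    (IsLocalization.AtPrime.isUnit_to_map_iff _ (pointIdeal p) g).2 hg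
  have hF : ℓ kleinSextic ∈ m * K := by
    refine mem_of_mk_mem_map hKm (mem_mul_of_smooth π hπ hker hsm _ (map_mk_pow_two K)
      ((Ideal.Quotient.mk (K ^ 2)).comp ℓ) (fun f hf => Ideal.mem_map_of_mem _ (hJ hf))
      (hgu.map (Ideal.Quotient.mk (K ^ 2)))
      (Ideal.mem_sup_left (Ideal.mem_span_singleton_self _)) _ fun j => ?_)
    refine Ideal.mem_map_of_mem _ (hm _ ?_)
    rw [← dd_single]
    exact isSing_iff.1 hs _
  have hF' : ℓ kleinSextic ∈ (Ideal.span {(MvPolynomial.X i - 1 : CoordRing)}).map ℓ := by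
    rw [Ideal.map_span, Set.image_singleton]
    exact mem_span_of_mem_maximalIdeal_mul hF
  obtain ⟨s, hs1, hs2⟩ := (IsLocalization.algebraMap_mem_map_algebraMap_iff
    (pointIdeal p).primeCompl _ _ _).1 hF'
  exact mul_notMem_span_X_sub_one hp hs1 hs2

end Singular

end

end KleinEPW

namespace KleinEPW

noncomputable section

/-! ### The degeneracy loci of the Klein Lagrangian -/

section DegeneracyLoci

/-- The ideal of a point of a chart, in homogeneous coordinates. -/
def chartPoint (I : Ideal CoordRing) (i : Fin 6)
    (w : Spec (CommRingCat.of (ChartRing i ⧸ chartIdeal I i))) : Ideal CoordRing :=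
  w.asIdeal.comap (chartHom I i)

theorem isPrime_chartPoint (I : Ideal CoordRing) (i : Fin 6)
    (w : Spec (CommRingCat.of (ChartRing i ⧸ chartIdeal I i))) : (chartPoint I i w).IsPrime := by
  have := w.isPrime
  exact Ideal.comap_isPrime _ _

theorem affineIdeal_le_chartPoint {I : Ideal CoordRing} (hI : I.IsHomogeneous grading) (i : Fin 6)
    (w : Spec (CommRingCat.of (ChartRing i ⧸ chartIdeal I i))) :
    affineIdeal I i ≤ chartPoint I i w := fun f hf => by
  rw [chartPoint, Ideal.mem_comap, (chartHom_eq_zero_iff hI i).2 hf]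
  exact zero_mem _

theorem mem_range_subschemeι_iff_le_chartPoint (I : Ideal CoordRing) {J : Ideal CoordRing}
    (hJ : J.IsHomogeneous grading) (i : Fin 6)
    (w : Spec (CommRingCat.of (ChartRing i ⧸ chartIdeal I i))) :
    (idealSheaf I).subschemeι (subschemeChart I i w) ∈ Set.range (idealSheaf J).subschemeι ↔
      J ≤ chartPoint I i w := by
  rw [mem_range_subschemeι_iff hJ, subschemeι_subschemeChart, le_awayι_iff _ _ hJ]
  rfl

theorem isEmpty_subscheme_degeneracyIdeal_three :
    IsEmpty (idealSheaf (degeneracyIdeal kleinLagrangian 3)).subscheme := by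
  refine ⟨fun x => ?_⟩
  obtain ⟨i, w, rfl⟩ := exists_subschemeChart _ x
  have h := affineIdeal_le_chartPoint (isHomogeneous_degeneracyIdeal kleinLagrangian 3) i w
  rw [affineIdeal_degeneracyIdeal_three, top_le_iff] at h
  exact (isPrime_chartPoint _ i w).ne_top h

theorem singIdeal_le_iff (x : P5) : singIdeal ≤ x.asHomogeneousIdeal.toIdeal ↔
    degeneracyIdeal kleinLagrangian 2 ≤ x.asHomogeneousIdeal.toIdeal := by
  refine ⟨degeneracyIdeal_two_le_singIdeal.trans, ?_⟩
  obtain ⟨i, y, rfl⟩ := exists_awayι_eq x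
  rw [le_awayι_iff _ _ isHomogeneous_singIdeal,
    le_awayι_iff _ _ (isHomogeneous_degeneracyIdeal _ _)]
  intro h
  have hP : (y.asIdeal.comap (dehom i)).IsPrime := by
    have := y.isPrime
    exact Ideal.comap_isPrime _ _
  refine singIdeal_le_of_affineIdeal_le hP (i := i) (sup_le h ?_)
  rw [Ideal.span_le, Set.singleton_subset_iff, SetLike.mem_coe, Ideal.mem_comap, map_sub,
    dehom_X_self, map_one, sub_self]
  exact zero_mem _

/-- The generic point of the surface `Y_A^{≥ 2}`. -/
def singPoint : P5 where
  asHomogeneousIdeal := ⟨singIdeal, isHomogeneous_singIdeal⟩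
  isPrime := isPrime_singIdeal
  not_irrelevant_le h := by
    have h1 : (MvPolynomial.X 1 : CoordRing) ∈ singIdeal := by
      refine h ((HomogeneousIdeal.mem_irrelevant_iff _ _).2 ?_)
      rw [GradedRing.proj_apply]
      exact DirectSum.decompose_of_mem_ne grading (X_mem_grading 1) one_ne_zero
    have h2 := mem_singIdeal.1 h1 (Pi.single 1 1) (by simp) (isSing_single one_ne_zero 1)
    simp at h2

/-- The prime `singIdeal` defines a point of the scheme that specializes to every other point, so
any two nonempty open sets share it. -/
theorem irreducibleSpace_subscheme_degeneracyIdeal_two :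
    IrreducibleSpace (idealSheaf (degeneracyIdeal kleinLagrangian 2)).subscheme := by
  have hI := isHomogeneous_degeneracyIdeal kleinLagrangian 2
  obtain ⟨η, hη⟩ := (mem_range_subschemeι_iff hI singPoint).2 degeneracyIdeal_two_le_singIdeal
  have hspec : ∀ z, η ⤳ z := by
    intro z
    rw [← (idealSheaf (degeneracyIdeal kleinLagrangian 2)).subschemeι.isEmbedding.isInducing.specializes_iff,
      hη, specializes_iff_mem_closure]
    refine (ProjectiveSpectrum.le_iff_mem_closure grading _ _).1 ?_
    exact (singIdeal_le_iff _).2 ((mem_range_subschemeι_iff hI _).1 ⟨z, rfl⟩)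
  have : PreirreducibleSpace (idealSheaf (degeneracyIdeal kleinLagrangian 2)).subscheme := by
    refine PreirreducibleSpace.of_forall_nonempty_inter ?_
    rintro U V hU hV ⟨u, hu⟩ ⟨v, hv⟩
    exact ⟨η, (hspec u).mem_open hU hu, (hspec v).mem_open hV hv⟩
  exact ⟨⟨η⟩⟩

theorem isZariskiLocalAtSource_smoothOfRelativeDimension (n : ℕ) :
    IsZariskiLocalAtSource (@SmoothOfRelativeDimension.{0} n) :=
  HasRingHomProperty.instIsZariskiLocalAtSource

theorem respectsIso_smoothOfRelativeDimension (n : ℕ) :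
    MorphismProperty.RespectsIso (@SmoothOfRelativeDimension.{0} n) := by
  have := isZariskiLocalAtSource_smoothOfRelativeDimension n
  exact MorphismProperty.IsLocalAtSource.toRespects Scheme.zariskiPrecoverage

theorem smoothOfRelativeDimension_subscheme_degeneracyIdeal_two : SmoothOfRelativeDimension 2
    ((idealSheaf (degeneracyIdeal kleinLagrangian 2)).subschemeι ≫ P5.toSpec) := by
  have hI := isHomogeneous_degeneracyIdeal kleinLagrangian 2
  have hloc := isZariskiLocalAtSource_smoothOfRelativeDimension 2
  have hiso := respectsIso_smoothOfRelativeDimension 2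
  have key : ∀ x, ∃ U : (idealSheaf (degeneracyIdeal kleinLagrangian 2)).subscheme.Opens, x ∈ U ∧
      SmoothOfRelativeDimension 2 (U.ι ≫
        (idealSheaf (degeneracyIdeal kleinLagrangian 2)).subschemeι ≫ P5.toSpec) := by
    intro x
    obtain ⟨i, w, rfl⟩ := exists_subschemeChart _ x
    obtain ⟨g, hg, h⟩ := exists_isStandardSmooth (isPrime_chartPoint _ i w)
      (affineIdeal_le_chartPoint hI i w)
    refine exists_opens_of_subschemeBasic (@SmoothOfRelativeDimension 2) _ i g ?_ w hg
    refine HasRingHomProperty.Spec_iff.2 (RingHom.locally_of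
      RingHom.isStandardSmoothOfRelativeDimension_respectsIso _ ?_)
    exact h (chartHom _ i) (chartHom_surjective _ i) fun f => chartHom_eq_zero_iff hI i
  choose U hxU hU using key
  exact hloc.of_iSup_eq_top (P := @SmoothOfRelativeDimension 2) U
    (top_le_iff.1 fun x _ => TopologicalSpace.Opens.mem_iSup.2 ⟨x, hxU x⟩) hU

/-- Off the corank-two locus some partial ∂ⱼF with j ≠ i is invertible and the Jacobian criterion
applies. At a point of that locus, any neighbourhood assumed smooth contains a closed singular point
of F, where `not_smooth_of_isSing` applies. -/
theorem singularLocus_subscheme_degeneracyIdeal_one :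
    singularLocus ((idealSheaf (degeneracyIdeal kleinLagrangian 1)).subschemeι ≫ P5.toSpec) =
      (idealSheaf (degeneracyIdeal kleinLagrangian 1)).subschemeι ⁻¹'
        Set.range (idealSheaf (degeneracyIdeal kleinLagrangian 2)).subschemeι := by
  have hI := isHomogeneous_degeneracyIdeal kleinLagrangian 1
  ext x
  obtain ⟨i, w, rfl⟩ := exists_subschemeChart _ x
  have hP := isPrime_chartPoint _ i w
  have hle := affineIdeal_le_chartPoint hI i w
  have hker : ∀ f, chartHom (degeneracyIdeal kleinLagrangian 1) i f = 0 ↔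
      f ∈ affineIdeal (Ideal.span {kleinSextic}) i := fun f => by
    rw [chartHom_eq_zero_iff hI i, affineIdeal_degeneracyIdeal_one]
  rw [Set.mem_preimage, mem_range_subschemeι_iff_le_chartPoint _
    (isHomogeneous_degeneracyIdeal kleinLagrangian 2)]
  change (¬ ∃ U : (idealSheaf (degeneracyIdeal kleinLagrangian 1)).subscheme.Opens, _) ↔ _
  constructor
  · intro h
    by_contra hn
    refine h ?_
    rw [affineIdeal_degeneracyIdeal_one] at hle
    obtain ⟨j, hj, hjP⟩ := exists_pderiv_notMem hP hle
      fun hs => hn (degeneracyIdeal_two_le_singIdeal.trans hs)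
    have hiso := respectsIso_smoothOfRelativeDimension 4
    obtain ⟨U, hwU, hU⟩ := exists_opens_of_subschemeBasic (@SmoothOfRelativeDimension 4) _ i
      (MvPolynomial.pderiv j kleinSextic) (HasRingHomProperty.Spec_iff.2 (RingHom.locally_of
      RingHom.isStandardSmoothOfRelativeDimension_respectsIso _
      (isStandardSmooth_sextic hj (chartHom _ i) (chartHom_surjective _ i) hker))) w hjP
    exact ⟨U, hwU, hU.smooth⟩
  · rintro h ⟨U, hwU, hU⟩
    obtain ⟨g, hg, hsm⟩ := exists_smooth_subschemeBasic _ i w U hwU hU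
    have h2 : affineIdeal (degeneracyIdeal kleinLagrangian 2) i ≤ chartPoint _ i w :=
      sup_le h (le_sup_right.trans hle)
    obtain ⟨p, hp, hs, hgp⟩ := exists_isSing_eval_ne_zero hP h2 hg
    exact not_smooth_of_isSing hp hs hgp (chartHom _ i) (chartHom_surjective _ i) hker hsm

end DegeneracyLoci

end

end KleinEPW

theorem mainTheorem10 :
    KleinEPW.idealSheaf (KleinEPW.degeneracyIdeal KleinEPW.kleinLagrangian 1) =
        KleinEPW.idealSheaf (Ideal.span {KleinEPW.kleinSextic}) ∧
      KleinEPW.singularLocus (KleinEPW.Y.toSpec KleinEPW.kleinLagrangian 1) =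
        KleinEPW.Y.emb KleinEPW.kleinLagrangian 1 ⁻¹'
          Set.range (KleinEPW.Y.emb KleinEPW.kleinLagrangian 2) ∧
      AlgebraicGeometry.SmoothOfRelativeDimension 2
        (KleinEPW.Y.toSpec KleinEPW.kleinLagrangian 2) ∧
      IrreducibleSpace (KleinEPW.Y KleinEPW.kleinLagrangian 2) ∧
      IsEmpty (KleinEPW.Y KleinEPW.kleinLagrangian 3) :=
  ⟨KleinEPW.idealSheaf_congr KleinEPW.chartIdeal_degeneracyIdeal_one,
    KleinEPW.singularLocus_subscheme_degeneracyIdeal_one,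
    KleinEPW.smoothOfRelativeDimension_subscheme_degeneracyIdeal_two,
    KleinEPW.irreducibleSpace_subscheme_degeneracyIdeal_two,
    KleinEPW.isEmpty_subscheme_degeneracyIdeal_three⟩
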